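/- **Dynamics.** Let $U$ be a normed space over $\mathbb R$ (the phase space), continuously and injectively embedded in a normed space $V$ (e.g. $V=U$), and let $F:\mathrm{dom}(F)\subseteq U\to V$ be a (possibly nonlinear and unbounded) operator. A solution of $$\frac{du}{dt}(t)=F(u(t)),\quad t\in(0,\infty),\qquad u(0)=u_0 \tag{1}$$ is a map $u$ that is continuous from $[0,\infty)$ to $U$ with $u(0)=u_0$ and such that for every $t>0$: $u(t)\in \mathrm{dom}(F)$, $u$ is differentiable at $t$ as a map into $V$, and (1) holds. Assume that (1) has exactly one solution for every $u_0\in U$, and let $S_t:U\to U$, $S_tu_0=u(t)$, $t\ge 0$, be the solution operators. A class $\mathcal N$ of maps $U\to U$ is said to *approximate trajectories* on $U$ if for all such $V,F$, every $h>0$ for which $S_h$ is locally Lipschitz, every compact $K\subset U$, every $n\in\mathbb N$ and every $\varepsilon>0$ there is $\hat S_h\in\mathcal N$ with $$\sup_{u_0\in K}\ \sup_{k\in\{1,\dots,n\}}\ \|u(kh)-\hat S_h^k(u_0)\|_{U}<\varepsilon ,$$ where $u(kh)=S_{kh}u_0$ and $\hat S_h^k$ is the $k$-fold composition. **Networks.**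 A feed-forward network with activation $\sigma:\mathbb R\to\mathbb R$ is an alternating composition of affine maps and componentwise applications of $\sigma$, beginning and ending with an affine map. A neural operator on functions $u:D\to\mathbb R^m$, $D\subset\mathbb R^d$, is given by a width $w$ and a composition of: a pointwise lifting $v_0(x)=P(u(x))\in\mathbb R^w$; finitely many layers $$v_{t+1}(x)=\sigma\Big(W_tv_t(x)+\int_D\kappa_t(x,y)v_t(y)\,dy+b_t(x)\Big);$$ and a pointwise projection $x\mapsto Q(v_T(x))\in\mathbb R^m$. Here $W_t$ are matrices, and $P,Q$, the matrix-valued kernels $\kappa_t$ and the biases $b_t$ are feed-forward networks with activation $\sigma$. A neural operator $X\to X$ on a space $X$ of functions on $D$ is such an architecture for which, for every input $u\in X$, all $v_t$ to which a layer is applied are integrable on $D$ and the output function belongs to $X$ (equality a.e.). **Theorem.** (a) Let $d,m,k\in\mathbb N_0$, let $D\subset\mathbb R^d$ be a bounded Lipschitz domain, and let $\sigma\in C^k(\mathbb R)$ not be a polynomial. Let $X$ be either * any Banach space of functions $D\to\mathbb R^m$ such that $X$ is continuously embedded in $L^1(D;\mathbb R^m)$, and the restrictions to $D$ of functions in $C^k(\mathbb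 R^d;\mathbb R^m)$ belong to $X$, satisfy $\|f|_D\|_X\le C\max_{j\le k}\sup_D\|D^jf\|$, and are dense in $X$; or * the Sobolev space $W^{k,p}(D;\mathbb R^m)$, $1\le p<\infty$ (for $k=0$ the space $L^p(D;\mathbb R^m)$). Then the neural operators $X\to X$ with activation $\sigma$ approximate trajectories on the phase space $X$. Moreover, if $U\subseteq X$ is a linear subspace (encoding, e.g., boundary conditions, zero mean or incompressibility) and $\pi:X\to U$ is a bounded linear projection onto $U$, then the maps $U\to U$ of the form $\pi\circ N|_U$, with $N:X\to X$ a neural operator with activation $\sigma$, approximate trajectories on the phase space $U$. (b) Let $d\in\mathbb N_0$ and let $\sigma:\mathbb R\to\mathbb R$ be continuous and not a polynomial. Then the feed-forward networks $\mathbb R^d\to\mathbb R^d$ with activation $\sigma$ approximate trajectories on the Euclidean phase space $\mathbb R^d$. -/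

import Mathlib

universe u v

open MeasureTheory Set
open scoped ENNReal NNReal ContDiff

/-! ## Feed-forward neural networks -/

/-- Feed-forward neural networks with `a` inputs and `b` outputs: an affine map, or an affine map
followed by the activation (applied to every component) followed by a network. -/
inductive FeedForward (b : ℕ) : ℕ → Type
  | affine {a : ℕ} (W : Matrix (Fin b) (Fin a) ℝ) (c : Fin b → ℝ) : FeedForward b a
  | layer {a h : ℕ} (W : Matrix (Fin h) (Fin a) ℝ) (c : Fin h → ℝ) (N : FeedForward b h) :
      FeedForward b a

/-- The function `ℝᵃ → ℝᵇ` computed by a network with activation `σ`. -/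
noncomputable def FeedForward.eval (σ : ℝ → ℝ) {b : ℕ} :
    {a : ℕ} → FeedForward b a → (Fin a → ℝ) → (Fin b → ℝ)
  | _, .affine W c, x => W.mulVec x + c
  | _, .layer W c N, x => N.eval σ (fun i => σ ((W.mulVec x + c) i))

/-- `σ` is not (the function of) a polynomial. -/
def IsNonpolynomial (σ : ℝ → ℝ) : Prop :=
  ¬ ∃ P : Polynomial ℝ, ∀ t, σ t = P.eval t

/-- The self-maps of `ℝᵈ` computed by feed-forward networks with activation `σ`. -/
def feedForwardMaps (σ : ℝ → ℝ) (d : ℕ) :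
    Set (EuclideanSpace ℝ (Fin d) → EuclideanSpace ℝ (Fin d)) :=
  {Φ | ∃ N : FeedForward d d, ∀ x, Φ x = WithLp.toLp 2 (N.eval σ x.ofLp)}

/-! ## Neural operators -/

/-- One layer of a neural operator on a domain in `ℝᵈ` with `w` channels: a pointwise linear map,
an integral operator whose matrix-valued kernel `κ(x, y)` is a neural network, and a bias function
which is a neural network. -/
structure OperatorLayer (d w : ℕ) where
  weight : Matrix (Fin w) (Fin w) ℝ
  kernel : FeedForward (w * w) (d + d)
  bias : FeedForward w d

/-- The action of a layer on a hidden function `v : D → ℝʷ`: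
`x ↦ σ (W v(x) + ∫_D κ(x, y) v(y) dy + b(x))`. -/
noncomputable def OperatorLayer.apply {d w : ℕ} (ℓ : OperatorLayer d w) (σ : ℝ → ℝ)
    (D : Set (EuclideanSpace ℝ (Fin d))) (v : EuclideanSpace ℝ (Fin d) → Fin w → ℝ) :
    EuclideanSpace ℝ (Fin d) → Fin w → ℝ :=
  fun x i => σ (ℓ.weight.mulVec (v x) i
    + (∫ y in D, ∑ j : Fin w,
        ℓ.kernel.eval σ (Fin.append x.ofLp y.ofLp) (finProdFinEquiv (i, j)) * v y j)
    + ℓ.bias.eval σ x.ofLp i)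

/-- The successive action of a list of layers. -/
noncomputable def applyLayers {d w : ℕ} (σ : ℝ → ℝ) (D : Set (EuclideanSpace ℝ (Fin d))) :
    List (OperatorLayer d w) → (EuclideanSpace ℝ (Fin d) → Fin w → ℝ) →
      (EuclideanSpace ℝ (Fin d) → Fin w → ℝ)
  | [], v => v
  | ℓ :: ls, v => applyLayers σ D ls (ℓ.apply σ D v)

/-- All hidden functions to which a layer is applied are integrable on `D`, so that the kernel
integrals are genuine integrals. -/
def LayersIntegrable {d w : ℕ} (σ : ℝ → ℝ) (D : Set (EuclideanSpace ℝ (Fin d))) :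
    List (OperatorLayer d w) → (EuclideanSpace ℝ (Fin d) → Fin w → ℝ) → Prop
  | [], _ => True
  | ℓ :: ls, v => IntegrableOn v D ∧ LayersIntegrable σ D ls (ℓ.apply σ D v)

/-- A neural operator architecture acting on functions `D → ℝᵐ`, `D ⊆ ℝᵈ`: a pointwise lifting
network, a list of kernel-integral layers, a pointwise projection network. -/
structure NeuralOperator (d m : ℕ) where
  width : ℕ
  lift : FeedForward width m
  layers : List (OperatorLayer d width)
  proj : FeedForward m width

/-- The lifted input function `x ↦ P (u x)`. -/
noncomputable def NeuralOperator.lifted {d m : ℕ} (N : NeuralOperator d m) (σ : ℝ → ℝ)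
    (u : EuclideanSpace ℝ (Fin d) → EuclideanSpace ℝ (Fin m)) :
    EuclideanSpace ℝ (Fin d) → Fin N.width → ℝ :=
  fun x => N.lift.eval σ (u x).ofLp

/-- The output function of a neural operator for the input function `u`. -/
noncomputable def NeuralOperator.eval {d m : ℕ} (N : NeuralOperator d m) (σ : ℝ → ℝ)
    (D : Set (EuclideanSpace ℝ (Fin d)))
    (u : EuclideanSpace ℝ (Fin d) → EuclideanSpace ℝ (Fin m)) :
    EuclideanSpace ℝ (Fin d) → EuclideanSpace ℝ (Fin m) :=
  fun x => WithLp.toLp 2 (N.proj.eval σ (applyLayers σ D N.layers (N.lifted σ u) x))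

/-- Let `X` be a space whose elements `u` are represented by functions `rep u : D → ℝᵐ` (up to
null sets). The self-maps of `X` that are given by a neural operator: for every input `u` in `X`
all kernel integrals exist and the output of the architecture represents the image of `u`. -/
def neuralOperatorMaps {d m : ℕ} (σ : ℝ → ℝ) (D : Set (EuclideanSpace ℝ (Fin d))) {X : Type*}
    (rep : X → EuclideanSpace ℝ (Fin d) → EuclideanSpace ℝ (Fin m)) : Set (X → X) :=
  {Φ | ∃ N : NeuralOperator d m, ∀ u : X,
    LayersIntegrable σ D N.layers (N.lifted σ (rep u)) ∧
    rep (Φ u) =ᵐ[volume.restrict D] N.eval σ D (rep u)}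

/-- For a subspace `U` of `X` onto which `π` projects (boundary conditions, mean zero,
incompressibility, ...): the self-maps of `U` obtained by applying a neural operator on `X`
and then `π`. -/
def projectedNeuralOperatorMaps {d m : ℕ} (σ : ℝ → ℝ) (D : Set (EuclideanSpace ℝ (Fin d)))
    {X : Type*} [NormedAddCommGroup X] [NormedSpace ℝ X]
    (rep : X → EuclideanSpace ℝ (Fin d) → EuclideanSpace ℝ (Fin m))
    (U : Submodule ℝ X) (π : X →L[ℝ] U) : Set (U → U) :=
  {Φ | ∃ N ∈ neuralOperatorMaps σ D rep, ∀ u : U, Φ u = π (N u)}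

/-! ## Lipschitz domains and function spaces -/

/-- Bounded Lipschitz domains: nonempty, connected, open, bounded, and near every boundary point,
in suitable orthogonal coordinates, the strict epigraph of a Lipschitz function. -/
structure IsLipschitzDomain {d : ℕ} (D : Set (EuclideanSpace ℝ (Fin d))) : Prop where
  isOpen : IsOpen D
  isConnected : IsConnected D
  isBounded : Bornology.IsBounded D
  boundary : ∀ x ∈ frontier D, ∃ ν : EuclideanSpace ℝ (Fin d), ‖ν‖ = 1 ∧
    ∃ r > 0, ∃ L : ℝ≥0, ∃ γ : ((ℝ ∙ ν)ᗮ : Submodule ℝ (EuclideanSpace ℝ (Fin d))) → ℝ,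
      LipschitzWith L γ ∧ ∀ y ∈ Metric.ball x r,
        (y ∈ D ↔ γ ((ℝ ∙ ν)ᗮ.orthogonalProjectionOnto y) < inner ℝ ν y)

/-- `X` (with `ι` sending an element to the function it is) is a space of functions `D → ℝᵐ`
of smoothness order at most `k`: it is continuously embedded in `L¹(D; ℝᵐ)`, and the functions of
class `Cᵏ` up to the boundary are continuously embedded in `X` and dense in `X`. -/
structure IsFunctionSpace {d m : ℕ} (k : ℕ) (D : Set (EuclideanSpace ℝ (Fin d)))
    {X : Type*} [NormedAddCommGroup X] [NormedSpace ℝ X]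
    (ι : X →L[ℝ] Lp (EuclideanSpace ℝ (Fin m)) 1 (volume.restrict D)) : Prop where
  injective : Function.Injective ι
  smooth_mem : ∃ C : ℝ, ∀ f : EuclideanSpace ℝ (Fin d) → EuclideanSpace ℝ (Fin m),
    ContDiff ℝ k f → ∃ u : X, ι u =ᵐ[volume.restrict D] f ∧
      ∀ B : ℝ, (∀ j ≤ k, ∀ x ∈ D, ‖iteratedFDeriv ℝ j f x‖ ≤ B) → ‖u‖ ≤ C * B
  smooth_dense : ∀ u : X, ∀ ε > 0,
    ∃ f : EuclideanSpace ℝ (Fin d) → EuclideanSpace ℝ (Fin m), ContDiff ℝ k f ∧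
      ∃ v : X, ι v =ᵐ[volume.restrict D] f ∧ ‖u - v‖ < ε

/-- Words `(i₁, …, iⱼ)`, `j ≤ k`, of coordinate indices: they index the partial derivatives
of order at most `k`. -/
abbrev DerivIndex (d k : ℕ) : Type := Σ j : Fin (k + 1), (Fin j → Fin d)

/-- The empty word. -/
def DerivIndex.zero (d k : ℕ) : DerivIndex d k := ⟨0, Fin.elim0⟩

/-- The partial derivative `∂_{i₁} ⋯ ∂_{iⱼ} φ` of a smooth function. -/
noncomputable def partialDeriv {d k : ℕ} (α : DerivIndex d k) (φ : EuclideanSpace ℝ (Fin d) → ℝ)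
    (x : EuclideanSpace ℝ (Fin d)) : ℝ :=
  iteratedFDeriv ℝ α.1 φ x (fun a => EuclideanSpace.single (α.2 a) 1)

/-- `g` is the weak derivative of `f` on `D` belonging to the word `α`. -/
def IsWeakDeriv {d m k : ℕ} (D : Set (EuclideanSpace ℝ (Fin d))) (α : DerivIndex d k)
    (f g : EuclideanSpace ℝ (Fin d) → EuclideanSpace ℝ (Fin m)) : Prop :=
  ∀ φ : EuclideanSpace ℝ (Fin d) → ℝ, ContDiff ℝ ∞ φ → HasCompactSupport φ → tsupport φ ⊆ D →
    ∫ x in D, partialDeriv α φ x • f x = (-1 : ℝ) ^ (α.1 : ℕ) • ∫ x in D, φ x • g x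

theorem integrable_test_smul {d m : ℕ} {D : Set (EuclideanSpace ℝ (Fin d))} {p : ℝ≥0∞}
    [hp : Fact (1 ≤ p)] (u : Lp (EuclideanSpace ℝ (Fin m)) p (volume.restrict D))
    {ψ : EuclideanSpace ℝ (Fin d) → ℝ} (hψ : Continuous ψ) (hc : HasCompactSupport ψ) :
    Integrable (fun x => ψ x • u x) (volume.restrict D) :=
  ((Lp.memLp u).locallyIntegrable hp.out).integrable_smul_left_of_hasCompactSupport hψ hc

theorem continuous_partialDeriv {d k : ℕ} (α : DerivIndex d k)
    {φ : EuclideanSpace ℝ (Fin d) → ℝ} (hφ : ContDiff ℝ ∞ φ) : Continuous (partialDeriv α φ) := by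
  have h := hφ.continuous_iteratedFDeriv (m := (α.1 : ℕ)) (by exact_mod_cast le_top)
  unfold partialDeriv
  fun_prop

theorem hasCompactSupport_partialDeriv {d k : ℕ} (α : DerivIndex d k)
    {φ : EuclideanSpace ℝ (Fin d) → ℝ} (hc : HasCompactSupport φ) :
    HasCompactSupport (partialDeriv α φ) := by
  refine (hc.iteratedFDeriv (𝕜 := ℝ) (α.1 : ℕ)).mono fun x hx => ?_
  simp only [Function.mem_support, ne_eq, partialDeriv] at hx ⊢
  exact fun h => hx (by rw [h]; rfl)

/-- The Sobolev space `W^{k,p}(D; ℝᵐ)`: families `(u_α)` of `Lᵖ` functions in which `u_α` is the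
weak derivative `∂^α u` of `u = u_∅`, with the norm `(∑_α ‖∂^α u‖_p^p)^{1/p}`. For `k = 0` this is
`Lᵖ(D; ℝᵐ)`. -/
noncomputable def SobolevSpace {d : ℕ} (D : Set (EuclideanSpace ℝ (Fin d))) (m k : ℕ) (p : ℝ≥0∞)
    [Fact (1 ≤ p)] :
    Submodule ℝ (PiLp p (fun _ : DerivIndex d k =>
      Lp (EuclideanSpace ℝ (Fin m)) p (volume.restrict D))) where
  carrier := {u | ∀ α, IsWeakDeriv D α (u (DerivIndex.zero d k)) (u α)}
  zero_mem' := by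
    intro α φ _ _ _
    have h0 := Lp.coeFn_zero (EuclideanSpace ℝ (Fin m)) p (volume.restrict D)
    have h1 : ∀ ψ : EuclideanSpace ℝ (Fin d) → ℝ, ∫ x in D,
        ψ x • (0 : Lp (EuclideanSpace ℝ (Fin m)) p (volume.restrict D)) x = 0 := fun ψ =>
      integral_eq_zero_of_ae (by filter_upwards [h0] with x hx; rw [hx]; simp)
    simp only [PiLp.zero_apply]
    rw [h1, h1, smul_zero]
  add_mem' := by
    intro u v hu hv α φ h1 h2 h3
    have key : ∀ (β : DerivIndex d k) (ψ : EuclideanSpace ℝ (Fin d) → ℝ), Continuous ψ →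
        HasCompactSupport ψ → ∫ x in D, ψ x • (u + v) β x
          = (∫ x in D, ψ x • u β x) + ∫ x in D, ψ x • v β x := by
      intro β ψ hψ hc
      rw [← integral_add (integrable_test_smul _ hψ hc) (integrable_test_smul _ hψ hc)]
      refine integral_congr_ae ?_
      filter_upwards [Lp.coeFn_add (u β) (v β)] with x hx
      rw [PiLp.add_apply, hx, Pi.add_apply, smul_add]
    rw [key _ _ (continuous_partialDeriv α h1) (hasCompactSupport_partialDeriv α h2),
      key _ _ h1.continuous h2, hu α φ h1 h2 h3, hv α φ h1 h2 h3, smul_add]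
  smul_mem' := by
    intro c u hu α φ h1 h2 h3
    have key : ∀ (β : DerivIndex d k) (ψ : EuclideanSpace ℝ (Fin d) → ℝ),
        ∫ x in D, ψ x • (c • u) β x = c • ∫ x in D, ψ x • u β x := by
      intro β ψ
      rw [← integral_smul]
      refine integral_congr_ae ?_
      filter_upwards [Lp.coeFn_smul c (u β)] with x hx
      rw [PiLp.smul_apply, hx, Pi.smul_apply, smul_comm]
    rw [key, key, hu α φ h1 h2 h3, smul_comm]

/-- The function represented by an element of the Sobolev space. -/
noncomputable def SobolevSpace.rep {d m k : ℕ} {D : Set (EuclideanSpace ℝ (Fin d))} {p : ℝ≥0∞}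
    [Fact (1 ≤ p)] (u : SobolevSpace D m k p) :
    EuclideanSpace ℝ (Fin d) → EuclideanSpace ℝ (Fin m) :=
  u.1 (DerivIndex.zero d k)

/-! ## Dynamics and solution operators -/

/-- `u` solves `du/dt = F(u)` on `(0, ∞)`, `u(0) = u₀`. The (possibly unbounded, nonlinear)
operator `F` has the domain `dom ⊆ U` and takes values in a space `V` in which `U` is embedded
by `j`; the time derivative is taken in `V`. -/
structure IsSolution {U V : Type*} [NormedAddCommGroup U] [NormedSpace ℝ U]
    [NormedAddCommGroup V] [NormedSpace ℝ V] (j : U →L[ℝ] V) (dom : Set U) (F : dom → V)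
    (u₀ : U) (u : ℝ → U) : Prop where
  init : u 0 = u₀
  continuousOn : ContinuousOn u (Ici 0)
  hasDerivAt : ∀ t > 0, ∃ ht : u t ∈ dom, HasDerivAt (fun s => j (u s)) (F ⟨u t, ht⟩) t

/-- The initial value problem has, for every initial condition `u₀`, exactly one global solution,
and this solution is `t ↦ S t u₀`. -/
structure IsSolutionOperator {U V : Type*} [NormedAddCommGroup U] [NormedSpace ℝ U]
    [NormedAddCommGroup V] [NormedSpace ℝ V] (j : U →L[ℝ] V) (dom : Set U) (F : dom → V)
    (S : ℝ → U → U) : Prop where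
  isSolution : ∀ u₀, IsSolution j dom F u₀ (fun t => S t u₀)
  unique : ∀ u₀ u, IsSolution j dom F u₀ u → ∀ t ≥ 0, u t = S t u₀

/-- The class `𝒩` of self-maps of the phase space `U` approximates the trajectories of autonomous
dynamics: whenever `S h` is locally Lipschitz for some `h > 0`, `K` is compact, `n : ℕ` and
`ε > 0`, there is `Ŝ` in `𝒩` with `sup_{u₀ ∈ K} sup_{1 ≤ k ≤ n} ‖u(kh) - Ŝ^k(u₀)‖ < ε`
(the supremum is `< ε` iff some `δ < ε` is an upper bound). -/
def ApproximatesTrajectories (U : Type u) [NormedAddCommGroup U] [NormedSpace ℝ U]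
    (𝒩 : Set (U → U)) : Prop :=
  ∀ (V : Type v) [NormedAddCommGroup V] [NormedSpace ℝ V] (j : U →L[ℝ] V) (dom : Set U)
    (F : dom → V) (S : ℝ → U → U), Function.Injective j → IsSolutionOperator j dom F S →
  ∀ h > 0, LocallyLipschitz (S h) →
  ∀ K : Set U, IsCompact K → ∀ (n : ℕ), ∀ ε > 0,
    ∃ Ŝ ∈ 𝒩, ∃ δ < ε, ∀ u₀ ∈ K, ∀ k ∈ Finset.Icc 1 n, ‖S (k * h) u₀ - Ŝ^[k] u₀‖ ≤ δ

/-!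
The argument has a dynamical half and an approximation half.

*Dynamics.* By uniqueness of solutions, `S (k h)` is the `k`-th iterate of `T = S h`, which is
continuous. On a compact set, a continuous map is uniformly close to a continuous convex combination
`∑ τᵢ(u) zᵢ` of finitely many points, the `τᵢ` being a partition of unity composed with `T`. If the
maps of a class can approximate such combinations on every compact set `C`, with values in a compact
set `C₀` that does not depend on `C`, one takes `C = K ∪ C₀`: the iterates stay in `C`, and since
`T` is uniformly continuous near the visited points, small one-step errors stay small over `n` steps.
This is `approximatesTrajectories_of_convexCombinations`.

*Universal approximation.* `ridgeSpan σ Λ` is the span of the functions `x ↦ σ (λ x + b)`, `λ ∈ Λ`.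
A continuous functional on jets of order `k` that annihilates these functions annihilates, after
mollification of `σ`, also their derivatives with respect to the parameters; as `σ` is not a
polynomial, it annihilates all polynomials in the elements of `Λ` (`jet_annihilator_linearAlgebra`).
By Hahn-Banach, density of ridge functions reduces to density of polynomials: in the uniform norm
by Stone-Weierstrass on compact subsets of any normed space on which `Λ` separates points
(`exists_mem_ridgeSpan_near_of_separatesPoints`), in the `Cᵏ` norm on `ℝⁿ` by convolution with
polynomial (Landau) kernels (`exists_mem_ridgeSpan_iteratedFDeriv_near`).

*Neural operators.* The coefficients `τᵢ` are approximated by ridge functions of the averages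
`u ↦ ∫_D κ · u`, `κ` a network; these functionals separate points of `X ⊆ L¹(D)`. The points `zᵢ`
are replaced by `Cᵏ` functions `fᵢ`, and the map `(c, x) ↦ ∑ cᵢ fᵢ(x)` is approximated in `Cᵏ` by a
network in `(c, x)`. The composition of this encoder and decoder is a neural operator with two layers
(`exists_neuralOperator_encoder_decoder`), and as `c` ranges over a ball its outputs form a compact
subset of `X`; its image in the phase space is the set `C₀`.

*Sobolev spaces.* It remains to see that `W^{k,p}(D)` satisfies `IsFunctionSpace`
(`SobolevSpace.isFunctionSpace`). For the density of smooth functions, near a point of the closure of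
`D` one mollifies with bump functions whose off-centre supports only see values inside the domain; the
local approximations are glued by a partition of unity. `SobolevBound` packages weak derivatives
one coordinate at a time, which makes all these steps inductions over the order.
-/

/-! ### Jets of functions on a compact set -/

/-- The Banach space in which the `k`-jets, over the compact set `B`, of functions of class `Cᵏ`
live: one continuous field of multilinear forms on `B` for every order `j ≤ k`. -/
abbrev JetSpace {E : Type*} [NormedAddCommGroup E] [NormedSpace ℝ E] (k : ℕ) (B : Set E) : Type _ :=
  (j : Fin (k + 1)) → C(B, E [×(j : ℕ)]→L[ℝ] ℝ)

section Jets

variable {E : Type*} [NormedAddCommGroup E] [NormedSpace ℝ E]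

/-- The `k`-jet of `f` over `B`: all derivatives of order at most `k`, restricted to `B`. -/
noncomputable def jet (k : ℕ) (B : Set E) (f : E → ℝ) (hf : ContDiff ℝ k f) : JetSpace k B :=
  fun j => ⟨fun x => iteratedFDeriv ℝ j f x,
    (hf.continuous_iteratedFDeriv (by exact_mod_cast Nat.lt_succ_iff.mp j.2)).comp
      continuous_subtype_val⟩

@[simp] theorem jet_apply {k : ℕ} {B : Set E} {f : E → ℝ} (hf : ContDiff ℝ k f)
    (j : Fin (k + 1)) (x : B) : jet k B f hf j x = iteratedFDeriv ℝ j f x := rfl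

theorem jet_congr {k : ℕ} {B : Set E} {f g : E → ℝ} (hf : ContDiff ℝ k f) (hg : ContDiff ℝ k g)
    (h : f = g) : jet k B f hf = jet k B g hg := by
  subst h; rfl

/-- The jet over `B` depends only on the germ of the function along `B`. -/
theorem jet_congr_of_eventuallyEq {k : ℕ} {B : Set E} {f g : E → ℝ} (hf : ContDiff ℝ k f)
    (hg : ContDiff ℝ k g) (h : ∀ x ∈ B, f =ᶠ[nhds x] g) : jet k B f hf = jet k B g hg := by
  funext j
  ext1 x
  exact (h x x.2).iteratedFDeriv ℝ j |>.eq_of_nhds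

theorem jet_add {k : ℕ} {B : Set E} {f g : E → ℝ} (hf : ContDiff ℝ k f) (hg : ContDiff ℝ k g) :
    jet k B (fun x => f x + g x) (hf.add hg) = jet k B f hf + jet k B g hg := by
  funext j
  ext1 x
  have hj : ((j : ℕ) : WithTop ℕ∞) ≤ k := by exact_mod_cast Nat.lt_succ_iff.mp j.2
  have h := iteratedFDeriv_add_apply (𝕜 := ℝ) (x := (x : E)) (hf.of_le hj).contDiffAt
    (hg.of_le hj).contDiffAt
  exact h

theorem jet_const_mul {k : ℕ} {B : Set E} {f : E → ℝ} (c : ℝ) (hf : ContDiff ℝ k f) :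
    jet k B (fun x => c * f x) (contDiff_const.mul hf) = c • jet k B f hf := by
  funext j
  ext1 x
  have hj : ((j : ℕ) : WithTop ℕ∞) ≤ k := by exact_mod_cast Nat.lt_succ_iff.mp j.2
  have h := iteratedFDeriv_const_smul_apply (𝕜 := ℝ) (x := (x : E)) (a := c)
    (hf.of_le hj).contDiffAt
  exact h

/-- Instance search does not find the norm of this dependent product unaided. -/
noncomputable instance (k : ℕ) (B : Set E) [CompactSpace B] : NormedAddCommGroup (JetSpace k B) :=
  Pi.normedAddCommGroup

variable {P : Type*} [NormedAddCommGroup P] [NormedSpace ℝ P]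

theorem contDiff_slice {G : Type*} [NormedAddCommGroup G] [NormedSpace ℝ G] {n : WithTop ℕ∞}
    {F : P × E → G} (hF : ContDiff ℝ n F) (p : P) :
    ContDiff ℝ n (fun x => F (p, x)) :=
  hF.comp (contDiff_const.prodMk contDiff_id)

theorem iteratedFDeriv_slice {G : Type*} [NormedAddCommGroup G] [NormedSpace ℝ G] {k j : ℕ}
    {F : P × E → G} (hF : ContDiff ℝ k F) (hj : j ≤ k)
    (p : P) (x : E) :
    iteratedFDeriv ℝ j (fun x => F (p, x)) x =
      (iteratedFDeriv ℝ j F (p, x)).compContinuousLinearMap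
        (fun _ => ContinuousLinearMap.inr ℝ P E) := by
  have h1 : (fun x => F (p, x)) = (fun q => F ((p, 0) + q)) ∘ ContinuousLinearMap.inr ℝ P E := by
    funext x; simp
  have h2 : ContDiff ℝ k (fun q => F ((p, 0) + q)) := hF.comp (contDiff_const.add contDiff_id)
  rw [h1, ContinuousLinearMap.iteratedFDeriv_comp_right _ h2 _ (by exact_mod_cast hj),
    iteratedFDeriv_comp_add_left]
  simp

theorem continuous_iteratedFDeriv_slice {G : Type*} [NormedAddCommGroup G] [NormedSpace ℝ G]
    {k j : ℕ} {F : P × E → G} (hF : ContDiff ℝ k F) (hj : j ≤ k) :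
    Continuous (fun q : P × E => iteratedFDeriv ℝ j (fun x => F (q.1, x)) q.2) := by
  have h : (fun q : P × E => iteratedFDeriv ℝ j (fun x => F (q.1, x)) q.2) = fun q =>
      ContinuousMultilinearMap.compContinuousLinearMapL (𝕜 := ℝ)
        (fun _ : Fin j => ContinuousLinearMap.inr ℝ P E) (iteratedFDeriv ℝ j F q) := by
    funext q
    rw [iteratedFDeriv_slice hF hj]
    rfl
  rw [h]
  exact (ContinuousLinearMap.continuous _).comp
    (hF.continuous_iteratedFDeriv (by exact_mod_cast hj))

theorem continuous_jet_slice {k : ℕ} {B : Set E} {F : P × E → ℝ}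
    (hF : ContDiff ℝ k F) :
    Continuous (fun p => jet k B (fun x => F (p, x)) (contDiff_slice hF p)) := by
  refine continuous_pi fun j => ?_
  have hj : (j : ℕ) ≤ k := Nat.lt_succ_iff.mp j.2
  let A : C(P × B, E [×(j : ℕ)]→L[ℝ] ℝ) :=
    ⟨fun q => iteratedFDeriv ℝ j (fun x => F (q.1, x)) q.2,
      (continuous_iteratedFDeriv_slice hF hj).comp
        (continuous_fst.prodMk (continuous_subtype_val.comp continuous_snd))⟩
  exact A.curry.continuous

theorem exists_bound_near_of_continuous {P E G : Type*} [TopologicalSpace E] [TopologicalSpace P]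
    [NormedAddCommGroup G] {s : Set P} (hs : IsCompact s) {A : P → E → G}
    (hA : Continuous fun q : P × E => A q.1 q.2)
    (x : E) : ∃ C : ℝ, ∀ᶠ y in nhds x, ∀ p ∈ s, ‖A p y‖ < C := by
  obtain ⟨C, hC⟩ := hs.exists_bound_of_continuousOn
    (f := fun p => A p x) (hA.comp (continuous_id.prodMk continuous_const)).continuousOn
  refine ⟨C + 1, hs.eventually_forall_of_forall_eventually fun p hp => ?_⟩
  have hc : Continuous fun q : E × P => ‖A q.2 q.1‖ :=
    (hA.comp (continuous_snd.prodMk continuous_fst)).norm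
  exact hc.continuousAt.eventually_lt continuousAt_const ((hC p hp).trans_lt (lt_add_one C))

variable [MeasurableSpace P] [BorelSpace P]

theorem continuous_setIntegral_of_continuous {P E G : Type*} [NormedAddCommGroup P]
    [MeasurableSpace P] [BorelSpace P] [NormedAddCommGroup E] [NormedAddCommGroup G]
    [NormedSpace ℝ G] (μ : Measure P) [IsFiniteMeasureOnCompacts μ] {s : Set P} (hs : IsCompact s)
    {A : P → E → G} (hA : Continuous fun q : P × E => A q.1 q.2) :
    Continuous fun x => ∫ p in s, A p x ∂μ := by
  refine continuous_iff_continuousAt.2 fun x => ?_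
  obtain ⟨C, hC⟩ := exists_bound_near_of_continuous hs hA x
  refine continuousAt_of_dominated (bound := fun _ => C) ?_ ?_ ?_ ?_
  · exact Filter.Eventually.of_forall fun y =>
      ((hA.comp (continuous_id.prodMk continuous_const)).continuousOn.integrableOn_compact
        hs).aestronglyMeasurable
  · filter_upwards [hC] with y hy
    filter_upwards [ae_restrict_mem hs.measurableSet] with p hp using (hy p hp).le
  · exact integrableOn_const (hs.measure_lt_top.ne)
  · exact Filter.Eventually.of_forall fun p =>
      (hA.comp (continuous_const.prodMk continuous_id)).continuousAt

/-- Differentiation under an integral over a compact set of parameters. -/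
theorem hasFDerivAt_setIntegral_of_continuous {P G : Type*} [NormedAddCommGroup P]
    [MeasurableSpace P] [BorelSpace P] [NormedAddCommGroup G] [NormedSpace ℝ G]
    [CompleteSpace G] (μ : Measure P) [IsFiniteMeasureOnCompacts μ] {s : Set P} (hs : IsCompact s)
    {A : P → E → G} {A' : P → E → E →L[ℝ] G} (hA : Continuous fun q : P × E => A q.1 q.2)
    (hA' : Continuous fun q : P × E => A' q.1 q.2)
    (hd : ∀ p x, HasFDerivAt (A p) (A' p x) x) (x : E) :
    HasFDerivAt (fun x => ∫ p in s, A p x ∂μ) (∫ p in s, A' p x ∂μ) x := by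
  obtain ⟨C, hnear⟩ := exists_bound_near_of_continuous hs hA' x
  have hm : ∀ y, ContinuousOn (fun p => A p y) s := fun y =>
    (hA.comp (continuous_id.prodMk continuous_const)).continuousOn
  refine hasFDerivAt_integral_of_dominated_of_fderiv_le (𝕜 := ℝ) (bound := fun _ => C)
    (F := fun x p => A p x) (F' := fun x p => A' p x) hnear ?_ ?_ ?_ ?_ ?_ ?_
  · exact Filter.Eventually.of_forall fun y => ((hm y).integrableOn_compact hs).aestronglyMeasurable
  · exact (hm x).integrableOn_compact hs
  · have : ContinuousOn (fun p => A' p x) s :=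
      (hA'.comp (continuous_id.prodMk continuous_const)).continuousOn
    exact (this.integrableOn_compact hs).aestronglyMeasurable
  · filter_upwards [ae_restrict_mem hs.measurableSet] with p hp y hy
    exact (hy p hp).le
  · exact integrableOn_const (hs.measure_lt_top.ne)
  · exact Filter.Eventually.of_forall fun p y _ => hd p y

variable (μ : Measure P) [IsFiniteMeasureOnCompacts μ]

theorem hasFTaylorSeriesUpTo_setIntegral {k : ℕ} {F : P × E → ℝ} (hF : ContDiff ℝ k F)
    {s : Set P} (hs : IsCompact s) :
    HasFTaylorSeriesUpTo k (fun x => ∫ p in s, F (p, x) ∂μ)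
      (fun x j => ∫ p in s, iteratedFDeriv ℝ j (fun x => F (p, x)) x ∂μ) := by
  have hc : ∀ j ≤ k, ∀ x, IntegrableOn (fun p => iteratedFDeriv ℝ j (fun x => F (p, x)) x) s μ := by
    intro j hj x
    exact (((continuous_iteratedFDeriv_slice hF hj).comp
      (continuous_id.prodMk continuous_const)).continuousOn).integrableOn_compact hs
  have hder : ∀ m < k, ∀ x, HasFDerivAt
      (fun x => ∫ p in s, iteratedFDeriv ℝ m (fun x => F (p, x)) x ∂μ)
      (∫ p in s, iteratedFDeriv ℝ (m + 1) (fun x => F (p, x)) x ∂μ).curryLeft x := by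
    intro m hm x
    have h := hasFDerivAt_setIntegral_of_continuous μ hs
      (A := fun p x => iteratedFDeriv ℝ m (fun x => F (p, x)) x)
      (A' := fun p x => (iteratedFDeriv ℝ (m + 1) (fun x => F (p, x)) x).curryLeft)
      (continuous_iteratedFDeriv_slice hF hm.le)
      ((continuousMultilinearCurryLeftEquiv ℝ (fun _ : Fin (m + 1) => E) ℝ).continuous.comp
        (continuous_iteratedFDeriv_slice hF hm)) (fun p x => by
          have h1 : DifferentiableAt ℝ (iteratedFDeriv ℝ m (fun x => F (p, x))) x :=
            ((contDiff_slice hF p).differentiable_iteratedFDeriv (by exact_mod_cast hm)) x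
          exact h1.hasFDerivAt) x
    let Φ : (E [×(m + 1)]→L[ℝ] ℝ) →L[ℝ] (E →L[ℝ] E [×m]→L[ℝ] ℝ) :=
      (continuousMultilinearCurryLeftEquiv ℝ (fun _ : Fin (m + 1) => E)
        ℝ).toContinuousLinearEquiv.toContinuousLinearMap
    have e := ContinuousLinearMap.integral_comp_comm (𝕜 := ℝ) (E := E [×(m + 1)]→L[ℝ] ℝ)
      (Fₗ := E →L[ℝ] E [×m]→L[ℝ] ℝ) Φ (hc (m + 1) hm x)
    exact h.congr_fderiv e
  refine ⟨fun x => ?_, fun m hm x => hder m (by exact_mod_cast hm) x, fun m hm => ?_⟩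
  · have h := ((continuousMultilinearCurryFin0 ℝ E ℝ).toContinuousLinearEquiv
      |>.toContinuousLinearMap).integral_comp_comm (hc 0 (Nat.zero_le k) x)
    exact h.symm
  · have hm : m ≤ k := by exact_mod_cast hm
    exact continuous_setIntegral_of_continuous μ hs (continuous_iteratedFDeriv_slice hF hm)

theorem contDiff_setIntegral {k : ℕ} {F : P × E → ℝ} (hF : ContDiff ℝ k F)
    {s : Set P} (hs : IsCompact s) : ContDiff ℝ k (fun x => ∫ p in s, F (p, x) ∂μ) :=
  (hasFTaylorSeriesUpTo_setIntegral μ hF hs).contDiff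

/-- Taking jets commutes with integration over a compact set of parameters. -/
theorem jet_setIntegral {k : ℕ} {B : Set E} [CompactSpace B] {F : P × E → ℝ}
    (hF : ContDiff ℝ k F) {s : Set P} (hs : IsCompact s) :
    jet k B (fun x => ∫ p in s, F (p, x) ∂μ) (contDiff_setIntegral μ hF hs) =
      ∫ p in s, jet k B (fun x => F (p, x)) (contDiff_slice hF p) ∂μ := by
  have hint : IntegrableOn (fun p => jet k B (fun x => F (p, x)) (contDiff_slice hF p)) s μ :=
    (continuous_jet_slice hF).continuousOn.integrableOn_compact hs
  funext j
  ext1 x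
  let Φ : JetSpace k B →L[ℝ] E [×(j : ℕ)]→L[ℝ] ℝ := (ContinuousMap.evalCLM ℝ x).comp
    (ContinuousLinearMap.proj (R := ℝ) (φ := fun j : Fin (k + 1) => C(B, E [×(j : ℕ)]→L[ℝ] ℝ)) j)
  have h1 := ContinuousLinearMap.integral_comp_comm (𝕜 := ℝ) (E := JetSpace k B)
    (Fₗ := E [×(j : ℕ)]→L[ℝ] ℝ) Φ hint
  refine Eq.trans ?_ h1
  exact ((hasFTaylorSeriesUpTo_setIntegral μ hF hs).eq_iteratedFDeriv
    (by exact_mod_cast Nat.lt_succ_iff.mp j.2) x).symm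

end Jets

/-! ### Non-polynomial activations -/

/-- A smooth function with vanishing derivative of order `n` is a polynomial of degree below `n`. -/
theorem exists_polynomial_of_iteratedDeriv_eq_zero (n : ℕ) {f : ℝ → ℝ} (hf : ContDiff ℝ ∞ f)
    (h : ∀ t, iteratedDeriv n f t = 0) :
    ∃ P : Polynomial ℝ, P.degree < n ∧ ∀ t, f t = P.eval t := by
  induction n generalizing f with
  | zero => exact ⟨0, by simp, fun t => by simpa using h t⟩
  | succ n ih =>
    have hf' : ContDiff ℝ ∞ (deriv f) := (contDiff_infty_iff_deriv.1 hf).2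
    obtain ⟨P, hP, hPf⟩ := ih hf' fun t => by rw [← iteratedDeriv_succ']; exact h t
    let Q : Polynomial ℝ := ∑ i ∈ Finset.range n,
      Polynomial.C (P.coeff i / (i + 1)) * Polynomial.X ^ (i + 1)
    have hQ : Polynomial.derivative Q = P := by
      have hP' : P.natDegree < n ∨ n = 0 := by
        rcases Nat.eq_zero_or_pos n with h0 | h0
        · exact Or.inr h0
        · rcases eq_or_ne P 0 with rfl | hP0
          · exact Or.inl (by simpa using h0)
          · exact Or.inl ((Polynomial.natDegree_lt_iff_degree_lt hP0).2 hP)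
      rcases hP' with hP' | rfl
      · conv_rhs => rw [P.as_sum_range' n hP']
        rw [Polynomial.derivative_sum]
        refine Finset.sum_congr rfl fun i _ => ?_
        rw [Polynomial.derivative_C_mul_X_pow, ← Polynomial.C_mul_X_pow_eq_monomial]
        have : ((i : ℝ) + 1) ≠ 0 := by positivity
        congr 2
        push_cast
        field_simp
      · have : P = 0 := by simpa using hP
        simp [Q, this]
    have hc : ∀ t, f t - Q.eval t = f 0 - Q.eval 0 := by
      intro t
      refine is_const_of_deriv_eq_zero (f := fun t => f t - Q.eval t)
        ((hf.differentiable (by simp)).sub Q.differentiable) (fun s => ?_) t 0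
      have h1 : HasDerivAt f (deriv f s) s := (hf.differentiable (by simp) s).hasDerivAt
      have h2 := (h1.sub (Q.hasDerivAt s)).deriv
      refine Eq.trans h2 ?_
      rw [hQ, hPf s, sub_self]
    refine ⟨Q + Polynomial.C (f 0 - Q.eval 0), ?_, fun t => ?_⟩
    · refine (Polynomial.degree_add_le _ _).trans_lt (max_lt ?_ ?_)
      · refine (Polynomial.degree_sum_le _ _).trans_lt ?_
        refine (Finset.sup_lt_iff (by exact_mod_cast WithBot.bot_lt_coe _)).2 fun i hi => ?_
        refine (Polynomial.degree_C_mul_X_pow_le _ _).trans_lt ?_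
        exact_mod_cast Nat.succ_lt_succ (Finset.mem_range.1 hi)
      · exact Polynomial.degree_C_le.trans_lt (by exact_mod_cast Nat.succ_pos n)
    · rw [Polynomial.eval_add, Polynomial.eval_C, ← hc t]; ring

/-- The mollification of `σ` by `φ`. -/
noncomputable def mollify (φ σ : ℝ → ℝ) (t : ℝ) : ℝ := ∫ s in tsupport φ, φ s * σ (t - s)

theorem mollify_eq_convolution (φ σ : ℝ → ℝ) :
    mollify φ σ = MeasureTheory.convolution φ σ (ContinuousLinearMap.lsmul ℝ ℝ) volume := by
  funext t
  rw [mollify, convolution_lsmul]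
  refine setIntegral_eq_integral_of_forall_compl_eq_zero fun s hs => ?_
  rw [image_eq_zero_of_notMem_tsupport hs, zero_mul]

theorem contDiff_mollify {φ σ : ℝ → ℝ} (hφ : ContDiff ℝ ∞ φ) (hc : HasCompactSupport φ)
    (hσ : Continuous σ) : ContDiff ℝ ∞ (mollify φ σ) := by
  rw [mollify_eq_convolution]
  exact hc.contDiff_convolution_left _ hφ hσ.locallyIntegrable

/-- For a non-polynomial `σ`, no derivative vanishes identically for all mollifications of `σ`:
otherwise `σ` would be a pointwise limit of polynomials of bounded degree. -/
theorem exists_iteratedDeriv_mollify_ne_zero {σ : ℝ → ℝ} (hσ : Continuous σ)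
    (hn : IsNonpolynomial σ) (n : ℕ) :
    ∃ φ : ℝ → ℝ, ContDiff ℝ ∞ φ ∧ HasCompactSupport φ ∧
      ∃ b, iteratedDeriv n (mollify φ σ) b ≠ 0 := by
  by_contra! hcon
  refine hn ?_
  let ψ : ℕ → ContDiffBump (0 : ℝ) := fun i =>
    ⟨1 / (2 * (i + 1)), 1 / (i + 1), by positivity, by
      apply one_div_lt_one_div_of_lt <;> linarith [(Nat.cast_nonneg i : (0 : ℝ) ≤ i)]⟩
  have hψ : Filter.Tendsto (fun i => (ψ i).rOut) Filter.atTop (nhds 0) :=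
    tendsto_one_div_add_atTop_nhds_zero_nat
  have hlim : ∀ t, Filter.Tendsto (fun i => mollify ((ψ i).normed volume) σ t) Filter.atTop
      (nhds (σ t)) := by
    intro t
    simp_rw [mollify_eq_convolution]
    exact ContDiffBump.convolution_tendsto_right_of_continuous hψ hσ t
  have hpoly : ∀ i, ∃ P : Polynomial ℝ, P.degree < n ∧
      ∀ t, mollify ((ψ i).normed volume) σ t = P.eval t := fun i =>
    exists_polynomial_of_iteratedDeriv_eq_zero n
      (contDiff_mollify (ψ i).contDiff_normed (ψ i).hasCompactSupport_normed hσ)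
      (hcon _ (ψ i).contDiff_normed (ψ i).hasCompactSupport_normed)
  choose P hP hPe using hpoly
  let v : ℕ → ℝ := fun r => r
  have hv : Set.InjOn v (Finset.range n : Finset ℕ) := fun a _ b _ h => Nat.cast_injective h
  refine ⟨Lagrange.interpolate (Finset.range n) v (fun r => σ (v r)), fun t => ?_⟩
  refine tendsto_nhds_unique (hlim t) ?_
  have h1 : ∀ i, mollify ((ψ i).normed volume) σ t = ∑ r ∈ Finset.range n,
      mollify ((ψ i).normed volume) σ (v r) * (Lagrange.basis (Finset.range n) v r).eval t := by
    intro i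
    rw [hPe]
    conv_lhs => rw [Lagrange.eq_interpolate (f := P i) hv (by simpa using hP i)]
    rw [Lagrange.interpolate_apply, Polynomial.eval_finsetSum]
    simp [hPe]
  simp_rw [h1]
  rw [Lagrange.interpolate_apply, Polynomial.eval_finsetSum]
  simp only [Polynomial.eval_mul, Polynomial.eval_C]
  exact tendsto_finsetSum _ fun r _ => (hlim _).mul_const _

/-! ### Functionals annihilating all ridge functions -/

section Ridge

variable {E : Type*} [NormedAddCommGroup E] [NormedSpace ℝ E] {k : ℕ} {B : Set E} [CompactSpace B]

/-- If a functional on jets vanishes on all members of a one-parameter family of functions, then it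
vanishes on the derivatives of the family with respect to the parameter. -/
theorem jet_annihilator_deriv (ℓ : JetSpace k B →L[ℝ] ℝ) {F F' : ℝ × E → ℝ}
    (hF : ContDiff ℝ k F) (hF' : ContDiff ℝ k F')
    (hd : ∀ t x, HasDerivAt (fun t => F (t, x)) (F' (t, x)) t)
    (h : ∀ t, ℓ (jet k B (fun x => F (t, x)) (contDiff_slice hF t)) = 0) (t : ℝ) :
    ℓ (jet k B (fun x => F' (t, x)) (contDiff_slice hF' t)) = 0 := by
  set g : ℝ → ℝ := fun s => ℓ (jet k B (fun x => F' (s, x)) (contDiff_slice hF' s)) with hg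
  have hgc : Continuous g := ℓ.continuous.comp (continuous_jet_slice hF')
  have hzero : ∀ b ≥ t - 1, ∫ s in (t - 1)..b, g s = 0 := by
    intro b hb
    have hint : IntegrableOn (fun p => jet k B (fun x => F' (p, x)) (contDiff_slice hF' p))
        (Icc (t - 1) b) volume :=
      (continuous_jet_slice hF').continuousOn.integrableOn_compact isCompact_Icc
    have h0 : ∀ x, ∫ s in Icc (t - 1) b, F' (s, x) = F (b, x) + (-1) * F (t - 1, x) := by
      intro x
      rw [integral_Icc_eq_integral_Ioc, ← intervalIntegral.integral_of_le hb,
        intervalIntegral.integral_eq_sub_of_hasDerivAt (fun s _ => hd s x)]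
      · ring
      · exact (hF'.continuous.comp (by fun_prop)).intervalIntegrable _ _
    rw [intervalIntegral.integral_of_le hb, ← integral_Icc_eq_integral_Ioc, hg,
      ContinuousLinearMap.integral_comp_comm (𝕜 := ℝ) (E := JetSpace k B) (Fₗ := ℝ) ℓ hint,
      ← jet_setIntegral volume hF' isCompact_Icc,
      jet_congr _ ((contDiff_slice hF b).add (contDiff_const.mul (contDiff_slice hF (t - 1))))
        (funext h0), jet_add (contDiff_slice hF b) (contDiff_const.mul (contDiff_slice hF (t - 1))),
      jet_const_mul _ (contDiff_slice hF (t - 1)), map_add, map_smul, h, h, smul_zero, add_zero]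
  have h1 : HasDerivAt (fun b => ∫ s in (t - 1)..b, g s) (g t) t :=
    intervalIntegral.integral_hasDerivAt_right (hgc.intervalIntegrable _ _)
      (hgc.stronglyMeasurableAtFilter _ _) hgc.continuousAt
  have h2 : (fun b => ∫ s in (t - 1)..b, g s) =ᶠ[nhds t] fun _ => 0 := by
    filter_upwards [Ioi_mem_nhds (show t - 1 < t by linarith)] with b hb using hzero b hb.le
  exact (h1.congr_of_eventuallyEq h2.symm).unique (hasDerivAt_const t 0)

theorem contDiff_ridge {n : WithTop ℕ∞} {σ : ℝ → ℝ} (hσ : ContDiff ℝ n σ) (L : E →L[ℝ] ℝ) (b : ℝ) :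
    ContDiff ℝ n (fun x => σ (L x + b)) :=
  hσ.comp (L.contDiff.add contDiff_const)

theorem jet_annihilator_mollify (ℓ : JetSpace k B →L[ℝ] ℝ) {σ φ : ℝ → ℝ} (hσ : ContDiff ℝ k σ)
    (hφ : ContDiff ℝ ∞ φ) (hc : HasCompactSupport φ) (L : E →L[ℝ] ℝ)
    (h : ∀ b, ℓ (jet k B (fun x => σ (L x + b)) (contDiff_ridge hσ L b)) = 0) (b : ℝ)
    (hm : ContDiff ℝ k (fun x => mollify φ σ (L x + b))) :
    ℓ (jet k B (fun x => mollify φ σ (L x + b)) hm) = 0 := by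
  have hF : ContDiff ℝ k (fun q : ℝ × E => φ q.1 * σ (L q.2 + b - q.1)) := by
    have : ContDiff ℝ k φ := hφ.of_le (by exact_mod_cast le_top)
    fun_prop
  have hint := (continuous_jet_slice (B := B) hF).continuousOn.integrableOn_compact
    (μ := volume) hc.isCompact
  rw [jet_congr hm (contDiff_setIntegral volume hF hc.isCompact) rfl,
    jet_setIntegral volume hF hc.isCompact,
    ← ContinuousLinearMap.integral_comp_comm (𝕜 := ℝ) (E := JetSpace k B) (Fₗ := ℝ) ℓ hint]
  refine integral_eq_zero_of_ae (Filter.Eventually.of_forall fun s => ?_)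
  have e : jet k B (fun x => φ s * σ (L x + b - s)) (contDiff_slice hF s) =
      φ s • jet k B (fun x => σ (L x + (b - s))) (contDiff_ridge hσ L (b - s)) := by
    rw [← jet_const_mul]
    exact jet_congr _ _ (by funext x; rw [add_sub_assoc])
  change ℓ (jet k B (fun x => φ s * σ (L x + b - s)) (contDiff_slice hF s)) = 0
  rw [e, map_smul, h, smul_zero]

theorem contDiff_list_prod (n : WithTop ℕ∞) (μ : List (E →L[ℝ] ℝ)) :
    ContDiff ℝ n (fun x => (μ.map fun m => m x).prod) := by
  induction μ with
  | nil => simpa using contDiff_const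
  | cons m μ ih => simpa using m.contDiff.mul ih

theorem contDiff_iteratedDeriv {f : ℝ → ℝ} (hf : ContDiff ℝ ∞ f) (k n : ℕ) :
    ContDiff ℝ k (iteratedDeriv n f) := by
  rw [iteratedDeriv_eq_iterate]
  exact ContDiff.iterate_deriv' k n (hf.of_le (by exact_mod_cast le_top))

theorem contDiff_list_prod_ridge {f : ℝ → ℝ} (hf : ContDiff ℝ ∞ f) (μ : List (E →L[ℝ] ℝ)) (n : ℕ)
    (L : E →L[ℝ] ℝ) (b : ℝ) :
    ContDiff ℝ k (fun x => (μ.map fun m => m x).prod * iteratedDeriv n f (L x + b)) :=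
  (contDiff_list_prod k μ).mul (contDiff_ridge (contDiff_iteratedDeriv hf k n) L b)

/-- Differentiating `ℓ (f (L · + b)) = 0` repeatedly in `L`. -/
theorem jet_annihilator_list_prod_ridge (Λ : Submodule ℝ (E →L[ℝ] ℝ)) (ℓ : JetSpace k B →L[ℝ] ℝ)
    {f : ℝ → ℝ} (hf : ContDiff ℝ ∞ f)
    (h : ∀ L ∈ Λ, ∀ b, ∀ hm : ContDiff ℝ k (fun x => f (L x + b)),
      ℓ (jet k B (fun x => f (L x + b)) hm) = 0)
    (μ : List (E →L[ℝ] ℝ)) (hμ : ∀ m ∈ μ, m ∈ Λ) :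
    ∀ L ∈ Λ, ∀ b, ℓ (jet k B _ (contDiff_list_prod_ridge hf μ μ.length L b)) = 0 := by
  induction μ with
  | nil =>
    intro L hL b
    have hm : ContDiff ℝ k (fun x => f (L x + b)) :=
      contDiff_ridge (hf.of_le (by exact_mod_cast le_top)) L b
    rw [jet_congr _ hm (by funext x; simp)]
    exact h L hL b hm
  | cons m μ ih =>
    have ih := ih fun m hm => hμ m (List.mem_cons_of_mem _ hm)
    intro L hL b
    have hk := contDiff_iteratedDeriv hf k
    have h2 := contDiff_list_prod k μ
    have hF : ContDiff ℝ k (fun q : ℝ × E =>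
        (μ.map fun m => m q.2).prod * iteratedDeriv μ.length f ((L + q.1 • m) q.2 + b)) := by
      refine (h2.comp contDiff_snd).mul ((hk _).comp ?_)
      simp only [add_apply, smul_apply]
      fun_prop
    have hF' : ContDiff ℝ k (fun q : ℝ × E =>
        ((m :: μ).map fun m => m q.2).prod *
          iteratedDeriv (μ.length + 1) f ((L + q.1 • m) q.2 + b)) := by
      simp only [List.map_cons, List.prod_cons]
      refine ((m.contDiff.comp contDiff_snd).mul (h2.comp contDiff_snd)).mul ((hk _).comp ?_)
      simp only [add_apply, smul_apply]
      fun_prop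
    have key := jet_annihilator_deriv ℓ hF hF' (fun t x => ?_) (fun t => ?_) 0
    · rw [← key]
      congr 1
      exact jet_congr _ _ (by funext x; simp)
    · have hdf : HasDerivAt (iteratedDeriv μ.length f)
          (iteratedDeriv (μ.length + 1) f ((L + t • m) x + b)) ((L + t • m) x + b) := by
        rw [iteratedDeriv_succ]
        exact ((hf.differentiable_iteratedDeriv _
          (by exact_mod_cast ENat.natCast_lt_top _)) _).hasDerivAt
      have hin : HasDerivAt (fun t : ℝ => (L + t • m) x + b) (m x) t := by
        simp only [add_apply, smul_apply, smul_eq_mul]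
        simpa using (((hasDerivAt_id t).mul_const (m x)).const_add (L x)).add_const b
      have := (hdf.comp t hin).const_mul (μ.map fun m => m x).prod
      refine this.congr_deriv ?_
      rw [List.map_cons, List.prod_cons]
      ring
    · exact ih (L + t • m) (Λ.add_mem hL (Λ.smul_mem _ (hμ m (by simp)))) b

/-- A functional on jets that annihilates the ridge functions `x ↦ σ (L x + b)`, `L ∈ Λ`, for a
non-polynomial activation `σ`, annihilates all products of functionals from `Λ`. -/
theorem jet_annihilator_list_prod (Λ : Submodule ℝ (E →L[ℝ] ℝ)) (ℓ : JetSpace k B →L[ℝ] ℝ)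
    {σ : ℝ → ℝ} (hσ : ContDiff ℝ k σ) (hn : IsNonpolynomial σ)
    (h : ∀ L ∈ Λ, ∀ b, ℓ (jet k B (fun x => σ (L x + b)) (contDiff_ridge hσ L b)) = 0)
    (μ : List (E →L[ℝ] ℝ)) (hμ : ∀ m ∈ μ, m ∈ Λ)
    (hm : ContDiff ℝ k (fun x => (μ.map fun m => m x).prod)) :
    ℓ (jet k B (fun x => (μ.map fun m => m x).prod) hm) = 0 := by
  obtain ⟨φ, hφ, hc, b, hb⟩ := exists_iteratedDeriv_mollify_ne_zero hσ.continuous hn μ.length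
  have key := jet_annihilator_list_prod_ridge Λ ℓ (contDiff_mollify hφ hc hσ.continuous)
    (fun L hL b hm => jet_annihilator_mollify ℓ hσ hφ hc L (h L hL) b hm) μ hμ 0 Λ.zero_mem b
  rw [jet_congr _ (contDiff_const.mul hm) (g := fun x =>
    iteratedDeriv μ.length (mollify φ σ) b * (μ.map fun m => m x).prod)
    (by funext x; simp [mul_comm]), jet_const_mul, map_smul, smul_eq_mul] at key
  exact (mul_eq_zero.1 key).resolve_left hb

end Ridge

/-! ### Density of ridge functions -/

section Density

variable {E : Type*} [NormedAddCommGroup E] [NormedSpace ℝ E] {k : ℕ}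

theorem jet_zero {B : Set E} (h : ContDiff ℝ k (0 : E → ℝ)) : jet k B 0 h = 0 := by
  funext j
  ext1 x
  rw [jet_apply, Pi.zero_def, iteratedFDeriv_fun_zero]
  rfl

/-- The functions computed by networks with one hidden layer: linear combinations of the ridge
functions `x ↦ σ (L x + b)` with `L` in a given space `Λ` of functionals. -/
def ridgeSpan (σ : ℝ → ℝ) (Λ : Submodule ℝ (E →L[ℝ] ℝ)) : Submodule ℝ (E → ℝ) :=
  Submodule.span ℝ {f | ∃ L ∈ Λ, ∃ b : ℝ, f = fun x => σ (L x + b)}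

theorem contDiff_of_mem_ridgeSpan {σ : ℝ → ℝ} (hσ : ContDiff ℝ k σ) {Λ : Submodule ℝ (E →L[ℝ] ℝ)}
    {g : E → ℝ} (hg : g ∈ ridgeSpan σ Λ) : ContDiff ℝ k g := by
  induction hg using Submodule.span_induction with
  | mem f hf =>
    obtain ⟨L, -, b, rfl⟩ := hf
    exact contDiff_ridge hσ L b
  | zero => exact contDiff_const
  | add f g _ _ hf hg => exact hf.add hg
  | smul c f _ hf => exact contDiff_const.smul hf

theorem exists_sum_of_mem_ridgeSpan {σ : ℝ → ℝ} {Λ : Submodule ℝ (E →L[ℝ] ℝ)}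
    {g : E → ℝ} (hg : g ∈ ridgeSpan σ Λ) : ∃ (n : ℕ) (q b : Fin n → ℝ) (L : Fin n → E →L[ℝ] ℝ),
      (∀ r, L r ∈ Λ) ∧ ∀ x, g x = ∑ r, q r * σ (L r x + b r) := by
  induction hg using Submodule.span_induction with
  | mem f hf =>
    obtain ⟨L, hL, b, rfl⟩ := hf
    exact ⟨1, fun _ => 1, fun _ => b, fun _ => L, fun _ => hL, fun x => by simp⟩
  | zero => exact ⟨0, Fin.elim0, Fin.elim0, Fin.elim0, fun r => r.elim0, fun x => by simp⟩
  | add f g _ _ hf hg =>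
    obtain ⟨n, q, b, L, hL, hf⟩ := hf
    obtain ⟨n', q', b', L', hL', hg⟩ := hg
    refine ⟨n + n', Fin.append q q', Fin.append b b', Fin.append L L', fun r => ?_, fun x => ?_⟩
    · refine Fin.addCases (fun r => ?_) (fun r => ?_) r
      · simpa using hL r
      · simpa using hL' r
    · rw [Fin.sum_univ_add, Pi.add_apply, hf, hg]
      simp
  | smul c f _ hf =>
    obtain ⟨n, q, b, L, hL, hf⟩ := hf
    refine ⟨n, fun r => c * q r, b, L, hL, fun x => ?_⟩
    rw [Pi.smul_apply, hf, smul_eq_mul, Finset.mul_sum]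
    exact Finset.sum_congr rfl fun r _ => by ring

/-- Hahn–Banach: a jet that is annihilated by all functionals annihilating the ridge functions is a
limit of jets of linear combinations of ridge functions. -/
theorem exists_mem_ridgeSpan_of_annihilator {B : Set E} [CompactSpace B] {σ : ℝ → ℝ}
    (hσ : ContDiff ℝ k σ) (Λ : Submodule ℝ (E →L[ℝ] ℝ)) (v : JetSpace k B)
    (hv : ∀ ℓ : JetSpace k B →L[ℝ] ℝ,
      (∀ L ∈ Λ, ∀ b, ℓ (jet k B (fun x => σ (L x + b)) (contDiff_ridge hσ L b)) = 0) → ℓ v = 0)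
    {η : ℝ} (hη : 0 < η) :
    ∃ g ∈ ridgeSpan σ Λ, ∃ hg : ContDiff ℝ k g, ‖v - jet k B g hg‖ < η := by
  let M : Submodule ℝ (JetSpace k B) :=
    { carrier := {w | ∃ g ∈ ridgeSpan σ Λ, ∃ hg : ContDiff ℝ k g, w = jet k B g hg}
      zero_mem' := ⟨0, Submodule.zero_mem _, contDiff_const, (jet_zero _).symm⟩
      add_mem' := by
        rintro _ _ ⟨f, hf, hf', rfl⟩ ⟨g, hg, hg', rfl⟩
        exact ⟨f + g, Submodule.add_mem _ hf hg, hf'.add hg', (jet_add hf' hg').symm⟩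
      smul_mem' := by
        rintro c _ ⟨f, hf, hf', rfl⟩
        exact ⟨c • f, Submodule.smul_mem _ c hf, contDiff_const.mul hf',
          (jet_const_mul c hf').symm⟩ }
  have hmem : v ∈ closure (M : Set (JetSpace k B)) := by
    by_contra hcon
    obtain ⟨ℓ, a, hℓ, ha⟩ := geometric_hahn_banach_closed_point
      (s := (M.topologicalClosure : Set (JetSpace k B))) (Submodule.convex _)
      M.isClosed_topologicalClosure hcon
    have hz : ∀ w ∈ M, ℓ w = 0 := by
      intro w hw
      by_contra hne
      have := hℓ ((a / ℓ w) • w) (M.le_topologicalClosure (M.smul_mem _ hw))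
      rw [map_smul, smul_eq_mul, div_mul_cancel₀ _ hne] at this
      exact lt_irrefl _ this
    have h0 : 0 < a := by simpa using hℓ 0 (Submodule.zero_mem _)
    have hv0 := hv ℓ fun L hL b =>
      hz _ ⟨_, Submodule.subset_span ⟨L, hL, b, rfl⟩, contDiff_ridge hσ L b, rfl⟩
    linarith
  obtain ⟨w, ⟨g, hg, hg', rfl⟩, hd⟩ := Metric.mem_closure_iff.1 hmem η hη
  exact ⟨g, hg, hg', by rwa [← dist_eq_norm]⟩

/-- The algebra of polynomials in the functionals from `Λ`. -/
def linearAlgebra (Λ : Submodule ℝ (E →L[ℝ] ℝ)) : Subalgebra ℝ (E → ℝ) :=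
  Algebra.adjoin ℝ {f | ∃ L ∈ Λ, f = ⇑L}

theorem contDiff_of_mem_linearAlgebra {n : WithTop ℕ∞} {Λ : Submodule ℝ (E →L[ℝ] ℝ)} {p : E → ℝ}
    (hp : p ∈ linearAlgebra Λ) : ContDiff ℝ n p := by
  induction hp using Algebra.adjoin_induction with
  | mem f hf =>
    obtain ⟨L, -, rfl⟩ := hf
    exact L.contDiff
  | algebraMap r => exact contDiff_const
  | add f g _ _ hf hg => exact hf.add hg
  | mul f g _ _ hf hg => exact hf.mul hg

theorem jet_annihilator_linearAlgebra {B : Set E} [CompactSpace B] {σ : ℝ → ℝ}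
    (hσ : ContDiff ℝ k σ) (hn : IsNonpolynomial σ) (Λ : Submodule ℝ (E →L[ℝ] ℝ))
    (ℓ : JetSpace k B →L[ℝ] ℝ)
    (h : ∀ L ∈ Λ, ∀ b, ℓ (jet k B (fun x => σ (L x + b)) (contDiff_ridge hσ L b)) = 0)
    {p : E → ℝ} (hp : p ∈ linearAlgebra Λ) :
    ℓ (jet k B p (contDiff_of_mem_linearAlgebra hp)) = 0 := by
  have hp' : p ∈ Submodule.span ℝ
      ((Submonoid.closure {f : E → ℝ | ∃ L ∈ Λ, f = ⇑L} : Submonoid (E → ℝ)) : Set (E → ℝ)) := by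
    rw [← Algebra.adjoin_eq_span]
    exact hp
  suffices H : ∃ hc : ContDiff ℝ k p, ℓ (jet k B p hc) = 0 from H.2
  clear hp
  induction hp' using Submodule.span_induction with
  | mem f hf =>
    obtain ⟨l, hl, rfl⟩ := Submonoid.exists_list_of_mem_closure hf
    choose! Φ hΦ hΦ' using hl
    have e : l.prod = fun x => ((l.map Φ).map fun m => m x).prod := by
      funext x
      clear hf
      induction l with
      | nil => simp
      | cons f l ih =>
        rw [List.prod_cons, Pi.mul_apply,
          ih (fun y hy => hΦ y (by simp [hy])) (fun y hy => hΦ' y (by simp [hy]))]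
        have := congrFun (hΦ' f (by simp)) x
        simp [this]
    rw [e]
    refine ⟨contDiff_list_prod _ _, jet_annihilator_list_prod Λ ℓ hσ hn h _ (fun m hm => ?_) _⟩
    obtain ⟨f, hf, rfl⟩ := List.mem_map.1 hm
    exact hΦ f hf
  | zero =>
    exact ⟨contDiff_const, by rw [jet_zero, map_zero]⟩
  | add f g _ _ hf hg =>
    obtain ⟨hf, hf'⟩ := hf
    obtain ⟨hg, hg'⟩ := hg
    refine ⟨hf.add hg, ?_⟩
    rw [← add_zero (0 : ℝ)]
    nth_rw 1 [← hf']
    rw [← hg', ← map_add]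
    exact congrArg ℓ (jet_add hf hg)
  | smul c f _ hf =>
    obtain ⟨hf, hf'⟩ := hf
    refine ⟨contDiff_const.mul hf, ?_⟩
    have := congrArg ℓ (jet_const_mul (B := B) c hf)
    rw [map_smul, hf', smul_zero] at this
    exact this

/-- Uniform approximation on compact subsets of a normed space: if the functionals in `Λ` separate
the points of the compact set `B`, then continuous functions on `B` are uniform limits of linear
combinations of ridge functions. -/
theorem exists_mem_ridgeSpan_near_of_separatesPoints {B : Set E} (hB : IsCompact B) {σ : ℝ → ℝ}
    (hσ : Continuous σ) (hn : IsNonpolynomial σ) (Λ : Submodule ℝ (E →L[ℝ] ℝ))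
    (hΛ : ∀ x ∈ B, ∀ y ∈ B, x ≠ y → ∃ L ∈ Λ, L x ≠ L y) {f : E → ℝ} (hf : ContinuousOn f B)
    {η : ℝ} (hη : 0 < η) :
    ∃ g ∈ ridgeSpan σ Λ, ∀ x ∈ B, |g x - f x| < η := by
  have : CompactSpace B := isCompact_iff_compactSpace.1 hB
  let res : (linearAlgebra Λ) →ₐ[ℝ] C(B, ℝ) :=
    { toFun := fun p => ⟨fun x => p.1 x,
        (contDiff_of_mem_linearAlgebra (n := 0) p.2).continuous.comp continuous_subtype_val⟩
      map_one' := rfl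
      map_mul' := fun _ _ => rfl
      map_zero' := rfl
      map_add' := fun _ _ => rfl
      commutes' := fun _ => rfl }
  have hsep : (res.range).SeparatesPoints := by
    intro x y hxy
    obtain ⟨L, hL, hne⟩ := hΛ x x.2 y y.2 fun h => hxy (Subtype.ext h)
    exact ⟨_, ⟨res ⟨L, Algebra.subset_adjoin ⟨L, hL, rfl⟩⟩, ⟨_, rfl⟩, rfl⟩, hne⟩
  obtain ⟨⟨_, ⟨p, rfl⟩⟩, hp⟩ :=
    ContinuousMap.exists_mem_subalgebra_near_continuous_of_separatesPoints res.range hsep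
      (fun x : B => f x) (continuousOn_iff_continuous_domRestrict.1 hf) (η / 2) (half_pos hη)
  have hσ0 : ContDiff ℝ (0 : ℕ) σ := by exact_mod_cast contDiff_zero.2 hσ
  obtain ⟨g, hg, hg', hgp⟩ := exists_mem_ridgeSpan_of_annihilator (k := 0) (B := B) hσ0 Λ
    (jet 0 B p (contDiff_of_mem_linearAlgebra p.2))
    (fun ℓ h => jet_annihilator_linearAlgebra hσ0 hn Λ ℓ h p.2) (half_pos hη)
  refine ⟨g, hg, fun x hx => ?_⟩
  have h1 : |p.1 x - f x| < η / 2 := hp ⟨x, hx⟩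
  have h2 : |p.1 x - g x| < η / 2 := by
    refine lt_of_le_of_lt ?_ hgp
    have h3 := (ContinuousMap.norm_coe_le_norm _ (⟨x, hx⟩ : B)).trans
      (norm_le_pi_norm (jet 0 B p.1 (contDiff_of_mem_linearAlgebra p.2) - jet 0 B g hg') 0)
    refine le_trans (le_of_eq ?_) h3
    rw [← Real.norm_eq_abs, Pi.sub_apply, ContinuousMap.sub_apply, jet_apply, jet_apply]
    have h4 := (continuousMultilinearCurryFin0 ℝ E ℝ).norm_map
      (iteratedFDeriv ℝ 0 p.1 x - iteratedFDeriv ℝ 0 g x)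
    rw [map_sub] at h4
    exact h4
  calc |g x - f x| = |(p.1 x - f x) - (p.1 x - g x)| := by congr 1; ring
    _ ≤ |p.1 x - f x| + |p.1 x - g x| := abs_sub _ _
    _ < η := by linarith

theorem comp_sub_mem_linearAlgebra {p : E → ℝ}
    (hp : p ∈ linearAlgebra (⊤ : Submodule ℝ (E →L[ℝ] ℝ)))
    (y : E) : (fun x => p (x - y)) ∈ linearAlgebra (⊤ : Submodule ℝ (E →L[ℝ] ℝ)) := by
  induction hp using Algebra.adjoin_induction with
  | mem f hf =>
    obtain ⟨L, -, rfl⟩ := hf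
    have : (fun x => L (x - y)) = ⇑L - algebraMap ℝ (E → ℝ) (L y) := by
      funext x; simp
    rw [this]
    exact Subalgebra.sub_mem _ (Algebra.subset_adjoin ⟨L, trivial, rfl⟩)
      (Subalgebra.algebraMap_mem _ _)
  | algebraMap r => exact Subalgebra.algebraMap_mem _ r
  | add f g _ _ hf hg => exact Subalgebra.add_mem _ hf hg
  | mul f g _ _ hf hg => exact Subalgebra.mul_mem _ hf hg

/-- The kernel of Landau type `z ↦ C - ∑ zᵢ²`. -/
theorem exists_landau_kernel [FiniteDimensional ℝ E] {s : Set E} (hs : IsCompact s) :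
    ∃ c ∈ linearAlgebra (⊤ : Submodule ℝ (E →L[ℝ] ℝ)),
      (∀ z, z ≠ 0 → c z < c 0) ∧ (∀ z ∈ s, 0 ≤ c z) ∧ 0 < c 0 := by
  let b := Module.finBasis ℝ E
  let L : Fin (Module.finrank ℝ E) → E →L[ℝ] ℝ := fun i =>
    LinearMap.toContinuousLinearMap (b.coord i)
  let q : E → ℝ := ∑ i, ⇑(L i) ^ 2
  have hqz : ∀ z, q z = ∑ i, (L i z) ^ 2 := fun z => by simp [q]
  have hqmem : q ∈ linearAlgebra (⊤ : Submodule ℝ (E →L[ℝ] ℝ)) :=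
    Subalgebra.sum_mem _ fun i _ =>
      Subalgebra.pow_mem _
        (Algebra.subset_adjoin ⟨L i, Submodule.mem_top, rfl⟩ : ⇑(L i) ∈ linearAlgebra ⊤) 2
  have hq : Continuous q := (contDiff_of_mem_linearAlgebra (n := 0) hqmem).continuous
  obtain ⟨C, hC⟩ := hs.exists_bound_of_continuousOn hq.continuousOn
  refine ⟨algebraMap ℝ (E → ℝ) (|C| + 1) - q,
    Subalgebra.sub_mem _ (Subalgebra.algebraMap_mem _ _) hqmem, fun z hz => ?_, fun z hz => ?_, ?_⟩
  · have h0 : q 0 = 0 := by simp [hqz]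
    have h1 : 0 < q z := by
      rw [hqz]
      have : ∃ i, L i z ≠ 0 := by
        by_contra! hcon
        exact hz ((Module.Basis.forall_coord_eq_zero_iff b).1 hcon)
      obtain ⟨i, hi⟩ := this
      exact Finset.sum_pos' (fun i _ => sq_nonneg _) ⟨i, Finset.mem_univ _, by positivity⟩
    simp only [Pi.sub_apply, h0]
    simpa using h1
  · have := (le_abs_self _).trans ((hC z hz).trans (le_abs_self C))
    simp only [Pi.sub_apply, Pi.algebraMap_apply, Algebra.algebraMap_self, RingHom.id_apply]
    linarith
  · simp only [Pi.sub_apply, Pi.algebraMap_apply, Algebra.algebraMap_self, RingHom.id_apply, hqz]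
    simp only [map_zero]
    simp
    positivity

/-- Approximation with all derivatives: linear combinations of ridge functions with a
non-polynomial activation of class `Cᵏ` are dense in `Cᵏ` on compact sets. A compactly supported
`f` is the limit of its convolutions with normalised powers of a Landau kernel, which are integrals
of polynomials. -/
theorem exists_mem_ridgeSpan_jet_near_of_hasCompactSupport [FiniteDimensional ℝ E] {σ : ℝ → ℝ}
    (hσ : ContDiff ℝ k σ) (hn : IsNonpolynomial σ) {f : E → ℝ} (hf : ContDiff ℝ k f) {R : ℝ}
    (hR : 0 ≤ R) (hfR : ∀ x, R < ‖x‖ → f x = 0) {B : Set E} [CompactSpace B]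
    (hBR : B ⊆ Metric.closedBall 0 R) {η : ℝ} (hη : 0 < η) :
    ∃ g ∈ ridgeSpan σ (⊤ : Submodule ℝ (E →L[ℝ] ℝ)), ∃ hg : ContDiff ℝ k g,
      ‖jet k B f hf - jet k B g hg‖ < η := by
  refine exists_mem_ridgeSpan_of_annihilator hσ ⊤ _ (fun ℓ hℓ => ?_) hη
  let _ : MeasurableSpace E := borel E
  have _ : BorelSpace E := ⟨rfl⟩
  let μ : Measure E := Measure.addHaar
  set s : Set E := Metric.closedBall 0 (2 * R + 2) with hs
  have hsc : IsCompact s := isCompact_closedBall _ _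
  have hBc : IsCompact (Metric.closedBall (0 : E) R) := isCompact_closedBall _ _
  obtain ⟨c, hc, hmax, hnn, hpos⟩ := exists_landau_kernel hsc
  have hcd : ContDiff ℝ k c := contDiff_of_mem_linearAlgebra hc
  -- the translates of `f`, as a family of functions depending on the translation
  have hF : ContDiff ℝ k (fun q : E × E => f (q.2 - q.1)) := by fun_prop
  have hlim := tendsto_setIntegral_pow_smul_of_unique_maximum_of_isCompact_of_continuousOn (μ := μ)
    (g := fun z => jet k B (fun x => f (x - z)) (contDiff_slice hF z)) hsc
    hcd.continuous.continuousOn (fun y _ hy => hmax y hy) hnn hpos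
    (subset_closure (mem_interior_iff_mem_nhds.2
      (Metric.closedBall_mem_nhds (0 : E) (by linarith : 0 < 2 * R + 2))))
    (continuous_jet_slice hF).continuousOn
  have h0 : jet k B (fun x => f (x - 0)) (contDiff_slice hF 0) = jet k B f hf :=
    jet_congr _ _ (by funext x; rw [sub_zero])
  have hlim' := (ℓ.continuous.tendsto _).comp hlim
  suffices hz : ∀ n : ℕ, ℓ (∫ z in s, c z ^ n • jet k B (fun x => f (x - z))
      (contDiff_slice hF z) ∂μ) = 0 by
    rw [← h0]
    refine tendsto_nhds_unique hlim' (tendsto_const_nhds.congr fun n => ?_)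
    simp only [Function.comp_apply, map_smul, hz, smul_zero]
  intro n
  have hcn : c ^ n ∈ linearAlgebra (⊤ : Submodule ℝ (E →L[ℝ] ℝ)) := Subalgebra.pow_mem _ hc n
  have hF1 : ContDiff ℝ k (fun q : E × E => c q.1 ^ n * f (q.2 - q.1)) := by fun_prop
  have hF2 : ContDiff ℝ k (fun q : E × E => f q.1 * c (q.2 - q.1) ^ n) := by fun_prop
  have e1 : ∀ z, c z ^ n • jet k B (fun x => f (x - z)) (contDiff_slice hF z) =
      jet k B (fun x => c z ^ n * f (x - z)) (contDiff_slice hF1 z) := fun z =>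
    (jet_const_mul _ _).symm
  simp_rw [e1]
  rw [← jet_setIntegral μ hF1 hsc]
  -- near `B`, substitute `y = x - z`, so that the polynomial carries the variable `x`
  have e2 : ∀ x ∈ B, (fun x => ∫ z in s, c z ^ n * f (x - z) ∂μ) =ᶠ[nhds x]
      fun x => ∫ y in Metric.closedBall 0 R, f y * c (x - y) ^ n ∂μ := by
    intro x hx
    have hx' : ‖x‖ < R + 1 := by
      have := mem_closedBall_zero_iff.1 (hBR hx)
      linarith
    filter_upwards [(isOpen_lt continuous_norm continuous_const).mem_nhds hx'] with y hy
    have hy : ‖y‖ < R + 1 := hy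
    rw [setIntegral_eq_integral_of_forall_compl_eq_zero,
      setIntegral_eq_integral_of_forall_compl_eq_zero,
      ← integral_sub_left_eq_self _ μ y]
    · refine integral_congr_ae (Filter.Eventually.of_forall fun z => ?_)
      simp only [sub_sub_cancel]
      ring
    · intro z hz
      rw [hfR z (by simpa using hz), zero_mul]
    · intro z hz
      have hz : 2 * R + 2 < ‖z‖ := by simpa [hs] using hz
      have := norm_sub_norm_le z y
      rw [norm_sub_rev] at this
      rw [hfR (y - z) (by linarith), mul_zero]
  rw [jet_congr_of_eventuallyEq _ (contDiff_setIntegral μ hF2 hBc) e2, jet_setIntegral μ hF2 hBc,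
    ← ContinuousLinearMap.integral_comp_comm (𝕜 := ℝ) (E := JetSpace k B) (Fₗ := ℝ) ℓ
      ((continuous_jet_slice hF2).continuousOn.integrableOn_compact hBc)]
  refine integral_eq_zero_of_ae (Filter.Eventually.of_forall fun y => ?_)
  have hp := comp_sub_mem_linearAlgebra hcn y
  have hj := jet_annihilator_linearAlgebra hσ hn ⊤ ℓ hℓ hp
  have e3 := jet_const_mul (B := B) (f y) (contDiff_of_mem_linearAlgebra (n := k) hp)
  exact (congrArg ℓ e3).trans (by rw [map_smul, hj, smul_zero]; rfl)

theorem norm_iteratedFDeriv_sub_le_of_jet {B : Set E} [CompactSpace B] {f g : E → ℝ}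
    (hf : ContDiff ℝ k f) (hg : ContDiff ℝ k g) {j : ℕ} (hj : j ≤ k) {x : E} (hx : x ∈ B) :
    ‖iteratedFDeriv ℝ j (fun x => f x - g x) x‖ ≤ ‖jet k B f hf - jet k B g hg‖ := by
  have hj' : ((j : ℕ) : WithTop ℕ∞) ≤ k := by exact_mod_cast hj
  have h3 := (ContinuousMap.norm_coe_le_norm _ (⟨x, hx⟩ : B)).trans
    (norm_le_pi_norm (jet k B f hf - jet k B g hg) ⟨j, Nat.lt_succ_of_le hj⟩)
  refine le_trans (le_of_eq ?_) h3
  exact congrArg norm (iteratedFDeriv_sub_apply (hf.of_le hj').contDiffAt (hg.of_le hj').contDiffAt)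

/-- Linear combinations of ridge functions with a non-polynomial activation of class `Cᵏ` are dense
in `Cᵏ(E)` with respect to uniform convergence of all derivatives of order at most `k` on compact
sets. -/
theorem exists_mem_ridgeSpan_iteratedFDeriv_near [FiniteDimensional ℝ E] {σ : ℝ → ℝ}
    (hσ : ContDiff ℝ k σ) (hn : IsNonpolynomial σ) {f : E → ℝ} (hf : ContDiff ℝ k f)
    {K : Set E} (hK : Bornology.IsBounded K) {η : ℝ} (hη : 0 < η) :
    ∃ g ∈ ridgeSpan σ (⊤ : Submodule ℝ (E →L[ℝ] ℝ)), ∀ j ≤ k, ∀ x ∈ K,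
      ‖iteratedFDeriv ℝ j (fun x => f x - g x) x‖ < η := by
  obtain ⟨r, hr, hKr⟩ := hK.subset_ball_lt 0 (0 : E)
  let χ : ContDiffBump (0 : E) := ⟨r, r + 1, hr, by linarith⟩
  have hf' : ContDiff ℝ k (fun x => χ x * f x) := χ.contDiff.mul hf
  have : CompactSpace (Metric.closedBall (0 : E) (r + 1)) :=
    isCompact_iff_compactSpace.1 (isCompact_closedBall _ _)
  obtain ⟨g, hg, hg', hgf⟩ := exists_mem_ridgeSpan_jet_near_of_hasCompactSupport hσ hn hf'
    (by linarith : 0 ≤ r + 1) (fun x hx => by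
      rw [χ.zero_of_le_dist (by simpa using hx.le), zero_mul]) subset_rfl hη
  refine ⟨g, hg, fun j hj x hx => lt_of_le_of_lt ?_ hgf⟩
  have hxr := hKr hx
  have e : (fun x => f x - g x) =ᶠ[nhds x] fun x => χ x * f x - g x := by
    filter_upwards [Metric.isOpen_ball.mem_nhds hxr] with y hy
    rw [χ.one_of_mem_closedBall (Metric.ball_subset_closedBall hy), one_mul]
  rw [(e.iteratedFDeriv ℝ j).eq_of_nhds]
  exact norm_iteratedFDeriv_sub_le_of_jet hf' hg' hj
    (Metric.ball_subset_closedBall (Metric.ball_subset_ball (by linarith) hxr))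

end Density

/-! ### Trajectories of autonomous dynamics -/

section Dynamics

theorem IsSolutionOperator.add {U V : Type*} [NormedAddCommGroup U] [NormedSpace ℝ U]
    [NormedAddCommGroup V] [NormedSpace ℝ V] {j : U →L[ℝ] V} {dom : Set U} {F : dom → V}
    {S : ℝ → U → U} (hS : IsSolutionOperator j dom F S) (u₀ : U) {s t : ℝ} (hs : 0 ≤ s)
    (ht : 0 ≤ t) : S (t + s) u₀ = S t (S s u₀) := by
  obtain ⟨-, hc, hd⟩ := hS.isSolution u₀
  refine hS.unique (S s u₀) (fun t => S (t + s) u₀) ⟨by simp, ?_, fun t ht => ?_⟩ t ht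
  · refine hc.comp (by fun_prop) fun t ht => ?_
    have : 0 ≤ t := ht
    exact add_nonneg this hs
  · obtain ⟨hm, hder⟩ := hd (t + s) (by linarith)
    exact ⟨hm, hder.comp_add_const t s⟩

theorem IsSolutionOperator.iterate {U V : Type*} [NormedAddCommGroup U] [NormedSpace ℝ U]
    [NormedAddCommGroup V] [NormedSpace ℝ V] {j : U →L[ℝ] V} {dom : Set U} {F : dom → V}
    {S : ℝ → U → U} (hS : IsSolutionOperator j dom F S) {h : ℝ} (hh : 0 < h) (k : ℕ) (u₀ : U) :
    S (k * h) u₀ = (S h)^[k] u₀ := by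
  induction k with
  | zero => simpa using (hS.isSolution u₀).init
  | succ k ih =>
    rw [Function.iterate_succ_apply', ← ih, ← hS.add u₀ (by positivity) hh.le]
    congr 1
    push_cast
    ring

/-- A continuous map is uniformly continuous near a compact set. -/
theorem exists_modulus_near_compact {U : Type*} [NormedAddCommGroup U] {T : U → U}
    (hT : Continuous T) {K : Set U} (hK : IsCompact K) {ε : ℝ} (hε : 0 < ε) :
    ∃ δ > 0, ∀ x ∈ K, ∀ y, ‖y - x‖ ≤ δ → ‖T y - T x‖ ≤ ε := by
  have h := hK.uniformContinuousAt_of_continuousAt (f := T)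
    (r := {q | dist q.1 q.2 < ε}) (fun x _ => hT.continuousAt) (Metric.dist_mem_uniformity hε)
  obtain ⟨δ, hδ, hδ'⟩ := Metric.mem_uniformity_dist.1 h
  refine ⟨δ / 2, half_pos hδ, fun x hx y hy => ?_⟩
  have hxy : dist x y < δ := by
    rw [dist_comm, dist_eq_norm]
    linarith
  have : dist (T x) (T y) < ε := hδ' hxy hx
  rw [dist_comm, dist_eq_norm] at this
  exact this.le

/-- Sequences which follow an orbit of a continuous map up to a small error, and a multiple of
the error that the map itself produces, stay close to the orbit. -/
theorem exists_tolerance_pseudoOrbit {U : Type*} [NormedAddCommGroup U] {T : U → U}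
    (hT : Continuous T) {K : Set U} (hK : IsCompact K) (n : ℕ) {ε : ℝ} (hε : 0 < ε) :
    ∃ θ > 0, ∀ y : ℕ → U, y 0 ∈ K →
      (∀ i < n, ‖y (i + 1) - T^[i + 1] (y 0)‖ ≤ θ + 2 * ‖T (y i) - T (T^[i] (y 0))‖) →
      ∀ k ≤ n, ‖y k - T^[k] (y 0)‖ ≤ ε := by
  induction n generalizing ε with
  | zero =>
    refine ⟨1, one_pos, fun y _ _ k hk => ?_⟩
    obtain rfl : k = 0 := by omega
    simpa using hε.le
  | succ n ih =>
    obtain ⟨δ, hδ, hmod⟩ := exists_modulus_near_compact hT (hK.image (hT.iterate n))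
      (show 0 < ε / 4 by positivity)
    obtain ⟨θ, hθ, h⟩ := ih (lt_min hε hδ)
    refine ⟨min θ (ε / 2), lt_min hθ (half_pos hε), fun y hy herr => ?_⟩
    have h0 := h y hy fun i hi => (herr i (by omega)).trans (by gcongr; exact min_le_left _ _)
    intro k hk
    rcases Nat.lt_or_ge n k with hnk | hkn
    · obtain rfl : k = n + 1 := by omega
      have h2 := hmod (T^[n] (y 0)) ⟨y 0, hy, rfl⟩ (y n) ((h0 n le_rfl).trans (min_le_right _ _))
      have h3 := herr n (by omega)
      have := min_le_right θ (ε / 2)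
      linarith
    · exact (h0 k hkn).trans (min_le_left _ _)

/-- Weights of a partition of unity at a point `y`: the weight of `zᵢ` is positive if `zᵢ` is a
nearest point of `y` among the points `zₗ`, up to `r`. -/
noncomputable def nearWeight {U : Type*} [NormedAddCommGroup U] {p : ℕ} (z : Fin p → U) (r : ℝ)
    (y : U) (i : Fin p) : ℝ :=
  max 0 (Metric.infDist y (range z) + r - ‖y - z i‖) /
    ∑ l, max 0 (Metric.infDist y (range z) + r - ‖y - z l‖)

theorem nearWeight_denominator_pos {U : Type*} [NormedAddCommGroup U] {p : ℕ} [NeZero p]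
    (z : Fin p → U) {r : ℝ} (hr : 0 < r) (y : U) :
    0 < ∑ l, max 0 (Metric.infDist y (range z) + r - ‖y - z l‖) := by
  obtain ⟨_, ⟨i₀, rfl⟩, hi₀⟩ := (Metric.infDist_lt_iff (x := y) (range_nonempty z)).1
    (lt_add_of_pos_right (Metric.infDist y (range z)) hr)
  rw [dist_eq_norm] at hi₀
  exact Finset.sum_pos' (fun l _ => le_max_left _ _)
    ⟨i₀, Finset.mem_univ _, lt_max_of_lt_right (by linarith)⟩

theorem nearWeight_nonneg {U : Type*} [NormedAddCommGroup U] {p : ℕ} (z : Fin p → U) (r : ℝ)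
    (y : U) (i : Fin p) : 0 ≤ nearWeight z r y i :=
  div_nonneg (le_max_left _ _) (Finset.sum_nonneg fun _ _ => le_max_left _ _)

theorem sum_nearWeight {U : Type*} [NormedAddCommGroup U] {p : ℕ} [NeZero p]
    (z : Fin p → U) {r : ℝ} (hr : 0 < r) (y : U) : ∑ i, nearWeight z r y i = 1 := by
  unfold nearWeight
  rw [← Finset.sum_div, div_self (nearWeight_denominator_pos z hr y).ne']

theorem norm_sub_sum_nearWeight_le {U : Type*} [NormedAddCommGroup U] [NormedSpace ℝ U] {p : ℕ}
    [NeZero p] (z : Fin p → U) {r : ℝ} (hr : 0 < r) (y : U) :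
    ‖y - ∑ i, nearWeight z r y i • z i‖ ≤ Metric.infDist y (range z) + r := by
  set R := Metric.infDist y (range z) + r with hR
  have hsum := sum_nearWeight z hr y
  have e : y - ∑ i, nearWeight z r y i • z i = ∑ i, nearWeight z r y i • (y - z i) := by
    simp_rw [smul_sub, Finset.sum_sub_distrib, ← Finset.sum_smul, hsum, one_smul]
  rw [e]
  calc ‖∑ i, nearWeight z r y i • (y - z i)‖ ≤ ∑ i, nearWeight z r y i * R := by
        refine norm_sum_le_of_le _ fun i _ => ?_
        rw [norm_smul, Real.norm_of_nonneg (nearWeight_nonneg z r y i)]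
        rcases le_or_gt R ‖y - z i‖ with h | h
        · have : nearWeight z r y i = 0 := by
            unfold nearWeight
            rw [max_eq_left (by linarith), zero_div]
          simp [this]
        · exact mul_le_mul_of_nonneg_left h.le (nearWeight_nonneg z r y i)
    _ = R := by rw [← Finset.sum_mul, hsum, one_mul]

theorem continuous_nearWeight {U : Type*} [NormedAddCommGroup U] {p : ℕ} [NeZero p]
    (z : Fin p → U) {r : ℝ} (hr : 0 < r) : Continuous (nearWeight z r) := by
  have := Metric.continuous_infDist_pt (range z)
  refine continuous_pi fun i => Continuous.div ?_ ?_ fun y =>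
    (nearWeight_denominator_pos z hr y).ne'
  · fun_prop
  · fun_prop

/-- A criterion for the approximation of trajectories: the maps of the class approximate, on compact
sets, all continuous convex combinations of finitely many points, and their values can be kept in
a compact set `C₀` that depends on the points and the accuracy only, not on the compact set on which
the approximation takes place. It therefore suffices to approximate on a compact set that
contains `C₀`, and the iterates do not leave it. -/
theorem approximatesTrajectories_of_convexCombinations (U : Type u) [NormedAddCommGroup U]
    [NormedSpace ℝ U] (𝒩 : Set (U → U))
    (H : ∀ (p : ℕ) (z : Fin p → U) (η : ℝ), 0 < η → ∃ C₀ : Set U, IsCompact C₀ ∧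
      ∀ C : Set U, IsCompact C → ∀ τ : U → Fin p → ℝ, ContinuousOn τ C →
        (∀ u ∈ C, (∀ i, 0 ≤ τ u i) ∧ ∑ i, τ u i = 1) →
        ∃ N ∈ 𝒩, ∀ u ∈ C, N u ∈ C₀ ∧ ‖N u - ∑ i, τ u i • z i‖ ≤ η) :
    ApproximatesTrajectories.{u, v} U 𝒩 := by
  intro V _ _ j dom F S _ hS h hh hlip K hK n ε hε
  set T := S h with hTdef
  have hT : Continuous T := hlip.continuous
  -- the compact set of all points that the true orbits visit
  set K' : Set U := ⋃ i ∈ Finset.range (n + 1), T^[i] '' K with hK'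
  have hK'c : IsCompact K' :=
    (Finset.range (n + 1)).isCompact_biUnion fun i _ => hK.image (hT.iterate i)
  have hmemK' : ∀ u ∈ K, ∀ i ≤ n, T^[i] u ∈ K' := fun u hu i hi =>
    mem_biUnion (Finset.mem_coe.2 (Finset.mem_range.2 (by omega))) ⟨u, hu, rfl⟩
  obtain ⟨θ, hθ, horb⟩ := exists_tolerance_pseudoOrbit hT hK n (half_pos hε)
  -- a finite net of the visited points; adding the origin makes it nonempty
  obtain ⟨t, -, htfin, htK⟩ := (hK'c.insert 0).finite_cover_balls (show 0 < θ / 4 by positivity)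
  obtain ⟨p, z, hz⟩ : ∃ (p : ℕ) (z : Fin p → U), range z = t := by
    have := htfin.fintype
    refine ⟨Fintype.card t, fun i => ((Fintype.equivFin t).symm i : U), ?_⟩
    rw [range_comp' Subtype.val, (Fintype.equivFin t).symm.range_eq_univ, image_univ,
      Subtype.range_coe]
  have hnet : ∀ x ∈ K', ∃ i, ‖x - z i‖ < θ / 4 := by
    intro x hx
    obtain ⟨y, hy, hxy⟩ := mem_iUnion₂.1 (htK (mem_insert_of_mem _ hx))
    rw [← hz] at hy
    obtain ⟨i, rfl⟩ := hy
    exact ⟨i, by simpa [dist_eq_norm] using hxy⟩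
  have hp : NeZero p := by
    obtain ⟨y, hy, -⟩ := mem_iUnion₂.1 (htK (mem_insert _ _))
    rw [← hz] at hy
    obtain ⟨i, -⟩ := hy
    exact ⟨fun h => (h ▸ i).elim0⟩
  obtain ⟨C₀, hC₀, HC₀⟩ := H p z (θ / 4) (by positivity)
  have hr : 0 < θ / 4 := by positivity
  obtain ⟨N, hN, hNC⟩ := HC₀ (K ∪ C₀) (hK.union hC₀) (fun u => nearWeight z (θ / 4) (T u))
    ((continuous_nearWeight z hr).comp hT).continuousOn
    fun u _ => ⟨nearWeight_nonneg z _ _, sum_nearWeight z hr _⟩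
  refine ⟨N, hN, ε / 2, half_lt_self hε, fun u₀ hu₀ k hk => ?_⟩
  have hmem : ∀ i, N^[i] u₀ ∈ K ∪ C₀ := by
    intro i
    induction i with
    | zero => exact Or.inl hu₀
    | succ i ih =>
      rw [Function.iterate_succ_apply']
      exact Or.inr (hNC _ ih).1
  have key := horb (fun i => N^[i] u₀) hu₀ (fun i hi => ?_) k (Finset.mem_Icc.1 hk).2
  · rw [hS.iterate hh, norm_sub_rev]
    exact key
  · set y := N^[i] u₀ with hy
    have h1 := (hNC y (hmem i)).2
    have h2 := norm_sub_sum_nearWeight_le z hr (T y)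
    obtain ⟨l, hl⟩ := hnet _ (hmemK' u₀ hu₀ (i + 1) (by omega))
    have h3 : Metric.infDist (T y) (range z) ≤ ‖T y - T^[i + 1] u₀‖ + θ / 4 := by
      refine (Metric.infDist_le_dist_of_mem (mem_range_self l)).trans ?_
      rw [dist_eq_norm]
      have := norm_sub_le_norm_sub_add_norm_sub (T y) (T^[i + 1] u₀) (z l)
      linarith
    have h4 := norm_sub_le_norm_sub_add_norm_sub (N y)
      (∑ i, nearWeight z (θ / 4) (T y) i • z i) (T^[i + 1] u₀)
    have h5 := norm_sub_le_norm_sub_add_norm_sub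
      (∑ i, nearWeight z (θ / 4) (T y) i • z i) (T y) (T^[i + 1] u₀)
    rw [norm_sub_rev _ (T y)] at h5
    change ‖N^[i + 1] u₀ - T^[i + 1] u₀‖ ≤ θ + 2 * ‖T y - T (T^[i] u₀)‖
    rw [Function.iterate_succ_apply' N, ← hy]
    rw [Function.iterate_succ_apply'] at h3 h4 h5 ⊢
    linarith

end Dynamics

/-! ### Networks with one hidden layer, and Euclidean phase spaces -/

section Networks

variable {E : Type*} [NormedAddCommGroup E] [NormedSpace ℝ E]

/-- Finitely many functions from `ridgeSpan σ Λ` can share their hidden neurons. -/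
theorem exists_common_sum_of_mem_ridgeSpan {σ : ℝ → ℝ} {Λ : Submodule ℝ (E →L[ℝ] ℝ)} {m : ℕ}
    {f : Fin m → E → ℝ} (hf : ∀ i, f i ∈ ridgeSpan σ Λ) :
    ∃ (n : ℕ) (q : Fin m → Fin n → ℝ) (b : Fin n → ℝ) (L : Fin n → E →L[ℝ] ℝ),
      (∀ r, L r ∈ Λ) ∧ ∀ i x, f i x = ∑ r, q i r * σ (L r x + b r) := by
  choose n q b L hL h using fun i => exists_sum_of_mem_ridgeSpan (hf i)
  let e := Fintype.equivFin (Σ i, Fin (n i))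
  refine ⟨_, fun i r => if i = (e.symm r).1 then q (e.symm r).1 (e.symm r).2 else 0,
    fun r => b (e.symm r).1 (e.symm r).2, fun r => L (e.symm r).1 (e.symm r).2,
    fun r => hL _ _, fun i x => ?_⟩
  rw [e.symm.sum_comp (fun s : Σ i, Fin (n i) =>
    (if i = s.1 then q s.1 s.2 else 0) * σ (L s.1 s.2 x + b s.1 s.2)), Fintype.sum_sigma,
    Finset.sum_eq_single i]
  · simpa using h i x
  · intro l _ hl
    simp [Ne.symm hl]
  · simp

theorem comp_mem_ridgeSpan {E' : Type*} [NormedAddCommGroup E'] [NormedSpace ℝ E'] {σ : ℝ → ℝ}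
    {Λ : Submodule ℝ (E' →L[ℝ] ℝ)} {g : E' → ℝ} (hg : g ∈ ridgeSpan σ Λ) (A : E →L[ℝ] E') :
    (fun x => g (A x)) ∈ ridgeSpan σ (⊤ : Submodule ℝ (E →L[ℝ] ℝ)) := by
  induction hg using Submodule.span_induction with
  | mem f hf =>
    obtain ⟨L, -, b, rfl⟩ := hf
    exact Submodule.subset_span ⟨L.comp A, trivial, b, rfl⟩
  | zero => exact Submodule.zero_mem _
  | add f g _ _ hf hg => exact Submodule.add_mem _ hf hg
  | smul c f _ hf => exact Submodule.smul_mem _ c hf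

theorem ContinuousLinearMap.apply_eq_sum_single {a : ℕ} (L : (Fin a → ℝ) →L[ℝ] ℝ) (x : Fin a → ℝ) :
    L x = ∑ j, L (Pi.single j 1) * x j := by
  conv_lhs => rw [← Finset.univ_sum_single x]
  rw [map_sum]
  refine Finset.sum_congr rfl fun j _ => ?_
  rw [mul_comm, ← smul_eq_mul, ← map_smul, ← Pi.single_smul, smul_eq_mul, mul_one]

theorem exists_feedForward_of_mem_ridgeSpan {σ : ℝ → ℝ} {a b : ℕ} {f : Fin b → (Fin a → ℝ) → ℝ}
    (hf : ∀ i, f i ∈ ridgeSpan σ ⊤) :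
    ∃ N : FeedForward b a, ∀ x i, N.eval σ x i = f i x := by
  obtain ⟨n, q, c, L, -, h⟩ := exists_common_sum_of_mem_ridgeSpan hf
  refine ⟨.layer (Matrix.of fun r j => L r (Pi.single j 1)) c (.affine (Matrix.of q) 0),
    fun x i => ?_⟩
  rw [h]
  simp only [FeedForward.eval, add_zero, Pi.zero_apply, Matrix.mulVec, dotProduct,
    Matrix.of_apply, Pi.add_apply]
  exact Finset.sum_congr rfl fun r _ => by rw [← (L r).apply_eq_sum_single]

theorem EuclideanSpace.norm_le_sum_abs {m : ℕ} (x : EuclideanSpace ℝ (Fin m)) :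
    ‖x‖ ≤ ∑ i, |x i| := by
  conv_lhs => rw [← (EuclideanSpace.basisFun (Fin m) ℝ).sum_repr x]
  refine (norm_sum_le _ _).trans (Finset.sum_le_sum fun i _ => ?_)
  rw [norm_smul, (EuclideanSpace.basisFun (Fin m) ℝ).orthonormal.1 i, mul_one]
  simp

/-- Uniform approximation of continuous maps by networks on compact sets, in the form required by
`approximatesTrajectories_of_convexCombinations`. -/
theorem approximatesTrajectories_feedForwardMaps (d : ℕ) {σ : ℝ → ℝ} (hσ : Continuous σ)
    (hn : IsNonpolynomial σ) :
    ApproximatesTrajectories.{0, v} (EuclideanSpace ℝ (Fin d)) (feedForwardMaps σ d) := by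
  refine approximatesTrajectories_of_convexCombinations _ _ fun p z η hη =>
    ⟨Metric.closedBall 0 (∑ i, ‖z i‖ + η), isCompact_closedBall _ _, fun C hC τ hτ hτ1 => ?_⟩
  have hη' : 0 < η / (d + 1) := by positivity
  have hf : ∀ l : Fin d, ContinuousOn (fun u => (∑ i, τ u i • z i) l) C := by
    intro l
    have : ∀ i, ContinuousOn (fun u => τ u i) C := fun i => continuousOn_pi.1 hτ i
    have h2 : ContinuousOn (fun u => ∑ i, τ u i • z i) C :=
      continuousOn_finsetSum _ fun i _ => (this i).smul continuousOn_const
    exact (EuclideanSpace.proj (𝕜 := ℝ) l).continuous.comp_continuousOn h2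
  choose g hg hgf using fun l => exists_mem_ridgeSpan_near_of_separatesPoints hC hσ hn
    (⊤ : Submodule ℝ (EuclideanSpace ℝ (Fin d) →L[ℝ] ℝ)) (fun x _ y _ hxy => by
      by_contra! hcon
      exact hxy (PiLp.ext fun i => hcon (EuclideanSpace.proj i) trivial)) (hf l) hη'
  let A : (Fin d → ℝ) →L[ℝ] EuclideanSpace ℝ (Fin d) := (EuclideanSpace.equiv (Fin d) ℝ).symm
  obtain ⟨N, hN⟩ := exists_feedForward_of_mem_ridgeSpan fun l => comp_mem_ridgeSpan (hg l) A
  refine ⟨fun x => WithLp.toLp 2 (N.eval σ x.ofLp), ⟨N, fun _ => rfl⟩, fun u hu => ?_⟩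
  have herr : ‖WithLp.toLp 2 (N.eval σ u.ofLp) - ∑ i, τ u i • z i‖ ≤ η := by
    refine (EuclideanSpace.norm_le_sum_abs _).trans ?_
    calc ∑ l, |(WithLp.toLp 2 (N.eval σ u.ofLp) - ∑ i, τ u i • z i) l|
        ≤ ∑ _l : Fin d, η / (d + 1) := Finset.sum_le_sum fun l _ => by
          have := (hgf l u hu).le
          rw [PiLp.sub_apply]
          change |N.eval σ u.ofLp l - _| ≤ _
          rw [hN]
          exact this
      _ = d * η / (d + 1) := by simp; ring
      _ ≤ η := by
          rw [div_le_iff₀ (by positivity)]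
          nlinarith
  refine ⟨?_, herr⟩
  rw [mem_closedBall_zero_iff]
  have h1 : ‖∑ i, τ u i • z i‖ ≤ ∑ i, ‖z i‖ := by
    refine norm_sum_le_of_le _ fun i _ => ?_
    rw [norm_smul, Real.norm_of_nonneg ((hτ1 u hu).1 i)]
    have : τ u i ≤ 1 := (hτ1 u hu).2 ▸
      Finset.single_le_sum (fun i _ => (hτ1 u hu).1 i) (Finset.mem_univ i)
    exact mul_le_of_le_one_left (norm_nonneg _) this
  have h2 := norm_le_norm_add_norm_sub' (WithLp.toLp 2 (N.eval σ u.ofLp)) (∑ i, τ u i • z i)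
  linarith

end Networks

/-! ### A class of neural operators with two layers -/

section Realisation

/-- Operators that encode the input function by finitely many averages, feed these into a hidden
layer, and use the result as parameters of a network in the space variable, are neural operators.
The channels of the architecture are the `m` components of the input function, the `n₁` neurons of
the encoder, and the `n₂` neurons of the decoder. -/
theorem exists_neuralOperator_encoder_decoder {d m n₁ n₂ : ℕ} {σ : ℝ → ℝ}
    {D : Set (EuclideanSpace ℝ (Fin d))} (hD : volume D ≠ ⊤)
    {κ : Fin n₁ → Fin m → EuclideanSpace ℝ (Fin d) → ℝ} (hκ : ∀ r j, κ r j ∈ ridgeSpan σ ⊤)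
    (b : Fin n₁ → ℝ) (W : Fin n₂ → Fin n₁ → ℝ) (a : Fin n₂ → EuclideanSpace ℝ (Fin d) →L[ℝ] ℝ)
    (β : Fin n₂ → ℝ) (q : Fin m → Fin n₂ → ℝ) :
    ∃ N : NeuralOperator d m, ∀ u : EuclideanSpace ℝ (Fin d) → EuclideanSpace ℝ (Fin m),
      IntegrableOn u D → LayersIntegrable σ D N.layers (N.lifted σ u) ∧
        ∀ x l, N.eval σ D u x l = ∑ s, q l s *
          σ (∑ r, W s r * σ ((∫ y in D, ∑ j, κ r j y * u y j) + b r) + (a s x + β s)) := by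
  classical
  let Ch := Fin m ⊕ Fin n₁ ⊕ Fin n₂
  let e : Fin (Fintype.card Ch) ≃ Ch := (Fintype.equivFin Ch).symm
  let pr : (Fin (d + d) → ℝ) →L[ℝ] EuclideanSpace ℝ (Fin d) :=
    ((EuclideanSpace.equiv (Fin d) ℝ).symm : (Fin d → ℝ) →L[ℝ] EuclideanSpace ℝ (Fin d)).comp
      (ContinuousLinearMap.pi fun i => ContinuousLinearMap.proj (Fin.natAdd d i))
  have hpr : ∀ x y : EuclideanSpace ℝ (Fin d), pr (Fin.append x.ofLp y.ofLp) = y := by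
    intro x y
    refine PiLp.ext fun i => ?_
    exact Fin.append_right x.ofLp y.ofLp i
  -- the kernel of the first layer sends the input channels to the encoder channels
  let κ' : Ch → Ch → EuclideanSpace ℝ (Fin d) → ℝ :=
    Sum.elim (fun _ _ => 0) (Sum.elim (fun r => Sum.elim (fun j => κ r j) fun _ => 0) fun _ _ => 0)
  have hκ' : ∀ s t, κ' s t ∈ ridgeSpan σ ⊤ := by
    rintro (j | r | s) (j' | r' | s')
    · exact Submodule.zero_mem _
    · exact Submodule.zero_mem _
    · exact Submodule.zero_mem _
    · exact hκ r j'
    · exact Submodule.zero_mem _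
    · exact Submodule.zero_mem _
    · exact Submodule.zero_mem _
    · exact Submodule.zero_mem _
    · exact Submodule.zero_mem _
  obtain ⟨K, hK⟩ := exists_feedForward_of_mem_ridgeSpan (σ := σ)
    (f := fun (o : Fin (Fintype.card Ch * Fintype.card Ch)) z =>
      κ' (e (finProdFinEquiv.symm o).1) (e (finProdFinEquiv.symm o).2) (pr z))
    fun o => comp_mem_ridgeSpan (hκ' _ _) pr
  let P : FeedForward (Fintype.card Ch) m :=
    .affine (Matrix.of fun i j => Sum.elim (fun l => if l = j then 1 else 0) (fun _ => 0) (e i)) 0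
  let ℓ₁ : OperatorLayer d (Fintype.card Ch) :=
    ⟨0, K, .affine 0 fun i => Sum.elim (fun _ => 0) (Sum.elim b fun _ => 0) (e i)⟩
  let W' : Ch → Ch → ℝ :=
    Sum.elim (fun _ _ => 0) (Sum.elim (fun _ _ => 0) fun s =>
      Sum.elim (fun _ => 0) (Sum.elim (W s) fun _ => 0))
  let ℓ₂ : OperatorLayer d (Fintype.card Ch) :=
    ⟨Matrix.of fun i i' => W' (e i) (e i'), .affine 0 0,
      .affine (Matrix.of fun i j => Sum.elim (fun _ => 0) (Sum.elim (fun _ => 0)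
        fun s => a s (EuclideanSpace.single j 1)) (e i))
        fun i => Sum.elim (fun _ => 0) (Sum.elim (fun _ => 0) β) (e i)⟩
  let Q : FeedForward m (Fintype.card Ch) :=
    .affine (Matrix.of fun l i => Sum.elim (fun _ => 0) (Sum.elim (fun _ => 0) (q l)) (e i)) 0
  refine ⟨⟨Fintype.card Ch, P, [ℓ₁, ℓ₂], Q⟩, fun u hu => ?_⟩
  have hP : ∀ y i, P.eval σ (u y).ofLp i = Sum.elim (fun l => u y l) (fun _ => 0) (e i) := by
    intro y i
    simp only [P, FeedForward.eval, add_zero, Matrix.mulVec, dotProduct, Matrix.of_apply]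
    rcases e i with l | s
    · simp
    · simp
  have h₁ : ∀ x i, ℓ₁.apply σ D (fun y => P.eval σ (u y).ofLp) x i =
      σ (Sum.elim (fun _ => 0) (Sum.elim
        (fun r => (∫ y in D, ∑ j, κ r j y * u y j) + b r) fun _ => 0) (e i)) := by
    intro x i
    have hint : ∀ y, ∑ j, K.eval σ (Fin.append x.ofLp y.ofLp) (finProdFinEquiv (i, j)) *
        P.eval σ (u y).ofLp j = ∑ j : Fin m, κ' (e i) (Sum.inl j) y * u y j := by
      intro y
      simp only [hK, hP, hpr, Equiv.symm_apply_apply]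
      rw [e.sum_comp (fun t => κ' (e i) t y * Sum.elim (fun l => u y l) (fun _ => 0) t),
        Fintype.sum_sum_type]
      simp
    simp only [OperatorLayer.apply, ℓ₁, hint, FeedForward.eval, Matrix.zero_mulVec, Pi.add_apply,
      Pi.zero_apply, zero_add]
    congr 1
    rcases e i with l | r | s
    · simp [κ']
    · simp [κ']
    · simp [κ']
  refine ⟨⟨?_, ?_, trivial⟩, fun x l => ?_⟩
  · refine Integrable.of_eval fun i => ?_
    simp only [NeuralOperator.lifted, hP]
    rcases e i with l | s
    · exact (EuclideanSpace.proj (𝕜 := ℝ) l).integrable_comp hu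
    · exact integrable_zero _ _ _
  · refine Integrable.of_eval fun i => ?_
    have : (fun x => ℓ₁.apply σ D (fun y => P.eval σ (u y).ofLp) x i) = fun _ => _ :=
      funext fun x => h₁ x i
    exact this ▸ integrableOn_const hD
  · have ha : ∀ s (x : EuclideanSpace ℝ (Fin d)),
        a s x = ∑ j, a s (EuclideanSpace.single j 1) * x j := by
      intro s x
      conv_lhs => rw [← (EuclideanSpace.basisFun (Fin d) ℝ).sum_repr x]
      rw [map_sum]
      refine Finset.sum_congr rfl fun j _ => ?_
      rw [map_smul, smul_eq_mul, mul_comm]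
      simp
    have h₂' : ∀ v i s, e i = Sum.inr (Sum.inr s) → ℓ₂.apply σ D v x i =
        σ (∑ i', W' (Sum.inr (Sum.inr s)) (e i') * v x i' + (a s x + β s)) := by
      intro v i s hi
      rw [ha s x]
      simp only [OperatorLayer.apply, ℓ₂, FeedForward.eval, Matrix.zero_mulVec, Pi.add_apply,
        Pi.zero_apply, add_zero, zero_mul, Finset.sum_const_zero, integral_zero,
        Matrix.mulVec, dotProduct, Matrix.of_apply, hi, Sum.elim_inr]
    have h₂ : ∀ i s, e i = Sum.inr (Sum.inr s) →
        ℓ₂.apply σ D (ℓ₁.apply σ D (fun y => P.eval σ (u y).ofLp)) x i =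
        σ (∑ r, W s r * σ ((∫ y in D, ∑ j, κ r j y * u y j) + b r) + (a s x + β s)) := by
      intro i s hi
      rw [h₂' _ i s hi]
      simp only [h₁]
      rw [e.sum_comp (fun t => W' (Sum.inr (Sum.inr s)) t * σ (Sum.elim (fun _ => 0) (Sum.elim
        (fun r => (∫ y in D, ∑ j, κ r j y * u y j) + b r) fun _ => 0) t)), Fintype.sum_sum_type,
        Fintype.sum_sum_type]
      simp [W']
    change Q.eval σ (ℓ₂.apply σ D (ℓ₁.apply σ D (fun y => P.eval σ (u y).ofLp)) x) l = _
    simp only [Q, FeedForward.eval, add_zero, Matrix.mulVec, dotProduct, Matrix.of_apply]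
    have hsum : ∀ i, Sum.elim (fun _ => 0) (Sum.elim (fun _ => 0) (q l)) (e i) *
        ℓ₂.apply σ D (ℓ₁.apply σ D (fun y => P.eval σ (u y).ofLp)) x i =
        (fun t : Ch => Sum.elim (fun _ => 0) (Sum.elim (fun _ => 0) fun s => q l s *
          σ (∑ r, W s r * σ ((∫ y in D, ∑ j, κ r j y * u y j) + b r) + (a s x + β s))) t) (e i) := by
      intro i
      rcases hi : e i with j | r | s
      · simp
      · simp
      · simp [h₂ i s hi]
    rw [Finset.sum_congr rfl fun i _ => hsum i, e.sum_comp, Fintype.sum_sum_type,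
      Fintype.sum_sum_type]
    simp

end Realisation

/-! ### Neural operators on function spaces -/

section FunctionSpaces

variable {d m k : ℕ} {D : Set (EuclideanSpace ℝ (Fin d))}

theorem norm_iteratedFDeriv_le_sum_components {E : Type*} [NormedAddCommGroup E] [NormedSpace ℝ E]
    {g : E → EuclideanSpace ℝ (Fin m)} (hg : ContDiff ℝ k g) {j : ℕ} (hj : j ≤ k) (x : E) :
    ‖iteratedFDeriv ℝ j g x‖ ≤ ∑ l, ‖iteratedFDeriv ℝ j (fun x => g x l) x‖ := by
  have hjk : (j : WithTop ℕ∞) ≤ k := by exact_mod_cast hj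
  have hgl : ∀ l, ContDiff ℝ j (fun x => g x l) := fun l =>
    ((EuclideanSpace.proj (𝕜 := ℝ) l).contDiff.comp hg).of_le hjk
  have e : ∀ l, iteratedFDeriv ℝ j (fun x => g x l) x =
      (EuclideanSpace.proj (𝕜 := ℝ) l).compContinuousMultilinearMap (iteratedFDeriv ℝ j g x) :=
    fun l => (EuclideanSpace.proj (𝕜 := ℝ) l).iteratedFDeriv_comp_left hg.contDiffAt hjk
  refine ContinuousMultilinearMap.opNorm_le_bound (Finset.sum_nonneg fun _ _ => norm_nonneg _)
    fun v => ?_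
  refine (EuclideanSpace.norm_le_sum_abs _).trans ?_
  rw [Finset.sum_mul]
  refine Finset.sum_le_sum fun l _ => ?_
  have := (iteratedFDeriv ℝ j (fun x => g x l) x).le_opNorm v
  rw [e l] at this ⊢
  exact this

theorem continuous_of_mem_ridgeSpan {E : Type*} [NormedAddCommGroup E] [NormedSpace ℝ E]
    {σ : ℝ → ℝ} (hσ : Continuous σ) {Λ : Submodule ℝ (E →L[ℝ] ℝ)}
    {g : E → ℝ} (hg : g ∈ ridgeSpan σ Λ) : Continuous g :=
  (contDiff_of_mem_ridgeSpan (k := 0) (contDiff_zero.2 hσ) hg).continuous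

theorem exists_bound_of_isBounded (hD : Bornology.IsBounded D) {κ : EuclideanSpace ℝ (Fin d) → ℝ}
    (hκ : Continuous κ) : ∃ M : ℝ, 0 ≤ M ∧ ∀ x ∈ D, |κ x| ≤ M := by
  obtain ⟨M, hM⟩ := hD.isCompact_closure.exists_bound_of_continuousOn hκ.continuousOn
  exact ⟨|M|, abs_nonneg _, fun x hx => (hM x (subset_closure hx)).trans (le_abs_self _)⟩

theorem integrable_mul_component (hD : Bornology.IsBounded D) (hDm : MeasurableSet D)
    {κ : EuclideanSpace ℝ (Fin d) → ℝ} (hκ : Continuous κ)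
    {w : EuclideanSpace ℝ (Fin d) → EuclideanSpace ℝ (Fin m)}
    (hw : IntegrableOn w D) (j : Fin m) : IntegrableOn (fun y => κ y * w y j) D := by
  obtain ⟨M, -, hM⟩ := exists_bound_of_isBounded hD hκ
  refine Integrable.bdd_mul (c := M) ((EuclideanSpace.proj (𝕜 := ℝ) j).integrable_comp hw)
    hκ.aestronglyMeasurable ?_
  filter_upwards [ae_restrict_mem hDm] with y hy using hM y hy

/-- Integration against a continuous function, as a functional on `L¹(D)`. -/
theorem exists_clm_integral (hD : Bornology.IsBounded D) (hDm : MeasurableSet D)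
    {κ : Fin m → EuclideanSpace ℝ (Fin d) → ℝ} (hκ : ∀ j, Continuous (κ j)) :
    ∃ L : Lp (EuclideanSpace ℝ (Fin m)) 1 (volume.restrict D) →L[ℝ] ℝ,
      ∀ w, L w = ∫ y in D, ∑ j, κ j y * w y j := by
  choose M hM0 hM using fun j => exists_bound_of_isBounded hD (hκ j)
  have hint : ∀ w : Lp (EuclideanSpace ℝ (Fin m)) 1 (volume.restrict D),
      IntegrableOn (fun y => ∑ j, κ j y * w y j) D := fun w =>
    integrable_finsetSum _ fun j _ =>
      integrable_mul_component hD hDm (hκ j) (L1.integrable_coeFn w) j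
  refine ⟨LinearMap.mkContinuous
    { toFun := fun w => ∫ y in D, ∑ j, κ j y * w y j
      map_add' := fun w w' => ?_
      map_smul' := fun c w => ?_ } (∑ j, M j) fun w => ?_, fun w => rfl⟩
  · rw [← integral_add (hint w) (hint w')]
    refine integral_congr_ae ?_
    filter_upwards [Lp.coeFn_add w w'] with y hy
    simp only [hy, Pi.add_apply, PiLp.add_apply, mul_add, Finset.sum_add_distrib]
  · rw [RingHom.id_apply, ← integral_smul]
    refine integral_congr_ae ?_
    filter_upwards [Lp.coeFn_smul c w] with y hy
    simp only [hy, Pi.smul_apply, PiLp.smul_apply, smul_eq_mul, Finset.mul_sum]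
    exact Finset.sum_congr rfl fun j _ => by ring
  · rw [L1.norm_eq_integral_norm, ← integral_const_mul]
    refine norm_integral_le_of_norm_le ((L1.integrable_coeFn w).norm.const_mul _) ?_
    filter_upwards [ae_restrict_mem hDm] with y hy
    rw [Finset.sum_mul]
    refine norm_sum_le_of_le _ fun j _ => ?_
    rw [norm_mul]
    exact mul_le_mul (hM j y hy) (PiLp.norm_apply_le _ _) (norm_nonneg _) (hM0 j)

variable {X : Type u} [NormedAddCommGroup X] [NormedSpace ℝ X]
  {ι : X →L[ℝ] Lp (EuclideanSpace ℝ (Fin m)) 1 (volume.restrict D)}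

/-- The functionals `u ↦ ∫_D κ · u` whose kernel `κ` is a network with one hidden layer. -/
def kernelFunctionals (σ : ℝ → ℝ) (hσ : Continuous σ) (hD : Bornology.IsBounded D)
    (hDm : MeasurableSet D) (ι : X →L[ℝ] Lp (EuclideanSpace ℝ (Fin m)) 1 (volume.restrict D)) :
    Submodule ℝ (X →L[ℝ] ℝ) where
  carrier := {L | ∃ κ : Fin m → EuclideanSpace ℝ (Fin d) → ℝ, (∀ j, κ j ∈ ridgeSpan σ ⊤) ∧
    ∀ u, L u = ∫ y in D, ∑ j, κ j y * ι u y j}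
  zero_mem' := ⟨0, fun _ => Submodule.zero_mem _, fun u => by simp⟩
  add_mem' := by
    rintro L L' ⟨κ, hκ, hL⟩ ⟨κ', hκ', hL'⟩
    refine ⟨κ + κ', fun j => Submodule.add_mem _ (hκ j) (hκ' j), fun u => ?_⟩
    rw [add_apply, hL, hL', ← integral_add]
    · simp [add_mul, Finset.sum_add_distrib]
    · exact integrable_finsetSum _ fun j _ => integrable_mul_component hD hDm
        (continuous_of_mem_ridgeSpan hσ (hκ j)) (L1.integrable_coeFn _) j
    · exact integrable_finsetSum _ fun j _ => integrable_mul_component hD hDm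
        (continuous_of_mem_ridgeSpan hσ (hκ' j)) (L1.integrable_coeFn _) j
  smul_mem' := by
    rintro c L ⟨κ, hκ, hL⟩
    refine ⟨c • κ, fun j => Submodule.smul_mem _ c (hκ j), fun u => ?_⟩
    rw [smul_apply, hL, ← integral_smul]
    simp [Finset.mul_sum, mul_assoc]

/-- The averages against networks determine a function, because networks are uniformly dense in the
continuous functions. -/
theorem kernelFunctionals_separate {σ : ℝ → ℝ} (hσ : Continuous σ) (hn : IsNonpolynomial σ)
    (hD : Bornology.IsBounded D) (hDm : MeasurableSet D) (hι : Function.Injective ι) {u u' : X}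
    (huu : u ≠ u') : ∃ L ∈ kernelFunctionals σ hσ hD hDm ι, L u ≠ L u' := by
  by_contra! hcon
  refine huu (hι ?_)
  rw [← sub_eq_zero, ← map_sub]
  set w := ι (u - u') with hw
  have hwint : IntegrableOn w D := L1.integrable_coeFn w
  -- the components of `w` are orthogonal to all networks, hence to all continuous functions
  have h1 : ∀ l : Fin m, ∀ g ∈ ridgeSpan σ (⊤ : Submodule ℝ (EuclideanSpace ℝ (Fin d) →L[ℝ] ℝ)),
      ∫ y in D, g y * w y l = 0 := by
    intro l g hg
    have hmem : ∀ j, (Pi.single l g : Fin m → EuclideanSpace ℝ (Fin d) → ℝ) j ∈ ridgeSpan σ ⊤ := by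
      intro j
      rcases eq_or_ne j l with rfl | hj
      · simpa using hg
      · simp [hj]
    obtain ⟨L, hL⟩ := exists_clm_integral hD hDm fun j => continuous_of_mem_ridgeSpan hσ (hmem j)
    have hLu := hcon (L.comp ι) ⟨_, hmem, fun u => hL _⟩
    rw [← sub_eq_zero, ← map_sub, ContinuousLinearMap.comp_apply, hL] at hLu
    rw [← hLu]
    refine integral_congr_ae (Filter.Eventually.of_forall fun y => ?_)
    change _ = ∑ j, _
    rw [Finset.sum_eq_single l]
    · simp [hw]
    · intro j _ hj
      simp [hj]
    · simp
  have h2 : ∀ l : Fin m, ∀ f : EuclideanSpace ℝ (Fin d) → ℝ, Continuous f →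
      ∫ y in D, f y * w y l = 0 := by
    intro l f hf
    by_contra hne
    set I := ∫ y in D, ‖w y l‖ with hI
    have hI0 : 0 ≤ I := integral_nonneg fun _ => norm_nonneg _
    have hwl : IntegrableOn (fun y => w y l) D :=
      (EuclideanSpace.proj (𝕜 := ℝ) l).integrable_comp hwint
    obtain ⟨g, hg, hgf⟩ := exists_mem_ridgeSpan_near_of_separatesPoints hD.isCompact_closure hσ hn
      (⊤ : Submodule ℝ (EuclideanSpace ℝ (Fin d) →L[ℝ] ℝ)) (fun x _ y _ hxy => by
        by_contra! hcon
        exact hxy (PiLp.ext fun i => hcon (EuclideanSpace.proj i) trivial)) hf.continuousOn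
      (show 0 < |∫ y in D, f y * w y l| / (2 * (I + 1)) by positivity)
    set A := |∫ y in D, f y * w y l| with hA
    have hA0 : 0 < A := abs_pos.2 hne
    have h3 : ∫ y in D, f y * w y l = ∫ y in D, (f y - g y) * w y l := by
      have := integral_sub (integrable_mul_component hD hDm hf hwint l)
        (integrable_mul_component hD hDm (continuous_of_mem_ridgeSpan hσ hg) hwint l)
      rw [h1 l g hg, sub_zero] at this
      rw [← this]
      simp [sub_mul]
    have h4 : A ≤ A / (2 * (I + 1)) * I := by
      rw [hI, ← integral_const_mul, hA, h3, ← Real.norm_eq_abs]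
      refine norm_integral_le_of_norm_le (hwl.norm.const_mul _) ?_
      filter_upwards [ae_restrict_mem hDm] with y hy
      rw [norm_mul, ← h3]
      refine mul_le_mul_of_nonneg_right ?_ (norm_nonneg _)
      rw [Real.norm_eq_abs, abs_sub_comm]
      exact (hgf y (subset_closure hy)).le
    rw [div_mul_eq_mul_div, le_div_iff₀ (by positivity)] at h4
    nlinarith
  have h5 : ∀ l : Fin m, ∀ᵐ y ∂volume.restrict D, w y l = 0 := by
    intro l
    refine ae_eq_zero_of_integral_contDiff_smul_eq_zero (f := fun y => w y l)
      ((EuclideanSpace.proj (𝕜 := ℝ) l).integrable_comp hwint).locallyIntegrable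
      fun g hg _ => ?_
    exact h2 l g hg.continuous
  refine (Lp.eq_zero_iff_ae_eq_zero).2 ?_
  filter_upwards [ae_all_iff.2 h5] with y hy
  exact PiLp.ext hy

end FunctionSpaces

section Decoder

variable {d m k : ℕ} {D : Set (EuclideanSpace ℝ (Fin d))}
  {X : Type u} [NormedAddCommGroup X] [NormedSpace ℝ X]
  {ι : X →L[ℝ] Lp (EuclideanSpace ℝ (Fin m)) 1 (volume.restrict D)}

/-- The norm of `X` is controlled by the `Cᵏ` norm. -/
theorem IsFunctionSpace.exists_norm_sub_le (hX : IsFunctionSpace k D ι) (hne : D.Nonempty) :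
    ∃ C : ℝ, 0 ≤ C ∧ ∀ (f g : EuclideanSpace ℝ (Fin d) → EuclideanSpace ℝ (Fin m)) (u v : X),
      ContDiff ℝ k f → ContDiff ℝ k g → ι u =ᵐ[volume.restrict D] f → ι v =ᵐ[volume.restrict D] g →
      ∀ B : ℝ, (∀ j ≤ k, ∀ x ∈ D, ‖iteratedFDeriv ℝ j (fun x => f x - g x) x‖ ≤ B) →
        ‖u - v‖ ≤ C * B := by
  obtain ⟨C, hC⟩ := hX.smooth_mem
  refine ⟨|C|, abs_nonneg _, fun f g u v hf hg hu hv B hB => ?_⟩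
  obtain ⟨w, hw, hwn⟩ := hC (fun x => f x - g x) (hf.sub hg)
  have huv : u - v = w := by
    refine hX.injective (Lp.ext ?_)
    rw [map_sub]
    filter_upwards [hw, hu, hv, Lp.coeFn_sub (ι u) (ι v)] with x h1 h2 h3 h4
    rw [h4, Pi.sub_apply, h2, h3, h1]
  obtain ⟨x, hx⟩ := hne
  have hB0 : 0 ≤ B := (norm_nonneg _).trans (hB 0 (Nat.zero_le _) x hx)
  rw [huv]
  exact (hwn B hB).trans (mul_le_mul_of_nonneg_right (le_abs_self C) hB0)

/-- A family of functions, depending on finitely many parameters `c`, that is computed by a single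
network in the variables `(c, x)`: it is continuous in `c` with respect to the norm of `X`, and it
approximates the linear combinations `∑ cᵢ vᵢ` for bounded coefficients. -/
theorem IsFunctionSpace.exists_decoder (hX : IsFunctionSpace k D ι) (hne : D.Nonempty)
    (hD : Bornology.IsBounded D) {σ : ℝ → ℝ} (hσ : ContDiff ℝ k σ) (hn : IsNonpolynomial σ) {p : ℕ}
    {f : Fin p → EuclideanSpace ℝ (Fin d) → EuclideanSpace ℝ (Fin m)} {v : Fin p → X}
    (hf : ∀ i, ContDiff ℝ k (f i)) (hv : ∀ i, ι (v i) =ᵐ[volume.restrict D] f i)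
    {η : ℝ} (hη : 0 < η) :
    ∃ (F : Fin m → (Fin p → ℝ) × EuclideanSpace ℝ (Fin d) → ℝ) (Φ : (Fin p → ℝ) → X),
      (∀ l, F l ∈ ridgeSpan σ ⊤) ∧ Continuous Φ ∧
      (∀ c, ι (Φ c) =ᵐ[volume.restrict D] fun x => WithLp.toLp 2 fun l => F l (c, x)) ∧
      ∀ c, ‖c‖ ≤ 2 → ‖Φ c - ∑ i, c i • v i‖ ≤ η := by
  obtain ⟨C, hC0, hC⟩ := hX.exists_norm_sub_le hne
  have hfl : ∀ i l, ContDiff ℝ k fun x => f i x l := fun i l =>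
    (EuclideanSpace.proj (𝕜 := ℝ) l).contDiff.comp (hf i)
  have hH : ∀ l, ContDiff ℝ k
      (fun q : (Fin p → ℝ) × EuclideanSpace ℝ (Fin d) => ∑ i, q.1 i * f i q.2 l) := fun l =>
    ContDiff.sum fun i _ => (((contDiff_apply ℝ ℝ i).comp contDiff_fst).mul
      ((hfl i l).comp contDiff_snd))
  have hK : Bornology.IsBounded (Metric.closedBall (0 : Fin p → ℝ) 2 ×ˢ D) :=
    Metric.isBounded_closedBall.prod hD
  have hη' : 0 < η / (m * C + 1) := by positivity
  choose F hF hFH using fun l => exists_mem_ridgeSpan_iteratedFDeriv_near hσ hn (hH l) hK hη'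
  have hFk : ∀ l, ContDiff ℝ k (F l) := fun l => contDiff_of_mem_ridgeSpan hσ (hF l)
  have hFc : ∀ c, ContDiff ℝ k (fun x => (WithLp.toLp 2 fun l => F l (c, x) :
      EuclideanSpace ℝ (Fin m))) := fun c =>
    contDiff_euclidean.2 fun l => contDiff_slice (hFk l) c
  obtain ⟨C', hC'⟩ := hX.smooth_mem
  choose Φ hΦ _ using fun c => hC' _ (hFc c)
  refine ⟨F, Φ, hF, ?_, hΦ, fun c hc => ?_⟩
  · -- the jets of the slices depend continuously on the parameter
    have : CompactSpace (closure D) := isCompact_iff_compactSpace.1 hD.isCompact_closure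
    refine continuous_iff_continuousAt.2 fun c₀ => ?_
    rw [ContinuousAt, tendsto_iff_norm_sub_tendsto_zero]
    have hlim : Filter.Tendsto (fun c => C * ∑ l, ‖jet k (closure D) (fun x => F l (c, x))
        (contDiff_slice (hFk l) c) - jet k (closure D) (fun x => F l (c₀, x))
        (contDiff_slice (hFk l) c₀)‖) (nhds c₀) (nhds 0) := by
      have : Filter.Tendsto (fun c => C * ∑ l, ‖jet k (closure D) (fun x => F l (c, x))
        (contDiff_slice (hFk l) c) - jet k (closure D) (fun x => F l (c₀, x))
        (contDiff_slice (hFk l) c₀)‖) (nhds c₀) (nhds (C * ∑ l : Fin m, 0)) :=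
        (tendsto_finsetSum _ fun l _ => tendsto_iff_norm_sub_tendsto_zero.1
          ((continuous_jet_slice (B := closure D) (hFk l)).tendsto c₀)).const_mul C
      simpa using this
    refine squeeze_zero (fun _ => norm_nonneg _) (fun c => ?_) hlim
    refine hC _ _ _ _ (hFc c) (hFc c₀) (hΦ c) (hΦ c₀) _ fun j hj x hx => ?_
    refine (norm_iteratedFDeriv_le_sum_components ((hFc c).sub (hFc c₀)) hj x).trans
      (Finset.sum_le_sum fun l _ => ?_)
    exact norm_iteratedFDeriv_sub_le_of_jet (contDiff_slice (hFk l) c) (contDiff_slice (hFk l) c₀)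
      hj (subset_closure hx)
  · have hcomb : ι (∑ i, c i • v i) =ᵐ[volume.restrict D] fun x => ∑ i, c i • f i x := by
      rw [map_sum]
      have h1 : ∀ i, ι (c i • v i) =ᵐ[volume.restrict D] fun x => c i • f i x := by
        intro i
        rw [map_smul]
        filter_upwards [hv i, Lp.coeFn_smul (c i) (ι (v i))] with x h1 h2
        rw [h2, Pi.smul_apply, h1]
      refine (Lp.coeFn_fun_finsetSum _ _).trans ?_
      filter_upwards [ae_all_iff.2 h1] with x hx
      exact Finset.sum_congr rfl fun i _ => hx i
    have hcs : ContDiff ℝ k (fun x => ∑ i, c i • f i x) :=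
      ContDiff.sum fun i _ => (hf i).const_smul (c i)
    have hle := hC _ _ _ _ (hFc c) hcs (hΦ c) hcomb (m * (η / (m * C + 1))) fun j hj x hx => by
      refine (norm_iteratedFDeriv_le_sum_components ((hFc c).sub hcs) hj x).trans ?_
      calc _ ≤ ∑ _l : Fin m, η / (m * C + 1) := Finset.sum_le_sum fun l _ => ?_
        _ = m * (η / (m * C + 1)) := by simp
      have hd : ContDiff ℝ k (fun q : (Fin p → ℝ) × EuclideanSpace ℝ (Fin d) =>
          ∑ i, q.1 i * f i q.2 l - F l q) := (hH l).sub (hFk l)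
      have e : (fun x => ((WithLp.toLp 2 fun l => F l (c, x) : EuclideanSpace ℝ (Fin m)) -
          ∑ i, c i • f i x) l) = -fun x => ∑ i, c i * f i x l - F l (c, x) := by
        funext x
        simp
      rw [e, iteratedFDeriv_neg, Pi.neg_apply, norm_neg, iteratedFDeriv_slice hd hj]
      refine le_trans ?_ (hFH l j hj (c, x) ⟨by simpa using hc, hx⟩).le
      refine (ContinuousMultilinearMap.norm_compContinuousLinearMap_le _ _).trans ?_
      refine mul_le_of_le_one_right (norm_nonneg _) (Finset.prod_le_one (fun _ _ => norm_nonneg _)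
        fun _ _ => ContinuousLinearMap.norm_inr_le_one ℝ _ _)
    refine hle.trans ?_
    rw [show C * (m * (η / (m * C + 1))) = (m * C) * η / (m * C + 1) by ring,
      div_le_iff₀ (by positivity)]
    nlinarith

/-- Neural operators approximate trajectories on a complemented subspace `U` of a function space
`X`, after projection to `U`. The case `U = X` is included. -/
theorem IsFunctionSpace.approximatesTrajectories (hX : IsFunctionSpace k D ι)
    (hne : D.Nonempty) (hD : Bornology.IsBounded D) (hDm : MeasurableSet D) {σ : ℝ → ℝ}
    (hσ : ContDiff ℝ k σ) (hn : IsNonpolynomial σ)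
    (rep : X → EuclideanSpace ℝ (Fin d) → EuclideanSpace ℝ (Fin m))
    (hrep : ∀ u, rep u =ᵐ[volume.restrict D] ι u) {U : Type u} [NormedAddCommGroup U]
    [NormedSpace ℝ U] (i : U →L[ℝ] X) (π : X →L[ℝ] U) (hπ : ∀ u, π (i u) = u) :
    ApproximatesTrajectories.{u, v} U
      {Φ | ∃ N ∈ neuralOperatorMaps σ D rep, ∀ u, Φ u = π (N (i u))} := by
  refine approximatesTrajectories_of_convexCombinations _ _ fun p z η hη => ?_
  have hσc := hσ.continuous
  -- replace the given points by functions of class `Cᵏ`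
  have hη₁ : 0 < η / (4 * (‖π‖ + 1)) := by positivity
  choose f hf v hv hvz using fun l => hX.smooth_dense (i (z l)) _ hη₁
  obtain ⟨F, Φ, hF, hΦc, hΦ, hΦv⟩ := hX.exists_decoder hne hD hσ hn hf hv hη₁
  refine ⟨(fun c => π (Φ c)) '' Metric.closedBall 0 2, (isCompact_closedBall _ _).image
    (π.continuous.comp hΦc), fun C hC τ hτ hτ1 => ?_⟩
  -- the encoder approximates the coefficients `τ`
  obtain ⟨η₂, hη₂, hη₂1, hη₂s⟩ : ∃ η₂ : ℝ, 0 < η₂ ∧ η₂ ≤ 1 ∧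
      η₂ * ∑ l, ‖v l‖ ≤ η / (4 * (‖π‖ + 1)) := by
    have hs : 0 ≤ ∑ l, ‖v l‖ := Finset.sum_nonneg fun _ _ => norm_nonneg _
    refine ⟨min 1 (η / (4 * (‖π‖ + 1)) / (∑ l, ‖v l‖ + 1)), by positivity, min_le_left _ _, ?_⟩
    calc _ ≤ η / (4 * (‖π‖ + 1)) / (∑ l, ‖v l‖ + 1) * ∑ l, ‖v l‖ :=
          mul_le_mul_of_nonneg_right (min_le_right _ _) hs
      _ = η / (4 * (‖π‖ + 1)) * ((∑ l, ‖v l‖) / (∑ l, ‖v l‖ + 1)) := by ring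
      _ ≤ _ := mul_le_of_le_one_right hη₁.le (by rw [div_le_one (by positivity)]; linarith)
  have hτl : ∀ l, ContinuousOn (fun x => τ (π x) l) (i '' C) := fun l =>
    (continuousOn_pi.1 hτ l).comp π.continuous.continuousOn (by
      rintro _ ⟨u, hu, rfl⟩
      rwa [hπ])
  choose g hg hgτ using fun l => exists_mem_ridgeSpan_near_of_separatesPoints
    (hC.image i.continuous) hσc hn (kernelFunctionals σ hσc hD hDm ι)
    (fun x _ y _ hxy => kernelFunctionals_separate hσc hn hD hDm hX.injective hxy) (hτl l) hη₂
  obtain ⟨n₁, q₁, b, Lk, hLk, hgs⟩ := exists_common_sum_of_mem_ridgeSpan hg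
  choose κ hκ hκL using hLk
  obtain ⟨n₂, q₂, β, A, -, hFs⟩ := exists_common_sum_of_mem_ridgeSpan hF
  obtain ⟨N, hN⟩ := exists_neuralOperator_encoder_decoder hD.measure_lt_top.ne hκ b
    (fun s r => ∑ l, A s (Pi.single l 1, 0) * q₁ l r)
    (fun s => (A s).comp (ContinuousLinearMap.inr ℝ _ _)) β q₂
  refine ⟨fun u => π (Φ fun l => g l (i u)), ⟨fun x => Φ fun l => g l x, ⟨N, fun x => ?_⟩,
    fun u => rfl⟩, fun u hu => ?_⟩
  · -- the architecture computes the composition of encoder and decoder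
    obtain ⟨h1, h2⟩ := hN (rep x) ((L1.integrable_coeFn (ι x)).congr (hrep x).symm)
    refine ⟨h1, ((hrep _).trans (hΦ _)).trans (Filter.Eventually.of_forall fun y => ?_)⟩
    refine PiLp.ext fun l => ?_
    rw [h2]
    change F l (_, y) = _
    rw [hFs]
    refine Finset.sum_congr rfl fun s _ => ?_
    have hlin : A s (fun l => g l x, y) = ∑ r, (∑ l, A s (Pi.single l 1, 0) * q₁ l r) *
        σ ((∫ y in D, ∑ j, κ r j y * rep x y j) + b r) +
        ((A s).comp (ContinuousLinearMap.inr ℝ _ _)) y := by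
      have e1 : ∀ r, ∫ y in D, ∑ j, κ r j y * rep x y j = Lk r x := by
        intro r
        rw [hκL]
        refine integral_congr_ae ?_
        filter_upwards [hrep x] with y hy
        rw [hy]
      have e2 := ((A s).comp (ContinuousLinearMap.inl ℝ (Fin p → ℝ)
        (EuclideanSpace ℝ (Fin d)))).apply_eq_sum_single (fun l => g l x)
      have e3 : ((fun l => g l x, y) : (Fin p → ℝ) × EuclideanSpace ℝ (Fin d)) =
        ContinuousLinearMap.inl ℝ (Fin p → ℝ) (EuclideanSpace ℝ (Fin d)) (fun l => g l x) +
          ContinuousLinearMap.inr ℝ (Fin p → ℝ) (EuclideanSpace ℝ (Fin d)) y := by simp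
      rw [e3, map_add]
      congr 1
      refine e2.trans ?_
      simp only [e1, hgs, Finset.mul_sum, Finset.sum_mul]
      rw [Finset.sum_comm]
      refine Finset.sum_congr rfl fun r _ => Finset.sum_congr rfl fun l _ => ?_
      simp only [ContinuousLinearMap.comp_apply, ContinuousLinearMap.inl_apply]
      ring
    rw [hlin, add_assoc]
  · have hc : ∀ l, |g l (i u) - τ u l| < η₂ := fun l => by
      have := hgτ l (i u) ⟨u, hu, rfl⟩
      rwa [hπ] at this
    have hτ01 : ∀ l, τ u l ≤ 1 := fun l => (hτ1 u hu).2 ▸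
      Finset.single_le_sum (fun l _ => (hτ1 u hu).1 l) (Finset.mem_univ l)
    have hball : ‖fun l => g l (i u)‖ ≤ 2 := by
      refine (pi_norm_le_iff_of_nonneg zero_le_two).2 fun l => ?_
      have h1 := abs_lt.1 (hc l)
      have h2 := (hτ1 u hu).1 l
      have h3 := hτ01 l
      rw [Real.norm_eq_abs, abs_le]
      constructor <;> linarith
    refine ⟨⟨_, by simpa using hball, rfl⟩, ?_⟩
    have e : ∑ l, τ u l • z l = π (∑ l, τ u l • i (z l)) := by simp [hπ]
    rw [e, ← map_sub]
    refine (π.le_opNorm _).trans ?_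
    have h1 := hΦv (fun l => g l (i u)) hball
    have h2 : ‖∑ l, g l (i u) • v l - ∑ l, τ u l • v l‖ ≤ η / (4 * (‖π‖ + 1)) := by
      refine le_trans ?_ hη₂s
      rw [← Finset.sum_sub_distrib, Finset.mul_sum]
      refine norm_sum_le_of_le _ fun l _ => ?_
      rw [← sub_smul, norm_smul]
      exact mul_le_mul_of_nonneg_right (hc l).le (norm_nonneg _)
    have h3 : ‖∑ l, τ u l • v l - ∑ l, τ u l • i (z l)‖ ≤ η / (4 * (‖π‖ + 1)) := by
      rw [← Finset.sum_sub_distrib]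
      calc _ ≤ ∑ l, τ u l * (η / (4 * (‖π‖ + 1))) := by
            refine norm_sum_le_of_le _ fun l _ => ?_
            rw [← smul_sub, norm_smul, Real.norm_of_nonneg ((hτ1 u hu).1 l), norm_sub_rev]
            exact mul_le_mul_of_nonneg_left (hvz l).le ((hτ1 u hu).1 l)
        _ = _ := by rw [← Finset.sum_mul, (hτ1 u hu).2, one_mul]
    have h4 := norm_sub_le_norm_sub_add_norm_sub (Φ fun l => g l (i u)) (∑ l, g l (i u) • v l)
      (∑ l, τ u l • i (z l))
    have h5 := norm_sub_le_norm_sub_add_norm_sub (∑ l, g l (i u) • v l) (∑ l, τ u l • v l)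
      (∑ l, τ u l • i (z l))
    calc ‖π‖ * ‖(Φ fun l => g l (i u)) - ∑ l, τ u l • i (z l)‖
        ≤ (‖π‖ + 1) * (3 * (η / (4 * (‖π‖ + 1)))) := by
          gcongr
          · linarith
          · linarith
      _ = 3 / 4 * η := by field_simp
      _ ≤ η := by linarith

end Decoder

/-! ### Mollification in `Lᵖ` -/

/-- Translation is continuous in `Lᵖ`, `p < ∞`. -/
theorem exists_forall_eLpNorm_translate_sub_le {d : ℕ} {G : Type*} [NormedAddCommGroup G]
    {p : ℝ≥0∞} [hp1 : Fact (1 ≤ p)] (hp : p ≠ ⊤) {F : EuclideanSpace ℝ (Fin d) → G}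
    (hF : MemLp F p) {ε : ℝ≥0∞} (hε : 0 < ε) :
    ∃ δ > 0, ∀ y : EuclideanSpace ℝ (Fin d), ‖y‖ < δ →
      eLpNorm (fun x => F (x - y) - F x) p ≤ ε := by
  let τ : EuclideanSpace ℝ (Fin d) → C(EuclideanSpace ℝ (Fin d), EuclideanSpace ℝ (Fin d)) :=
    ContinuousMap.curry ⟨fun z => z.2 - z.1, by fun_prop⟩
  have hτ : Continuous τ := ContinuousMap.continuous _
  have hm : ∀ y, MeasurePreserving (τ y) := fun y => measurePreserving_sub_right volume y
  have hc : Continuous fun y => Lp.compMeasurePreserving (τ y) (hm y) (hF.toLp F) :=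
    continuous_const.compMeasurePreservingLp hτ hm hp
  obtain ⟨δ, hδ, h⟩ := EMetric.continuous_iff.1 hc 0 ε hε
  have hE : ∀ y, Lp.compMeasurePreserving (τ y) (hm y) (hF.toLp F) =ᵐ[volume]
      fun x => F (x - y) := fun y =>
    (Lp.coeFn_compMeasurePreserving _ (hm y)).trans
      ((hm y).quasiMeasurePreserving.ae_eq_comp hF.coeFn_toLp)
  obtain ⟨δ', hδ', hle⟩ : ∃ δ' : ℝ, 0 < δ' ∧ ENNReal.ofReal δ' ≤ δ := by
    rcases eq_or_ne δ ⊤ with rfl | hne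
    · exact ⟨1, one_pos, le_top⟩
    · exact ⟨δ.toReal, ENNReal.toReal_pos hδ.ne' hne, (ENNReal.ofReal_toReal hne).le⟩
  refine ⟨δ', hδ', fun y hy => ?_⟩
  have h1 := h y (by
    rw [edist_dist, dist_zero_right]
    exact ((ENNReal.ofReal_lt_ofReal_iff hδ').2 hy).trans_le hle)
  rw [Lp.edist_def] at h1
  refine (eLpNorm_congr_ae ?_).trans_le h1.le
  have h0 := hE 0
  filter_upwards [hE y, h0] with x hx hx0
  simp only [Pi.sub_apply, hx, hx0, sub_zero]

/-- Convolution with a probability density concentrated near the origin moves an `Lᵖ` function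
little; only the support of the density matters, not its shape. -/
theorem exists_forall_eLpNorm_convolution_sub_le {d : ℕ} {G : Type*} [NormedAddCommGroup G]
    [NormedSpace ℝ G] [CompleteSpace G]
    {p : ℝ≥0∞} [hp1 : Fact (1 ≤ p)] (hp : p ≠ ⊤) {F : EuclideanSpace ℝ (Fin d) → G}
    (hF : MemLp F p) {ε : ℝ≥0∞} (hε : 0 < ε) :
    ∃ δ > 0, ∀ ψ : EuclideanSpace ℝ (Fin d) → ℝ, Continuous ψ → HasCompactSupport ψ →
      (∀ y, 0 ≤ ψ y) → ∫ y, ψ y = 1 → (∀ y, ψ y ≠ 0 → ‖y‖ < δ) →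
      eLpNorm (fun x => (∫ y, ψ y • F (x - y)) - F x) p ≤ ε := by
  obtain ⟨δ, hδ, h⟩ := exists_forall_eLpNorm_translate_sub_le hp hF hε
  refine ⟨δ, hδ, fun ψ hψ hc h0 h1 hs => ?_⟩
  have hψm : Measurable fun y => (ψ y).toNNReal := hψ.measurable.real_toNNReal
  set P : Measure (EuclideanSpace ℝ (Fin d)) := volume.withDensity fun y => ((ψ y).toNNReal : ℝ≥0∞)
    with hP
  have hPac : P ≪ volume := withDensity_absolutelyContinuous _ _
  have hint : Integrable ψ := hψ.integrable_of_hasCompactSupport hc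
  have hprob : IsProbabilityMeasure P := by
    refine ⟨?_⟩
    rw [hP, withDensity_apply _ MeasurableSet.univ, Measure.restrict_univ]
    have := ofReal_integral_eq_lintegral_ofReal hint (Filter.Eventually.of_forall h0)
    rw [h1, ENNReal.ofReal_one] at this
    exact this.symm
  have hp0 : p ≠ 0 := (one_pos.trans_le hp1.out).ne'
  have hpr : 0 < p.toReal := ENNReal.toReal_pos hp0 hp
  have hFl : LocallyIntegrable F := hF.locallyIntegrable hp1.out
  have hconv : ∀ x, Integrable (fun y => F (x - y)) P := by
    intro x
    rw [hP, integrable_withDensity_iff_integrable_smul hψm]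
    have := hc.convolutionExists_left (ContinuousLinearMap.lsmul ℝ ℝ) hψ hFl x
    refine (this.integrable).congr (Filter.Eventually.of_forall fun y => ?_)
    simp [NNReal.smul_def, Real.coe_toNNReal _ (h0 y)]
  have hpt : ∀ x, ‖(∫ y, ψ y • F (x - y)) - F x‖ₑ ^ p.toReal
      ≤ ∫⁻ y, ‖F (x - y) - F x‖ₑ ^ p.toReal ∂P := by
    intro x
    have e1 : (∫ y, ψ y • F (x - y)) = ∫ y, F (x - y) ∂P := by
      rw [hP, integral_withDensity_eq_integral_smul hψm]
      refine integral_congr_ae (Filter.Eventually.of_forall fun y => ?_)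
      simp [NNReal.smul_def, Real.coe_toNNReal _ (h0 y)]
    have e2 : (∫ y, F (x - y) ∂P) - F x = ∫ y, (F (x - y) - F x) ∂P := by
      rw [integral_sub (hconv x) (integrable_const _)]
      simp
    have hi : Integrable (fun y => F (x - y) - F x) P := (hconv x).sub (integrable_const _)
    have e3 : ‖∫ y, (F (x - y) - F x) ∂P‖ₑ ≤ eLpNorm (fun y => F (x - y) - F x) p P :=
      ((enorm_integral_le_lintegral_enorm _).trans_eq eLpNorm_one_eq_lintegral_enorm.symm).trans
        (eLpNorm_le_eLpNorm_of_exponent_le hp1.out hi.aestronglyMeasurable)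
    rw [e1, e2]
    refine (ENNReal.rpow_le_rpow e3 hpr.le).trans_eq ?_
    rw [eLpNorm_eq_lintegral_rpow_enorm_toReal hp0 hp, one_div, ENNReal.rpow_inv_rpow hpr.ne']
  rw [eLpNorm_eq_lintegral_rpow_enorm_toReal hp0 hp, one_div]
  rw [ENNReal.rpow_inv_le_iff hpr]
  refine (lintegral_mono hpt).trans ?_
  rw [lintegral_lintegral_swap]
  · have hy : ∀ᵐ y ∂P, ∫⁻ x, ‖F (x - y) - F x‖ₑ ^ p.toReal ≤ ε ^ p.toReal := by
      rw [hP, ae_withDensity_iff hψm.coe_nnreal_ennreal]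
      refine Filter.Eventually.of_forall fun y hy => ?_
      have hyδ := h y (hs y fun h' => hy (by simp [h']))
      rw [eLpNorm_eq_lintegral_rpow_enorm_toReal hp0 hp, one_div, ENNReal.rpow_inv_le_iff hpr]
        at hyδ
      exact hyδ
    refine (lintegral_mono_ae hy).trans ?_
    simp
  · have hsub : Measure.QuasiMeasurePreserving
        (fun z : EuclideanSpace ℝ (Fin d) × EuclideanSpace ℝ (Fin d) => z.1 - z.2)
        (volume.prod P) volume :=
      (quasiMeasurePreserving_sub volume volume).mono_left
        (Measure.AbsolutelyContinuous.rfl.prod hPac)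
    exact ((hF.1.comp_quasiMeasurePreserving hsub).sub hF.1.comp_fst).enorm.pow_const _

/-! ### First-order weak derivatives and Sobolev bounds -/

/-- `g` is the weak derivative of `f` on `D` in the direction `v`. -/
def IsWeakPartial {d m : ℕ} (D : Set (EuclideanSpace ℝ (Fin d))) (v : EuclideanSpace ℝ (Fin d))
    (f g : EuclideanSpace ℝ (Fin d) → EuclideanSpace ℝ (Fin m)) : Prop :=
  ∀ φ : EuclideanSpace ℝ (Fin d) → ℝ, ContDiff ℝ ∞ φ → HasCompactSupport φ → tsupport φ ⊆ D →
    ∫ x in D, fderiv ℝ φ x v • f x = -∫ x in D, φ x • g x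

/-- `f` has iterated weak derivatives up to the order `k` on `D`, all of them (and `f` itself)
bounded by `ε` in `Lᵖ(D)`. The recursion takes one coordinate derivative at a time, which is the
form that inductions over the order need; `ε = ∞` expresses membership without a bound. -/
def SobolevBound {d m : ℕ} (D : Set (EuclideanSpace ℝ (Fin d))) (p : ℝ≥0∞) :
    ℕ → ℝ≥0∞ → (EuclideanSpace ℝ (Fin d) → EuclideanSpace ℝ (Fin m)) → Prop
  | 0, ε, f => MemLp f p (volume.restrict D) ∧ eLpNorm f p (volume.restrict D) ≤ ε
  | k + 1, ε, f => (MemLp f p (volume.restrict D) ∧ eLpNorm f p (volume.restrict D) ≤ ε) ∧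
      ∀ i : Fin d, ∃ g, IsWeakPartial D (EuclideanSpace.single i 1) f g ∧ SobolevBound D p k ε g

section

variable {d m : ℕ} {D D' : Set (EuclideanSpace ℝ (Fin d))} {p : ℝ≥0∞}
  {f f' g g' : EuclideanSpace ℝ (Fin d) → EuclideanSpace ℝ (Fin m)}
  {v : EuclideanSpace ℝ (Fin d)}

theorem SobolevBound.memLp {k : ℕ} {ε : ℝ≥0∞} (h : SobolevBound D p k ε f) :
    MemLp f p (volume.restrict D) := by
  cases k with
  | zero => exact h.1
  | succ k => exact h.1.1

theorem SobolevBound.eLpNorm_le {k : ℕ} {ε : ℝ≥0∞} (h : SobolevBound D p k ε f) :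
    eLpNorm f p (volume.restrict D) ≤ ε := by
  cases k with
  | zero => exact h.2
  | succ k => exact h.1.2

theorem SobolevBound.mono {k : ℕ} {ε ε' : ℝ≥0∞} (hε : ε ≤ ε') (h : SobolevBound D p k ε f) :
    SobolevBound D p k ε' f := by
  induction k generalizing f with
  | zero => exact ⟨h.1, h.2.trans hε⟩
  | succ k ih =>
    refine ⟨⟨h.1.1, h.1.2.trans hε⟩, fun i => ?_⟩
    obtain ⟨g, hg, hk⟩ := h.2 i
    exact ⟨g, hg, ih hk⟩

theorem SobolevBound.of_succ {k : ℕ} {ε : ℝ≥0∞} (h : SobolevBound D p (k + 1) ε f) :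
    SobolevBound D p k ε f := by
  induction k generalizing f with
  | zero => exact h.1
  | succ k ih =>
    refine ⟨h.1, fun i => ?_⟩
    obtain ⟨g, hg, hk⟩ := h.2 i
    exact ⟨g, hg, ih hk⟩

theorem IsWeakPartial.congr (h : IsWeakPartial D v f g) (hf : f =ᵐ[volume.restrict D] f') :
    IsWeakPartial D v f' g := fun φ h1 h2 h3 => by
  rw [← h φ h1 h2 h3]
  refine integral_congr_ae ?_
  filter_upwards [hf] with x hx
  rw [hx]

theorem SobolevBound.congr {k : ℕ} {ε : ℝ≥0∞} (h : SobolevBound D p k ε f)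
    (hf : f =ᵐ[volume.restrict D] f') : SobolevBound D p k ε f' := by
  have h0 : MemLp f' p (volume.restrict D) ∧ eLpNorm f' p (volume.restrict D) ≤ ε :=
    ⟨(memLp_congr_ae hf).1 h.memLp, (eLpNorm_congr_ae hf).symm.trans_le h.eLpNorm_le⟩
  cases k with
  | zero => exact h0
  | succ k =>
    refine ⟨h0, fun i => ?_⟩
    obtain ⟨g, hg, hk⟩ := h.2 i
    exact ⟨g, hg.congr hf, hk⟩

theorem MeasureTheory.MemLp.integrable_smul_of_hasCompactSupport (hp : 1 ≤ p)
    (hf : MemLp f p (volume.restrict D))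
    {φ : EuclideanSpace ℝ (Fin d) → ℝ} (hφ : Continuous φ) (hc : HasCompactSupport φ) :
    Integrable (fun x => φ x • f x) (volume.restrict D) :=
  (hf.locallyIntegrable hp).integrable_smul_left_of_hasCompactSupport hφ hc

theorem continuous_fderiv_apply_const {φ : EuclideanSpace ℝ (Fin d) → ℝ} (h : ContDiff ℝ ∞ φ)
    (v : EuclideanSpace ℝ (Fin d)) : Continuous fun x => fderiv ℝ φ x v :=
  (h.continuous_fderiv (by simp)).clm_apply continuous_const

theorem HasCompactSupport.fderiv_apply_const {φ : EuclideanSpace ℝ (Fin d) → ℝ}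
    (h : HasCompactSupport φ) (v : EuclideanSpace ℝ (Fin d)) :
    HasCompactSupport fun x => fderiv ℝ φ x v := h.fderiv_apply (𝕜 := ℝ) v

theorem tsupport_fderiv_apply_const_subset (φ : EuclideanSpace ℝ (Fin d) → ℝ)
    (v : EuclideanSpace ℝ (Fin d)) : tsupport (fun x => fderiv ℝ φ x v) ⊆ tsupport φ :=
  (closure_mono fun x hx => by
    rw [Function.mem_support] at hx ⊢
    exact fun h => hx (by rw [h]; rfl)).trans (tsupport_fderiv_subset ℝ)

theorem contDiff_fderiv_apply_const {φ : EuclideanSpace ℝ (Fin d) → ℝ} (h : ContDiff ℝ ∞ φ)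
    (v : EuclideanSpace ℝ (Fin d)) : ContDiff ℝ ∞ fun x => fderiv ℝ φ x v :=
  (h.fderiv_right (m := ∞) (by simp)).clm_apply contDiff_const

theorem IsWeakPartial.add (hp : 1 ≤ p) (h : IsWeakPartial D v f g) (h' : IsWeakPartial D v f' g')
    (hf : MemLp f p (volume.restrict D)) (hf' : MemLp f' p (volume.restrict D))
    (hg : MemLp g p (volume.restrict D)) (hg' : MemLp g' p (volume.restrict D)) :
    IsWeakPartial D v (f + f') (g + g') := fun φ h1 h2 h3 => by
  have c1 := continuous_fderiv_apply_const h1 v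
  have c2 := h2.fderiv_apply_const v
  simp only [Pi.add_apply, smul_add]
  rw [integral_add (hf.integrable_smul_of_hasCompactSupport hp c1 c2)
      (hf'.integrable_smul_of_hasCompactSupport hp c1 c2),
    integral_add (hg.integrable_smul_of_hasCompactSupport hp h1.continuous h2)
      (hg'.integrable_smul_of_hasCompactSupport hp h1.continuous h2),
    h φ h1 h2 h3, h' φ h1 h2 h3, neg_add]

theorem IsWeakPartial.neg (h : IsWeakPartial D v f g) : IsWeakPartial D v (-f) (-g) :=
  fun φ h1 h2 h3 => by
    simp only [Pi.neg_apply, smul_neg, integral_neg, h φ h1 h2 h3]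

theorem IsWeakPartial.sub (hp : 1 ≤ p) (h : IsWeakPartial D v f g) (h' : IsWeakPartial D v f' g')
    (hf : MemLp f p (volume.restrict D)) (hf' : MemLp f' p (volume.restrict D))
    (hg : MemLp g p (volume.restrict D)) (hg' : MemLp g' p (volume.restrict D)) :
    IsWeakPartial D v (f - f') (g - g') := by
  rw [sub_eq_add_neg, sub_eq_add_neg]
  exact h.add hp h'.neg hf hf'.neg hg hg'.neg

theorem SobolevBound.add (hp : 1 ≤ p) {k : ℕ} {ε ε' : ℝ≥0∞} (h : SobolevBound D p k ε f)
    (h' : SobolevBound D p k ε' f') : SobolevBound D p k (ε + ε') (f + f') := by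
  have h0 : MemLp (f + f') p (volume.restrict D) ∧
      eLpNorm (f + f') p (volume.restrict D) ≤ ε + ε' :=
    ⟨h.memLp.add h'.memLp, (eLpNorm_add_le h.memLp.1 h'.memLp.1 hp).trans
      (add_le_add h.eLpNorm_le h'.eLpNorm_le)⟩
  induction k generalizing f f' with
  | zero => exact h0
  | succ k ih =>
    refine ⟨h0, fun i => ?_⟩
    obtain ⟨g, hg, hk⟩ := h.2 i
    obtain ⟨g', hg', hk'⟩ := h'.2 i
    refine ⟨g + g', hg.add hp hg' h.memLp h'.memLp hk.memLp hk'.memLp, ih hk hk' ?_⟩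
    exact ⟨hk.memLp.add hk'.memLp, (eLpNorm_add_le hk.memLp.1 hk'.memLp.1 hp).trans
      (add_le_add hk.eLpNorm_le hk'.eLpNorm_le)⟩

theorem sobolevBound_zero (k : ℕ) :
    SobolevBound D p k 0 (0 : EuclideanSpace ℝ (Fin d) → EuclideanSpace ℝ (Fin m)) := by
  induction k with
  | zero => exact ⟨MemLp.zero, by simp⟩
  | succ k ih =>
    exact ⟨⟨MemLp.zero, by simp⟩, fun i => ⟨0, fun φ _ _ _ => by simp, ih⟩⟩

theorem SobolevBound.sum (hp : 1 ≤ p) {k : ℕ} {ι : Type*} (s : Finset ι) {ε : ι → ℝ≥0∞}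
    {F : ι → EuclideanSpace ℝ (Fin d) → EuclideanSpace ℝ (Fin m)}
    (h : ∀ i ∈ s, SobolevBound D p k (ε i) (F i)) :
    SobolevBound D p k (∑ i ∈ s, ε i) (∑ i ∈ s, F i) := by
  classical
  induction s using Finset.induction_on with
  | empty => simpa using sobolevBound_zero k
  | insert a s ha ih =>
    rw [Finset.sum_insert ha, Finset.sum_insert ha]
    exact (h a (Finset.mem_insert_self a s)).add hp
      (ih fun i hi => h i (Finset.mem_insert_of_mem hi))

/-- An integral over `D` of a test function on a subset `D'` is an integral over `D'`. -/
theorem setIntegral_smul_eq_of_tsupport_subset (hDD : D' ⊆ D) (hD : MeasurableSet D)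
    {φ : EuclideanSpace ℝ (Fin d) → ℝ} (hφ : tsupport φ ⊆ D')
    (f : EuclideanSpace ℝ (Fin d) → EuclideanSpace ℝ (Fin m)) :
    ∫ x in D, φ x • f x = ∫ x in D', φ x • f x :=
  (setIntegral_eq_of_subset_of_forall_sdiff_eq_zero hD hDD fun x hx => by
    rw [image_eq_zero_of_notMem_tsupport fun h => hx.2 (hφ h), zero_smul])

theorem IsWeakPartial.restrict (h : IsWeakPartial D v f g) (hDD : D' ⊆ D)
    (hD : MeasurableSet D) : IsWeakPartial D' v f g := fun φ h1 h2 h3 => by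
  rw [← setIntegral_smul_eq_of_tsupport_subset hDD hD h3,
    ← setIntegral_smul_eq_of_tsupport_subset hDD hD
      ((tsupport_fderiv_apply_const_subset φ v).trans h3)]
  exact h φ h1 h2 (h3.trans hDD)

theorem integrable_smul_of_continuous {φ : EuclideanSpace ℝ (Fin d) → ℝ} (hφ : Continuous φ)
    (hc : HasCompactSupport φ) (hf : Continuous f) : Integrable fun x => φ x • f x :=
  (hφ.smul hf).integrable_of_hasCompactSupport hc.smul_right

/-- Classical derivatives are weak derivatives. -/
theorem isWeakPartial_fderiv (hf : ContDiff ℝ 1 f)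
    (v : EuclideanSpace ℝ (Fin d)) : IsWeakPartial D v f fun x => fderiv ℝ f x v :=
  fun φ h1 h2 h3 => by
  have hf' : Continuous fun x => fderiv ℝ f x v :=
    (hf.continuous_fderiv one_ne_zero).clm_apply continuous_const
  have e1 := setIntegral_smul_eq_of_tsupport_subset (subset_univ D) MeasurableSet.univ h3
    fun x => fderiv ℝ f x v
  have e2 := setIntegral_smul_eq_of_tsupport_subset (subset_univ D) MeasurableSet.univ
    ((tsupport_fderiv_apply_const_subset φ v).trans h3) f
  rw [Measure.restrict_univ] at e1 e2
  rw [← e1, ← e2, integral_smul_fderiv_eq_neg_fderiv_smul_of_integrable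
    (integrable_smul_of_continuous (continuous_fderiv_apply_const h1 v)
      (h2.fderiv_apply_const v) hf.continuous)
    (integrable_smul_of_continuous h1.continuous h2 hf')
    (integrable_smul_of_continuous h1.continuous h2 hf.continuous)
    (fun x _ => (h1.differentiable (by simp)).differentiableAt)
    (fun x _ => (hf.differentiable one_ne_zero).differentiableAt), neg_neg]

theorem norm_iteratedFDeriv_fderiv_single_le {k j : ℕ} (hf : ContDiff ℝ (k + 1 : ℕ) f) (hj : j ≤ k)
    (i : Fin d) (x : EuclideanSpace ℝ (Fin d)) :
    ‖iteratedFDeriv ℝ j (fun x => fderiv ℝ f x (EuclideanSpace.single i 1)) x‖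
      ≤ ‖iteratedFDeriv ℝ (j + 1) f x‖ := by
  set L : (EuclideanSpace ℝ (Fin d) →L[ℝ] EuclideanSpace ℝ (Fin m)) →L[ℝ]
      EuclideanSpace ℝ (Fin m) :=
    ContinuousLinearMap.apply ℝ _ (EuclideanSpace.single i (1 : ℝ))
  have h1 : ContDiff ℝ k (fderiv ℝ f) := hf.fderiv_right (by norm_cast)
  have h2 := L.norm_iteratedFDeriv_comp_left (h1.contDiffAt (x := x)) (n := j)
    (by exact_mod_cast hj)
  have hL : ‖L‖ ≤ 1 := ContinuousLinearMap.opNorm_le_bound _ zero_le_one fun T => by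
    have := T.le_opNorm (EuclideanSpace.single i (1 : ℝ))
    simpa [L] using this
  rw [norm_iteratedFDeriv_fderiv] at h2
  exact h2.trans (mul_le_of_le_one_left (norm_nonneg _) hL)

/-- A function of class `Cᵏ` whose derivatives are bounded by `B` on `D` obeys the Sobolev bound
`vol(D)^{1/p} B`. -/
theorem sobolevBound_of_contDiff (hD : MeasurableSet D) (hfin : volume D ≠ ⊤) {k : ℕ}
    (hf : ContDiff ℝ k f) {B : ℝ} (hB : ∀ j ≤ k, ∀ x ∈ D, ‖iteratedFDeriv ℝ j f x‖ ≤ B) :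
    SobolevBound D p k (volume D ^ p.toReal⁻¹ * ENNReal.ofReal B) f := by
  have := isFiniteMeasure_restrict.2 hfin
  have key : ∀ f : EuclideanSpace ℝ (Fin d) → EuclideanSpace ℝ (Fin m), Continuous f →
      (∀ x ∈ D, ‖iteratedFDeriv ℝ 0 f x‖ ≤ B) → MemLp f p (volume.restrict D) ∧
      eLpNorm f p (volume.restrict D) ≤ volume D ^ p.toReal⁻¹ * ENNReal.ofReal B := by
    intro f hf hB
    have hae : ∀ᵐ x ∂(volume.restrict D), ‖f x‖ ≤ B := by
      filter_upwards [ae_restrict_mem hD] with x hx using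
        (norm_iteratedFDeriv_zero (𝕜 := ℝ) (f := f) (x := x)) ▸ hB x hx
    refine ⟨MemLp.of_bound hf.aestronglyMeasurable B hae, ?_⟩
    have := eLpNorm_le_of_ae_bound (p := p) hae
    rwa [Measure.restrict_apply_univ] at this
  induction k generalizing f with
  | zero => exact key f hf.continuous (hB 0 le_rfl)
  | succ k ih =>
    refine ⟨key f hf.continuous (hB 0 (Nat.zero_le _)), fun i =>
      ⟨fun x => fderiv ℝ f x (EuclideanSpace.single i 1),
        isWeakPartial_fderiv (hf.of_le (by exact_mod_cast Nat.le_add_left 1 k)) _, ih ?_ ?_⟩⟩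
    · exact (hf.fderiv_right (m := k) (by norm_cast)).clm_apply contDiff_const
    · exact fun j hj x hx => (norm_iteratedFDeriv_fderiv_single_le hf hj i x).trans
        (hB (j + 1) (Nat.succ_le_succ hj) x hx)

/-- Leibniz rule for weak derivatives, with localization: the product of a function on `D ∩ B`
and a smooth function supported in `B` is a function on `D`. -/
theorem IsWeakPartial.smul (hp : 1 ≤ p) {B : Set (EuclideanSpace ℝ (Fin d))}
    (hD : MeasurableSet D) (h : IsWeakPartial (D ∩ B) v f g)
    (hf : MemLp f p (volume.restrict (D ∩ B))) (hg : MemLp g p (volume.restrict (D ∩ B)))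
    {χ : EuclideanSpace ℝ (Fin d) → ℝ} (hχ : ContDiff ℝ ∞ χ) (hχB : tsupport χ ⊆ B) :
    IsWeakPartial D v (fun x => χ x • f x) fun x => fderiv ℝ χ x v • f x + χ x • g x :=
  fun φ h1 h2 h3 => by
  have hsub : ∀ ψ : EuclideanSpace ℝ (Fin d) → ℝ, tsupport ψ ⊆ D →
      ∀ η : EuclideanSpace ℝ (Fin d) → ℝ,
      tsupport η ⊆ B → tsupport (fun x => ψ x * η x) ⊆ D ∩ B := fun ψ hψ η hη =>
    subset_inter ((tsupport_mul_subset_left (f := ψ) (g := η)).trans hψ)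
      ((tsupport_mul_subset_right (f := ψ) (g := η)).trans hη)
  have hdφ := (tsupport_fderiv_apply_const_subset φ v).trans h3
  have hdχ := (tsupport_fderiv_apply_const_subset χ v).trans hχB
  have hφχ : ContDiff ℝ ∞ fun x => φ x * χ x := h1.mul hχ
  have c2 : HasCompactSupport fun x => φ x * χ x := h2.mul_right
  have hd : ∀ x, fderiv ℝ (fun x => φ x * χ x) x v
      = fderiv ℝ φ x v * χ x + φ x * fderiv ℝ χ x v := fun x => by
    have := fderiv_fun_mul ((h1.differentiable (by simp)).differentiableAt (x := x))
      ((hχ.differentiable (by simp)).differentiableAt (x := x))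
    rw [this]
    simp [mul_comm, add_comm]
  have e := h (fun x => φ x * χ x) hφχ c2 (hsub φ h3 χ hχB)
  have cdφ := continuous_fderiv_apply_const h1 v
  have cdχ := continuous_fderiv_apply_const hχ v
  have i1 : Integrable (fun x => (fderiv ℝ φ x v * χ x) • f x) (volume.restrict (D ∩ B)) :=
    hf.integrable_smul_of_hasCompactSupport hp (cdφ.mul hχ.continuous)
      (h2.fderiv_apply_const v).mul_right
  have i2 : Integrable (fun x => (φ x * fderiv ℝ χ x v) • f x) (volume.restrict (D ∩ B)) :=
    hf.integrable_smul_of_hasCompactSupport hp (h1.continuous.mul cdχ) h2.mul_right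
  have i3 : Integrable (fun x => (φ x * χ x) • g x) (volume.restrict (D ∩ B)) :=
    hg.integrable_smul_of_hasCompactSupport hp hφχ.continuous c2
  have e1 : ∫ x in D, fderiv ℝ φ x v • χ x • f x = ∫ x in D ∩ B, (fderiv ℝ φ x v * χ x) • f x := by
    rw [← setIntegral_smul_eq_of_tsupport_subset inter_subset_left hD
      (hsub (fun x => fderiv ℝ φ x v) hdφ χ hχB)]
    simp only [mul_smul]
  have e2 : ∫ x in D, φ x • (fderiv ℝ χ x v • f x + χ x • g x)
      = (∫ x in D ∩ B, (φ x * fderiv ℝ χ x v) • f x) + ∫ x in D ∩ B, (φ x * χ x) • g x := by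
    rw [← integral_add i2 i3]
    refine (setIntegral_eq_of_subset_of_forall_sdiff_eq_zero hD inter_subset_left
      fun x hx => ?_).trans (integral_congr_ae (Filter.Eventually.of_forall fun x => ?_))
    · have hxB : x ∉ B := fun h' => hx.2 ⟨hx.1, h'⟩
      rw [image_eq_zero_of_notMem_tsupport fun h' => hxB (hχB h')]
      have := image_eq_zero_of_notMem_tsupport (f := fun x => fderiv ℝ χ x v)
        fun h' => hxB (hdχ h')
      rw [this]
      simp
    · simp only [smul_add, mul_smul]
  rw [e1, e2]
  simp only [hd, add_smul] at e
  rw [integral_add i1 i2] at e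
  rw [eq_sub_of_add_eq e]
  abel

theorem memLp_smul_of_tsupport_subset {B : Set (EuclideanSpace ℝ (Fin d))}
    (hB : MeasurableSet B) {χ : EuclideanSpace ℝ (Fin d) → ℝ}
    (hχ : Continuous χ) (hc : HasCompactSupport χ) (hχB : tsupport χ ⊆ B) :
    ∃ C : ℝ≥0, ∀ f : EuclideanSpace ℝ (Fin d) → EuclideanSpace ℝ (Fin m),
      MemLp f p (volume.restrict (D ∩ B)) → MemLp (fun x => χ x • f x) p (volume.restrict D) ∧
        eLpNorm (fun x => χ x • f x) p (volume.restrict D)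
          ≤ C * eLpNorm f p (volume.restrict (D ∩ B)) := by
  obtain ⟨C, hC⟩ := hχ.bounded_above_of_compact_support hc
  refine ⟨C.toNNReal, fun f hf => ?_⟩
  have hi : (fun x => χ x • f x) = B.indicator fun x => χ x • f x := by
    symm
    rw [indicator_eq_self]
    intro x hx
    by_contra hxB
    exact hx (by simp [image_eq_zero_of_notMem_tsupport fun h' => hxB (hχB h')])
  have hr : (volume.restrict D).restrict B = volume.restrict (D ∩ B) := by
    rw [Measure.restrict_restrict hB, inter_comm]
  have hb : ∀ᵐ x ∂(volume.restrict (D ∩ B)), ‖χ x • f x‖₊ ≤ C.toNNReal * ‖f x‖₊ :=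
    Filter.Eventually.of_forall fun x => by
      rw [nnnorm_smul]
      gcongr
      rw [← NNReal.coe_le_coe]
      exact (hC x).trans (Real.le_coe_toNNReal C)
  have hle := eLpNorm_le_nnreal_smul_eLpNorm_of_ae_le_mul hb p
  have hm : AEStronglyMeasurable (fun x => χ x • f x) (volume.restrict (D ∩ B)) :=
    hχ.aestronglyMeasurable.smul hf.1
  rw [hi, memLp_indicator_iff_restrict hB, eLpNorm_indicator_eq_eLpNorm_restrict hB, hr]
  refine ⟨hf.of_le_mul (c := C.toNNReal) hm ?_, ?_⟩
  · filter_upwards [hb] with x hx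
    exact_mod_cast hx
  · simpa [ENNReal.smul_def] using hle

/-- Multiplication by a smooth function supported in `B` maps Sobolev functions on `D ∩ B` to
Sobolev functions on `D`, boundedly. -/
theorem exists_sobolevBound_smul (hp : 1 ≤ p) {B : Set (EuclideanSpace ℝ (Fin d))}
    (hD : MeasurableSet D) (hB : MeasurableSet B) (k : ℕ) {χ : EuclideanSpace ℝ (Fin d) → ℝ}
    (hχ : ContDiff ℝ ∞ χ) (hc : HasCompactSupport χ) (hχB : tsupport χ ⊆ B) :
    ∃ C : ℝ≥0, ∀ (f : EuclideanSpace ℝ (Fin d) → EuclideanSpace ℝ (Fin m)) (ε : ℝ≥0∞),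
      SobolevBound (D ∩ B) p k ε f → SobolevBound D p k (C * ε) fun x => χ x • f x := by
  induction k generalizing χ with
  | zero =>
    obtain ⟨C, hC⟩ := memLp_smul_of_tsupport_subset (m := m) (p := p) (D := D) hB hχ.continuous
      hc hχB
    exact ⟨C, fun f ε h => ⟨(hC f h.1).1, (hC f h.1).2.trans (by gcongr; exact h.2)⟩⟩
  | succ k ih =>
    obtain ⟨C₀, hC₀⟩ := memLp_smul_of_tsupport_subset (m := m) (p := p) (D := D) hB hχ.continuous
      hc hχB
    obtain ⟨C₁, hC₁⟩ := ih hχ hc hχB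
    choose C₂ hC₂ using fun i : Fin d => ih
      (contDiff_fderiv_apply_const hχ (EuclideanSpace.single i 1))
      (hc.fderiv_apply_const _) ((tsupport_fderiv_apply_const_subset χ _).trans hχB)
    refine ⟨C₀ + (C₁ + ∑ i, C₂ i), fun f ε h => ⟨⟨(hC₀ f h.memLp).1,
      (hC₀ f h.memLp).2.trans ?_⟩, fun i => ?_⟩⟩
    · gcongr
      · exact_mod_cast le_self_add
      · exact h.eLpNorm_le
    · obtain ⟨g, hg, hk⟩ := h.2 i
      refine ⟨_, hg.smul hp hD h.memLp hk.memLp hχ hχB, ?_⟩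
      refine (((hC₂ i) f ε h.of_succ).add hp (hC₁ g ε hk)).mono ?_
      rw [← add_mul]
      gcongr
      norm_cast
      have := Finset.single_le_sum (fun j _ => zero_le (a := C₂ j)) (Finset.mem_univ i)
      calc C₂ i + C₁ ≤ (∑ i, C₂ i) + C₁ := by gcongr
        _ ≤ _ := by rw [add_comm]; exact le_add_self

end

/-! ### Local approximation of Sobolev functions by smooth functions -/

/-- The convolution of `ψ` with the extension of `f` from `D` by zero. -/
noncomputable def localMollify {d m : ℕ} (D : Set (EuclideanSpace ℝ (Fin d)))
    (ψ : EuclideanSpace ℝ (Fin d) → ℝ) (f : EuclideanSpace ℝ (Fin d) → EuclideanSpace ℝ (Fin m))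
    (x : EuclideanSpace ℝ (Fin d)) : EuclideanSpace ℝ (Fin m) :=
  ∫ y, ψ y • D.indicator f (x - y)

section

variable {d m : ℕ} {D D' : Set (EuclideanSpace ℝ (Fin d))} {p : ℝ≥0∞}
  {f f' g g' : EuclideanSpace ℝ (Fin d) → EuclideanSpace ℝ (Fin m)}
  {v : EuclideanSpace ℝ (Fin d)} {ψ : EuclideanSpace ℝ (Fin d) → ℝ}

theorem MeasureTheory.MemLp.locallyIntegrable_indicator (hp : 1 ≤ p) (hD : MeasurableSet D)
    (hf : MemLp f p (volume.restrict D)) : LocallyIntegrable (D.indicator f) :=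
  ((memLp_indicator_iff_restrict hD).2 hf).locallyIntegrable hp

theorem contDiff_localMollify (hp : 1 ≤ p) (hD : MeasurableSet D)
    (hf : MemLp f p (volume.restrict D)) (hψ : ContDiff ℝ ∞ ψ) (hc : HasCompactSupport ψ) :
    ContDiff ℝ ∞ (localMollify D ψ f) :=
  hc.contDiff_convolution_left (ContinuousLinearMap.lsmul ℝ ℝ) hψ
    (hf.locallyIntegrable_indicator hp hD)

/-- Mollification commutes with weak derivatives at the points whose mollification only involves
values in `D`. -/
theorem fderiv_localMollify (hp : 1 ≤ p) (hD : MeasurableSet D)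
    (hf : MemLp f p (volume.restrict D)) (hfg : IsWeakPartial D v f g)
    (hψ : ContDiff ℝ ∞ ψ) (hc : HasCompactSupport ψ) {x : EuclideanSpace ℝ (Fin d)}
    (hx : ∀ y ∈ tsupport ψ, x - y ∈ D) :
    fderiv ℝ (localMollify D ψ f) x v = localMollify D ψ g x := by
  have hF := hf.locallyIntegrable_indicator hp hD
  have h1 := hc.hasFDerivAt_convolution_left (ContinuousLinearMap.lsmul ℝ ℝ)
    (hψ.of_le (by exact_mod_cast le_top)) hF x
  have hex := ((hc.fderiv (𝕜 := ℝ)).convolutionExists_left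
    ((ContinuousLinearMap.lsmul ℝ ℝ).precompL (EuclideanSpace ℝ (Fin d)))
    (hψ.continuous_fderiv (by simp)) hF x).integrable
  have h2 : fderiv ℝ (localMollify D ψ f) x v
      = ∫ y, fderiv ℝ ψ y v • D.indicator f (x - y) := by
    rw [show fderiv ℝ (localMollify D ψ f) x = _ from h1.fderiv, MeasureTheory.convolution,
      ContinuousLinearMap.integral_apply hex]
    rfl
  set φ : EuclideanSpace ℝ (Fin d) → ℝ := fun y => ψ (x - y) with hφ
  have hφc : ContDiff ℝ ∞ φ := hψ.comp (contDiff_const.sub contDiff_id)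
  have hφs : HasCompactSupport φ := hc.comp_homeomorph (Homeomorph.subLeft x)
  have hφt : tsupport φ ⊆ D := fun y hy => by
    have h3 : x - y ∈ tsupport ψ :=
      tsupport_comp_subset_preimage ψ (f := fun y => x - y) (by fun_prop) hy
    simpa using hx _ h3
  have hφd : ∀ y, fderiv ℝ φ y v = -(fderiv ℝ ψ (x - y) v) := fun y => by
    have h3 := ((hψ.differentiable (by simp)).differentiableAt (x := x - y)).hasFDerivAt.comp y
      ((hasFDerivAt_id y).const_sub x)
    have h4 : fderiv ℝ φ y = _ := h3.fderiv
    rw [h4]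
    simp
  have e := hfg φ hφc hφs hφt
  have hind : ∀ (η : EuclideanSpace ℝ (Fin d) → ℝ)
      (f : EuclideanSpace ℝ (Fin d) → EuclideanSpace ℝ (Fin m)),
      ∫ y, η y • D.indicator f (x - y) = ∫ y in D, η (x - y) • f y := fun η f => by
    rw [← integral_sub_left_eq_self _ volume x, ← integral_indicator hD]
    refine integral_congr_ae (Filter.Eventually.of_forall fun y => ?_)
    by_cases hy : y ∈ D <;> simp [hy]
  rw [h2, localMollify, hind, hind]
  simp only [hφd, neg_smul, integral_neg, neg_inj] at e
  exact e

theorem IsWeakPartial.congr_right (h : IsWeakPartial D v f g) (hD : MeasurableSet D)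
    (hg : ∀ x ∈ D, g x = g' x) : IsWeakPartial D v f g' := fun φ h1 h2 h3 => by
  rw [h φ h1 h2 h3]
  congr 1
  exact setIntegral_congr_fun hD fun x hx => by rw [hg x hx]

/-- Mollification with densities concentrated near the origin approximates a Sobolev function on
every part `D ∩ B` of `D` on which the mollification only involves values in `D`. -/
theorem SobolevBound.eventually_sub_localMollify [hp1 : Fact (1 ≤ p)] (hp : p ≠ ⊤)
    (hD : MeasurableSet D) {k : ℕ} {A : ℝ≥0∞} (h : SobolevBound D p k A f) {ε : ℝ≥0∞}
    (hε : 0 < ε) (hε' : ε ≠ ⊤) :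
    ∀ᶠ δ in nhdsWithin (0 : ℝ) (Ioi 0), ∀ (ψ : EuclideanSpace ℝ (Fin d) → ℝ)
      (B : Set (EuclideanSpace ℝ (Fin d))), ContDiff ℝ ∞ ψ →
      HasCompactSupport ψ → (∀ y, 0 ≤ ψ y) → ∫ y, ψ y = 1 → (∀ y ∈ tsupport ψ, ‖y‖ < δ) →
      MeasurableSet B → (∀ x ∈ D ∩ B, ∀ y ∈ tsupport ψ, x - y ∈ D) →
      SobolevBound (D ∩ B) p k ε (f - localMollify D ψ f) := by
  have key : ∀ {f : EuclideanSpace ℝ (Fin d) → EuclideanSpace ℝ (Fin m)},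
      MemLp f p (volume.restrict D) →
      ∀ᶠ δ in nhdsWithin (0 : ℝ) (Ioi 0), ∀ (ψ : EuclideanSpace ℝ (Fin d) → ℝ)
      (B : Set (EuclideanSpace ℝ (Fin d))), ContDiff ℝ ∞ ψ →
      HasCompactSupport ψ → (∀ y, 0 ≤ ψ y) → ∫ y, ψ y = 1 → (∀ y ∈ tsupport ψ, ‖y‖ < δ) →
      MeasurableSet B → MemLp (f - localMollify D ψ f) p (volume.restrict (D ∩ B)) ∧
        eLpNorm (f - localMollify D ψ f) p (volume.restrict (D ∩ B)) ≤ ε := by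
    intro f hf
    have hF : MemLp (D.indicator f) p := (memLp_indicator_iff_restrict hD).2 hf
    obtain ⟨δ₀, hδ₀, H⟩ := exists_forall_eLpNorm_convolution_sub_le hp hF hε
    filter_upwards [Ioo_mem_nhdsGT hδ₀] with δ hδ ψ B h1 h2 h3 h4 h5 hB
    have e1 : eLpNorm (localMollify D ψ f - D.indicator f) p ≤ ε := H ψ h1.continuous h2 h3 h4
      fun y hy => (h5 y (subset_tsupport _ hy)).trans hδ.2
    have e2 : eLpNorm (f - localMollify D ψ f) p (volume.restrict (D ∩ B)) ≤ ε := by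
      refine le_trans ?_ e1
      rw [eLpNorm_congr_ae (g := D.indicator f - localMollify D ψ f), eLpNorm_sub_comm]
      · exact eLpNorm_mono_measure _ Measure.restrict_le_self
      · filter_upwards [ae_restrict_mem (hD.inter hB)] with x hx
        simp [hx.1]
    exact ⟨⟨(hf.1.mono_measure (Measure.restrict_mono inter_subset_left le_rfl)).sub
      (contDiff_localMollify hp1.out hD hf h1 h2).continuous.aestronglyMeasurable,
      e2.trans_lt hε'.lt_top⟩, e2⟩
  induction k generalizing f with
  | zero =>
    filter_upwards [key h.1] with δ hδ ψ B h1 h2 h3 h4 h5 hB _ using hδ ψ B h1 h2 h3 h4 h5 hB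
  | succ k ih =>
    choose g hg hk using h.2
    filter_upwards [key h.memLp, Filter.eventually_all.2 fun i => ih (hk i)]
      with δ hδ hδi ψ B h1 h2 h3 h4 h5 hB h6
    have h0 := hδ ψ B h1 h2 h3 h4 h5 hB
    refine ⟨h0, fun i => ⟨g i - localMollify D ψ (g i), ?_, hδi i ψ B h1 h2 h3 h4 h5 hB h6⟩⟩
    have hr : ∀ {f : EuclideanSpace ℝ (Fin d) → EuclideanSpace ℝ (Fin m)},
        MemLp f p (volume.restrict D) → MemLp f p (volume.restrict (D ∩ B)) := fun hf =>
      hf.mono_measure (Measure.restrict_mono inter_subset_left le_rfl)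
    have hw := isWeakPartial_fderiv (D := D ∩ B)
      ((contDiff_localMollify hp1.out hD h.memLp h1 h2).of_le (by exact_mod_cast le_top))
      (EuclideanSpace.single i 1)
    have hw' := hw.congr_right (g' := localMollify D ψ (g i)) (hD.inter hB) fun x hx =>
      fderiv_localMollify hp1.out hD h.memLp (hg i) h1 h2 (h6 x hx)
    refine ((hg i).restrict inter_subset_left hD).sub hp1.out hw' (hr h.memLp) ?_
      (hr (hk i).memLp) ?_
    · simpa using (hr h.memLp).sub h0.1
    · simpa using (hr (hk i).memLp).sub (hδi i ψ B h1 h2 h3 h4 h5 hB h6).memLp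

end

/-- Near every point of the closure of a Lipschitz domain there is a cone of directions pointing
into the domain. -/
theorem IsLipschitzDomain.exists_inward_cone {d : ℕ} {D : Set (EuclideanSpace ℝ (Fin d))}
    (hD : IsLipschitzDomain D) {x₀ : EuclideanSpace ℝ (Fin d)} (hx₀ : x₀ ∈ closure D) :
    ∃ ρ > 0, ∃ ν : EuclideanSpace ℝ (Fin d), ‖ν‖ ≤ 1 ∧ ∃ c : ℝ, 0 < c ∧ c ≤ 1 ∧ ∃ t₀ > 0,
      ∀ x ∈ D ∩ Metric.ball x₀ ρ, ∀ t : ℝ, 0 < t → t < t₀ → ∀ z : EuclideanSpace ℝ (Fin d),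
        ‖z - t • ν‖ ≤ c * t → x + z ∈ D := by
  by_cases hx : x₀ ∈ D
  · obtain ⟨r, hr, hrD⟩ := Metric.isOpen_iff.1 hD.isOpen x₀ hx
    refine ⟨r / 2, by positivity, 0, by simp, 1, one_pos, le_rfl, r / 2, by positivity,
      fun x hx t _ ht z hz => hrD ?_⟩
    rw [smul_zero, sub_zero, one_mul] at hz
    have h1 := hx.2
    rw [Metric.mem_ball, dist_eq_norm] at h1 ⊢
    calc ‖x + z - x₀‖ = ‖(x - x₀) + z‖ := by congr 1; abel
      _ ≤ ‖x - x₀‖ + ‖z‖ := norm_add_le _ _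
      _ < r := by linarith
  · obtain ⟨ν, hν, r, hr, L, γ, hγ, hrD⟩ := hD.boundary x₀ ⟨hx₀, by rwa [hD.isOpen.interior_eq]⟩
    -- the aperture `c` satisfies `L c t ≤ t - c t`: the graph rises less than the point does
    have hL : (0 : ℝ) < L + 1 := by positivity
    have hc1 : (1 : ℝ) / (L + 1) ≤ 1 := by
      rw [div_le_one hL]
      linarith [L.coe_nonneg]
    refine ⟨r / 2, by positivity, ν, hν.le, 1 / (L + 1), by positivity, hc1, r / 4, by positivity,
      fun x hx t ht0 ht z hz => ?_⟩
    have h1 := hx.2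
    rw [Metric.mem_ball, dist_eq_norm] at h1
    set w := z - t • ν with hw
    have hz' : z = t • ν + w := by rw [hw]; abel
    set c : ℝ := 1 / (L + 1) with hc
    have hct : c * t ≤ t := mul_le_of_le_one_left ht0.le hc1
    have hzn : ‖z‖ ≤ 2 * t := by
      rw [hz']
      refine (norm_add_le _ _).trans ?_
      rw [norm_smul, hν, Real.norm_of_nonneg ht0.le]
      linarith
    refine (hrD (x + z) ?_).2 ?_
    · rw [Metric.mem_ball, dist_eq_norm]
      calc ‖x + z - x₀‖ = ‖(x - x₀) + z‖ := by congr 1; abel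
        _ ≤ ‖x - x₀‖ + ‖z‖ := norm_add_le _ _
        _ < r := by linarith
    · have h2 := (hrD x (Metric.ball_subset_ball (by linarith) hx.2)).1 hx.1
      set P := (ℝ ∙ ν)ᗮ.orthogonalProjectionOnto
      have hPν : P ν = 0 :=
        Submodule.orthogonalProjectionOnto_orthogonalComplement_singleton_eq_zero ν
      have hP : ‖P (x + z) - P x‖ ≤ c * t := by
        rw [map_add, add_sub_cancel_left, hz', map_add, map_smul, hPν, smul_zero, zero_add]
        exact ((ℝ ∙ ν)ᗮ.norm_orthogonalProjectionOnto_apply_le w).trans hz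
      have h3 : γ (P (x + z)) - γ (P x) ≤ L * (c * t) := by
        have := hγ.dist_le_mul (P (x + z)) (P x)
        rw [Real.dist_eq, dist_eq_norm] at this
        exact (le_abs_self _).trans (this.trans (by gcongr))
      have h4 : inner ℝ ν (x + z) = inner ℝ ν x + t + inner ℝ ν w := by
        rw [inner_add_right, hz', inner_add_right, inner_smul_right, real_inner_self_eq_norm_sq, hν]
        ring
      have h5 : -(c * t) ≤ inner ℝ ν w := by
        have := abs_real_inner_le_norm ν w
        rw [hν, one_mul] at this
        exact (abs_le.1 (this.trans hz)).1
      have h6 : L * (c * t) + c * t = t := by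
        rw [hc]; field_simp
      rw [h4]
      linarith

/-- Near every point of the closure of a Lipschitz domain there are arbitrarily concentrated
mollifiers that only involve values in the domain: bump functions with an off-centre support. -/
theorem IsLipschitzDomain.exists_mollifier {d : ℕ} {D : Set (EuclideanSpace ℝ (Fin d))}
    (hD : IsLipschitzDomain D) {x₀ : EuclideanSpace ℝ (Fin d)} (hx₀ : x₀ ∈ closure D) :
    ∃ ρ > 0, ∀ δ > 0, ∃ ψ : EuclideanSpace ℝ (Fin d) → ℝ, ContDiff ℝ ∞ ψ ∧ HasCompactSupport ψ ∧
      (∀ y, 0 ≤ ψ y) ∧ ∫ y, ψ y = 1 ∧ (∀ y ∈ tsupport ψ, ‖y‖ < δ) ∧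
      ∀ x ∈ D ∩ Metric.ball x₀ ρ, ∀ y ∈ tsupport ψ, x - y ∈ D := by
  obtain ⟨ρ, hρ, ν, hν, c, hc, hc1, t₀, ht₀, H⟩ := hD.exists_inward_cone hx₀
  refine ⟨ρ, hρ, fun δ hδ => ?_⟩
  obtain ⟨t, ht, ht'⟩ := exists_between (lt_min ht₀ (half_pos hδ))
  rw [lt_min_iff] at ht'
  let b : ContDiffBump (-(t • ν)) := ⟨c * t / 2, c * t, by positivity, by
    have : 0 < c * t := by positivity
    linarith⟩
  have hb : ∀ y ∈ tsupport (b.normed volume), ‖-y - t • ν‖ ≤ c * t := fun y hy => by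
    rw [b.tsupport_normed_eq, Metric.mem_closedBall, dist_eq_norm] at hy
    rw [← norm_neg]
    refine le_trans (le_of_eq ?_) hy
    congr 1
    abel
  refine ⟨b.normed volume, b.contDiff_normed, b.hasCompactSupport_normed, b.nonneg_normed,
    b.integral_normed, fun y hy => ?_, fun x hx y hy => ?_⟩
  · have h1 := hb y hy
    have h2 : ‖t • ν‖ ≤ t := by
      rw [norm_smul, Real.norm_of_nonneg ht.le]
      exact mul_le_of_le_one_right ht.le hν
    have h3 : ‖y‖ ≤ ‖-y - t • ν‖ + ‖t • ν‖ := by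
      rw [← norm_neg y]
      simpa using norm_add_le (-y - t • ν) (t • ν)
    have h4 : c * t ≤ t := mul_le_of_le_one_left ht.le hc1
    linarith
  · rw [sub_eq_add_neg]
    exact H x hx t ht ht'.1 (-y) (hb y hy)

open scoped Manifold in
/-- Functions smooth on the whole of `ℝᵈ` are dense among the Sobolev functions on a Lipschitz
domain: local approximations are glued by a partition of unity. -/
theorem SobolevBound.exists_contDiff_sub {d m k : ℕ} {D : Set (EuclideanSpace ℝ (Fin d))}
    {p : ℝ≥0∞} [hp1 : Fact (1 ≤ p)] (hp : p ≠ ⊤) (hD : IsLipschitzDomain D)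
    {f : EuclideanSpace ℝ (Fin d) → EuclideanSpace ℝ (Fin m)} {A : ℝ≥0∞}
    (h : SobolevBound D p k A f) {ε : ℝ≥0} (hε : 0 < ε) :
    ∃ φ : EuclideanSpace ℝ (Fin d) → EuclideanSpace ℝ (Fin m), ContDiff ℝ ∞ φ ∧
      SobolevBound D p k ε (f - φ) := by
  have hDm := hD.isOpen.measurableSet
  choose ρ hρ H using fun x : closure D => hD.exists_mollifier x.2
  obtain ⟨t, ht⟩ := hD.isBounded.isCompact_closure.elim_finite_subcover
    (fun x : closure D => Metric.ball (x : EuclideanSpace ℝ (Fin d)) (ρ x))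
    (fun x => Metric.isOpen_ball)
    fun x hx => mem_iUnion.2 ⟨⟨x, hx⟩, Metric.mem_ball_self (hρ _)⟩
  obtain ⟨χ, hχ⟩ := SmoothPartitionOfUnity.exists_isSubordinate
    𝓘(ℝ, EuclideanSpace ℝ (Fin d)) isClosed_closure
    (fun x : t => Metric.ball (x.1 : EuclideanSpace ℝ (Fin d)) (ρ x.1))
    (fun x => Metric.isOpen_ball) (by
      intro x hx
      obtain ⟨y, hy, hxy⟩ := mem_iUnion₂.1 (ht hx)
      exact mem_iUnion.2 ⟨⟨y, hy⟩, hxy⟩)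
  have hχs : ∀ x : t, ContDiff ℝ ∞ (χ x) := fun x => (χ x).contMDiff.contDiff
  have hχc : ∀ x : t, HasCompactSupport (χ x) := fun x =>
    Metric.isCompact_of_isClosed_isBounded (isClosed_tsupport _)
      (Metric.isBounded_ball.subset (hχ x))
  choose C hC using fun x : t => exists_sobolevBound_smul (m := m) hp1.out hDm
    Metric.isOpen_ball.measurableSet k (hχs x) (hχc x) (hχ x)
  set η : ℝ≥0 := ε / (∑ x, C x + 1) with hη
  have hη0 : 0 < η := by positivity
  have key : ∀ x : t, ∃ w : EuclideanSpace ℝ (Fin d) → EuclideanSpace ℝ (Fin m),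
      ContDiff ℝ ∞ w ∧ SobolevBound (D ∩ Metric.ball (x.1 : EuclideanSpace ℝ (Fin d)) (ρ x.1)) p k
        η (f - w) := fun x => by
    obtain ⟨δ, hδ, hδ0⟩ := ((h.eventually_sub_localMollify hp hDm (ε := η)
      (by exact_mod_cast hη0) ENNReal.coe_ne_top).and self_mem_nhdsWithin).exists
    obtain ⟨ψ, h1, h2, h3, h4, h5, h6⟩ := H x.1 δ hδ0
    exact ⟨localMollify D ψ f, contDiff_localMollify hp1.out hDm h.memLp h1 h2,
      hδ ψ _ h1 h2 h3 h4 h5 Metric.isOpen_ball.measurableSet h6⟩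
  choose w hw hwb using key
  refine ⟨fun y => ∑ x, χ x y • w x y, ContDiff.sum fun x _ => (hχs x).smul (hw x), ?_⟩
  have hsum := SobolevBound.sum hp1.out Finset.univ fun x _ => hC x _ _ (hwb x)
  refine (hsum.mono ?_).congr ?_
  · rw [← Finset.sum_mul]
    norm_cast
    rw [hη, mul_div_assoc', div_le_iff₀ (by positivity), mul_comm]
    gcongr
    exact le_self_add
  · filter_upwards [ae_restrict_mem hDm] with y hy
    have h1 : ∑ x, χ x y = 1 := by
      rw [← finsum_eq_sum_of_fintype]
      exact χ.sum_eq_one (subset_closure hy)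
    simp only [Finset.sum_apply, Pi.sub_apply, smul_sub, Finset.sum_sub_distrib]
    rw [← Finset.sum_smul, h1, one_smul]

/-! ### Weak derivatives of higher order -/

/-- The partial derivative `∂_{i₁} ⋯ ∂_{iₙ} φ` for a word of any length. -/
noncomputable def wordDeriv {d n : ℕ} (α : Fin n → Fin d) (φ : EuclideanSpace ℝ (Fin d) → ℝ)
    (x : EuclideanSpace ℝ (Fin d)) : ℝ :=
  iteratedFDeriv ℝ n φ x fun a => EuclideanSpace.single (α a) 1

/-- `g` is the weak derivative of `f` on `D` belonging to the word `α`. -/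
def IsWeakWordDeriv {d m n : ℕ} (D : Set (EuclideanSpace ℝ (Fin d))) (α : Fin n → Fin d)
    (f g : EuclideanSpace ℝ (Fin d) → EuclideanSpace ℝ (Fin m)) : Prop :=
  ∀ φ : EuclideanSpace ℝ (Fin d) → ℝ, ContDiff ℝ ∞ φ → HasCompactSupport φ → tsupport φ ⊆ D →
    ∫ x in D, wordDeriv α φ x • f x = (-1 : ℝ) ^ n • ∫ x in D, φ x • g x

section

variable {d m n : ℕ} {D : Set (EuclideanSpace ℝ (Fin d))} {p : ℝ≥0∞}
  {f f' g g' : EuclideanSpace ℝ (Fin d) → EuclideanSpace ℝ (Fin m)}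
  {φ : EuclideanSpace ℝ (Fin d) → ℝ}

theorem wordDeriv_zero (α : Fin 0 → Fin d) : wordDeriv α φ = φ :=
  funext fun _ => iteratedFDeriv_zero_apply _

theorem isWeakWordDeriv_zero (α : Fin 0 → Fin d) : IsWeakWordDeriv D α f f := fun φ _ _ _ => by
  rw [wordDeriv_zero, pow_zero, one_smul]

theorem wordDeriv_succ_left (α : Fin (n + 1) → Fin d) (hφ : ContDiff ℝ ∞ φ)
    (x : EuclideanSpace ℝ (Fin d)) :
    wordDeriv α φ x
      = fderiv ℝ (wordDeriv (Fin.tail α) φ) x (EuclideanSpace.single (α 0) 1) :=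
  DifferentiableAt.iteratedFDeriv_succ_apply_left'
    ((hφ.differentiable_iteratedFDeriv (m := n) (by exact_mod_cast ENat.natCast_lt_top n)) x)

theorem wordDeriv_snoc (β : Fin n → Fin d) (i : Fin d) (hφ : ContDiff ℝ ∞ φ)
    (x : EuclideanSpace ℝ (Fin d)) :
    wordDeriv (Fin.snoc (α := fun _ => Fin d) β i) φ x
      = wordDeriv β (fun y => fderiv ℝ φ y (EuclideanSpace.single i 1)) x := by
  set L : (EuclideanSpace ℝ (Fin d) →L[ℝ] ℝ) →L[ℝ] ℝ :=
    ContinuousLinearMap.apply ℝ _ (EuclideanSpace.single i (1 : ℝ)) with hL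
  have h1 := L.iteratedFDeriv_comp_left
    (((hφ.fderiv_right (m := ∞) (by simp)).contDiffAt (x := x))) (i := n)
    (by exact_mod_cast le_top)
  have h2 : (fun y => fderiv ℝ φ y (EuclideanSpace.single i 1)) = L ∘ fderiv ℝ φ := rfl
  rw [wordDeriv, wordDeriv, iteratedFDeriv_succ_apply_right, h2, h1]
  simp [hL, Fin.init_def]

theorem contDiff_wordDeriv (α : Fin n → Fin d) (hφ : ContDiff ℝ ∞ φ) :
    ContDiff ℝ ∞ (wordDeriv α φ) := by
  induction n with
  | zero => rwa [wordDeriv_zero]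
  | succ n ih =>
    have h : wordDeriv α φ = _ := funext (wordDeriv_succ_left α hφ)
    rw [h]
    exact contDiff_fderiv_apply_const (ih (Fin.tail α)) _

theorem tsupport_wordDeriv_subset (α : Fin n → Fin d) :
    tsupport (wordDeriv α φ) ⊆ tsupport φ :=
  (closure_mono fun x hx => by
    rw [Function.mem_support] at hx ⊢
    exact fun h => hx (by rw [wordDeriv, h]; rfl)).trans (tsupport_iteratedFDeriv_subset (𝕜 := ℝ) n)

theorem HasCompactSupport.wordDeriv (α : Fin n → Fin d) (hc : HasCompactSupport φ) :
    HasCompactSupport (wordDeriv α φ) :=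
  hc.of_isClosed_subset (isClosed_tsupport _) (tsupport_wordDeriv_subset α)

theorem IsWeakWordDeriv.congr {α : Fin n → Fin d} (h : IsWeakWordDeriv D α f g)
    (hf : f =ᵐ[volume.restrict D] f') (hg : g =ᵐ[volume.restrict D] g') :
    IsWeakWordDeriv D α f' g' := fun φ h1 h2 h3 => by
  have e1 : ∫ x in D, _root_.wordDeriv α φ x • f' x = ∫ x in D, _root_.wordDeriv α φ x • f x := by
    refine integral_congr_ae ?_
    filter_upwards [hf] with x hx
    rw [hx]
  have e2 : ∫ x in D, φ x • g' x = ∫ x in D, φ x • g x := by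
    refine integral_congr_ae ?_
    filter_upwards [hg] with x hx
    rw [hx]
  rw [e1, e2]
  exact h φ h1 h2 h3

/-- Weak derivatives are unique. -/
theorem IsWeakWordDeriv.ae_eq (hD : IsOpen D) (hp : 1 ≤ p) {α : Fin n → Fin d}
    (h : IsWeakWordDeriv D α f g) (h' : IsWeakWordDeriv D α f g')
    (hg : MemLp g p (volume.restrict D)) (hg' : MemLp g' p (volume.restrict D)) :
    g =ᵐ[volume.restrict D] g' := by
  have key := hD.ae_eq_zero_of_integral_contDiff_smul_eq_zero (μ := volume.restrict D)
    (f := g - g') (((hg.sub hg').locallyIntegrable hp).locallyIntegrableOn D)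
    fun φ h1 h2 h3 => by
      simp only [Pi.sub_apply, smul_sub]
      rw [integral_sub (hg.integrable_smul_of_hasCompactSupport hp h1.continuous h2)
        (hg'.integrable_smul_of_hasCompactSupport hp h1.continuous h2), sub_eq_zero]
      have e := (h φ h1 h2 h3).symm.trans (h' φ h1 h2 h3)
      exact smul_right_injective _ (pow_ne_zero n (by norm_num : (-1 : ℝ) ≠ 0)) e
  filter_upwards [key, ae_restrict_mem hD.measurableSet] with x hx hxD
  exact sub_eq_zero.1 (hx hxD)

/-- The one-step-at-a-time Sobolev bound controls the weak derivatives of all words. -/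
theorem SobolevBound.exists_isWeakWordDeriv {k : ℕ} {ε : ℝ≥0∞} (h : SobolevBound D p k ε f)
    (hn : n ≤ k) (α : Fin n → Fin d) :
    ∃ g, MemLp g p (volume.restrict D) ∧ eLpNorm g p (volume.restrict D) ≤ ε ∧
      IsWeakWordDeriv D α f g := by
  induction n generalizing f k with
  | zero => exact ⟨f, h.memLp, h.eLpNorm_le, isWeakWordDeriv_zero α⟩
  | succ n ih =>
    obtain ⟨k, rfl⟩ : ∃ k', k = k' + 1 := ⟨k - 1, by omega⟩
    obtain ⟨g₁, h1, h2⟩ := h.2 (α 0)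
    obtain ⟨g, hg, hgε, hgw⟩ := ih h2 (Nat.le_of_succ_le_succ hn) (Fin.tail α)
    refine ⟨g, hg, hgε, fun φ c1 c2 c3 => ?_⟩
    have e1 := h1 (wordDeriv (Fin.tail α) φ) (contDiff_wordDeriv _ c1) (c2.wordDeriv _)
      ((tsupport_wordDeriv_subset _).trans c3)
    simp only [wordDeriv_succ_left α c1]
    rw [e1, hgw φ c1 c2 c3, pow_succ, mul_neg_one, neg_smul]

end

/-! ### Sobolev spaces on Lipschitz domains -/

/-- The inclusion `Lᵖ ⊆ L¹` for a finite measure. -/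
noncomputable def MeasureTheory.Lp.inclusionL1 {α G : Type*} [MeasurableSpace α] (μ : Measure α)
    [IsFiniteMeasure μ] [NormedAddCommGroup G] [NormedSpace ℝ G] (p : ℝ≥0∞) [hp1 : Fact (1 ≤ p)] :
    Lp G p μ →L[ℝ] Lp G 1 μ :=
  LinearMap.mkContinuous
    { toFun := fun u => ((Lp.memLp u).mono_exponent hp1.out).toLp u
      map_add' := fun u v => by
        rw [← MemLp.toLp_add]
        exact MemLp.toLp_congr _ _ (Lp.coeFn_add u v)
      map_smul' := fun c u => by
        rw [RingHom.id_apply, ← MemLp.toLp_const_smul]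
        exact MemLp.toLp_congr _ _ (Lp.coeFn_smul c u) }
    (μ univ ^ (1 / (1 : ℝ≥0∞).toReal - 1 / p.toReal)).toReal fun u => by
      have h1 := eLpNorm_le_eLpNorm_mul_rpow_measure_univ hp1.out (Lp.aestronglyMeasurable u)
      have h2 : 0 ≤ 1 / (1 : ℝ≥0∞).toReal - 1 / p.toReal := by
        rcases eq_or_ne p ⊤ with rfl | hp
        · simp
        · have h3 : 1 ≤ p.toReal := by
            simpa using ENNReal.toReal_mono hp hp1.out
          simpa using inv_le_one_of_one_le₀ h3
      refine (Lp.norm_toLp u ((Lp.memLp u).mono_exponent hp1.out)).trans_le ?_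
      refine (ENNReal.toReal_mono (ENNReal.mul_ne_top (Lp.eLpNorm_ne_top _)
        (ENNReal.rpow_ne_top_of_nonneg h2 (measure_ne_top _ _))) h1).trans_eq ?_
      rw [ENNReal.toReal_mul, mul_comm, Lp.norm_def]

theorem MeasureTheory.Lp.coeFn_inclusionL1 {α G : Type*} [MeasurableSpace α] (μ : Measure α)
    [IsFiniteMeasure μ] [NormedAddCommGroup G] [NormedSpace ℝ G] (p : ℝ≥0∞) [hp1 : Fact (1 ≤ p)]
    (u : Lp G p μ) : Lp.inclusionL1 μ p u =ᵐ[μ] u :=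
  ((Lp.memLp u).mono_exponent hp1.out).coeFn_toLp

section

variable {d m k : ℕ} {D : Set (EuclideanSpace ℝ (Fin d))} {p : ℝ≥0∞} [hp1 : Fact (1 ≤ p)]

theorem SobolevSpace.sobolevBound_of_add_eq (u : SobolevSpace D m k p) (n j : ℕ)
    (hj : j + n = k) (β : Fin j → Fin d) :
    SobolevBound D p n ⊤ (u.1 ⟨⟨j, by omega⟩, β⟩) := by
  induction n generalizing j with
  | zero => exact ⟨Lp.memLp _, le_top⟩
  | succ n ih =>
    refine ⟨⟨Lp.memLp _, le_top⟩, fun i =>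
      ⟨_, fun φ h1 h2 h3 => ?_, ih (j + 1) (by omega) (Fin.snoc (α := fun _ => Fin d) β i)⟩⟩
    have e1 := u.2 ⟨⟨j, by omega⟩, β⟩ (fun y => fderiv ℝ φ y (EuclideanSpace.single i 1))
      (contDiff_fderiv_apply_const h1 _) (h2.fderiv_apply_const _)
      ((tsupport_fderiv_apply_const_subset φ _).trans h3)
    have e2 := u.2 ⟨⟨j + 1, by omega⟩, Fin.snoc (α := fun _ => Fin d) β i⟩ φ h1 h2 h3
    have e3 : ∀ x, partialDeriv (k := k) ⟨⟨j + 1, by omega⟩, Fin.snoc (α := fun _ => Fin d) β i⟩ φ x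
        = partialDeriv (k := k) ⟨⟨j, by omega⟩, β⟩
          (fun y => fderiv ℝ φ y (EuclideanSpace.single i 1)) x := wordDeriv_snoc β i h1
    simp only [e3] at e2
    have e4 := e1.symm.trans e2
    simp only at e4
    rw [pow_succ, mul_neg_one, neg_smul, ← smul_neg] at e4
    exact smul_right_injective _ (pow_ne_zero j (by norm_num : (-1 : ℝ) ≠ 0)) e4

theorem SobolevSpace.sobolevBound (u : SobolevSpace D m k p) :
    SobolevBound D p k ⊤ (SobolevSpace.rep u) :=
  SobolevSpace.sobolevBound_of_add_eq u k 0 (Nat.zero_add k) Fin.elim0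

theorem SobolevSpace.rep_sub_ae_eq (u v : SobolevSpace D m k p) :
    SobolevSpace.rep (u - v) =ᵐ[volume.restrict D] SobolevSpace.rep u - SobolevSpace.rep v :=
  Lp.coeFn_sub (u.1 (DerivIndex.zero d k)) (v.1 (DerivIndex.zero d k))

/-- By uniqueness of weak derivatives the Sobolev norm is controlled by the Sobolev bound. -/
theorem SobolevSpace.exists_norm_le_of_sobolevBound (hD : IsOpen D) (m k : ℕ) :
    ∃ C : ℝ≥0, ∀ (w : SobolevSpace D m k p) (b : ℝ≥0),
      SobolevBound D p k b (SobolevSpace.rep w) → ‖w‖ ≤ C * b := by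
  refine ⟨(Fintype.card (DerivIndex d k) : ℝ≥0) ^ (1 / p).toReal, fun w b h => ?_⟩
  have key : ∀ α, ‖w.1 α‖ ≤ b := fun α => by
    obtain ⟨g, hg, hgb, hgw⟩ := h.exists_isWeakWordDeriv (Nat.lt_succ_iff.1 α.1.2) α.2
    have hw : IsWeakWordDeriv D α.2 (SobolevSpace.rep w) (w.1 α) := w.2 α
    have hae := hw.ae_eq hD hp1.out hgw (Lp.memLp _) hg
    rw [Lp.norm_def, eLpNorm_congr_ae hae]
    exact ENNReal.toReal_le_coe_of_le_coe hgb
  have h1 := (PiLp.antilipschitzWith_ofLp p (fun _ : DerivIndex d k =>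
    Lp (EuclideanSpace ℝ (Fin m)) p (volume.restrict D))).le_mul_dist w.1 0
  rw [dist_zero_right] at h1
  refine h1.trans ?_
  gcongr
  rw [WithLp.ofLp_zero, dist_zero_right]
  exact (pi_norm_le_iff_of_nonneg b.2).2 key

/-- Functions with a Sobolev bound represent elements of the Sobolev space. -/
theorem SobolevBound.exists_sobolevSpace (hD : IsOpen D)
    {f : EuclideanSpace ℝ (Fin d) → EuclideanSpace ℝ (Fin m)} {ε : ℝ≥0∞}
    (h : SobolevBound D p k ε f) :
    ∃ u : SobolevSpace D m k p, (SobolevSpace.rep u) =ᵐ[volume.restrict D] f := by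
  choose g hg _ hgw using fun α : DerivIndex d k =>
    h.exists_isWeakWordDeriv (Nat.lt_succ_iff.1 α.1.2) α.2
  have h0 : g (DerivIndex.zero d k) =ᵐ[volume.restrict D] f :=
    (hgw (DerivIndex.zero d k)).ae_eq hD hp1.out
      (isWeakWordDeriv_zero Fin.elim0) (hg _) h.memLp
  refine ⟨⟨WithLp.toLp p fun α => (hg α).toLp (g α), fun α => ?_⟩,
    ((hg _).coeFn_toLp).trans h0⟩
  exact (hgw α).congr (((hg _).coeFn_toLp).trans h0).symm ((hg α).coeFn_toLp).symm

/-- The embedding of the Sobolev space of a bounded domain into `L¹`. -/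
noncomputable def SobolevSpace.toL1 (hD : Bornology.IsBounded D) :
    SobolevSpace D m k p →L[ℝ] Lp (EuclideanSpace ℝ (Fin m)) 1 (volume.restrict D) :=
  haveI : IsFiniteMeasure (volume.restrict D) := isFiniteMeasure_restrict.2 hD.measure_lt_top.ne
  (Lp.inclusionL1 (volume.restrict D) p).comp
    ((PiLp.proj p (fun _ : DerivIndex d k => Lp (EuclideanSpace ℝ (Fin m)) p (volume.restrict D))
      (DerivIndex.zero d k)).comp (SobolevSpace D m k p).subtypeL)

theorem SobolevSpace.rep_ae_eq_toL1 (hD : Bornology.IsBounded D) (u : SobolevSpace D m k p) :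
    SobolevSpace.rep u =ᵐ[volume.restrict D] SobolevSpace.toL1 hD u :=
  haveI : IsFiniteMeasure (volume.restrict D) := isFiniteMeasure_restrict.2 hD.measure_lt_top.ne
  (Lp.coeFn_inclusionL1 (volume.restrict D) p (u.1 (DerivIndex.zero d k))).symm

theorem exists_forall_norm_iteratedFDeriv_le (hD : Bornology.IsBounded D)
    {f : EuclideanSpace ℝ (Fin d) → EuclideanSpace ℝ (Fin m)} (hf : ContDiff ℝ k f) :
    ∃ B : ℝ, ∀ j ≤ k, ∀ x ∈ D, ‖iteratedFDeriv ℝ j f x‖ ≤ B := by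
  have h : ∀ j : Fin (k + 1), ∃ B : ℝ, ∀ x ∈ D, ‖iteratedFDeriv ℝ (j : ℕ) f x‖ ≤ B := fun j => by
    obtain ⟨B, hB⟩ := hD.isCompact_closure.exists_bound_of_continuousOn
      (hf.continuous_iteratedFDeriv (m := (j : ℕ))
        (by exact_mod_cast Nat.lt_succ_iff.1 j.2)).continuousOn
    exact ⟨B, fun x hx => hB x (subset_closure hx)⟩
  choose B hB using h
  refine ⟨∑ j, |B j|, fun j hj x hx => (hB ⟨j, Nat.lt_succ_of_le hj⟩ x hx).trans ?_⟩
  exact (le_abs_self _).trans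
    (Finset.single_le_sum (f := fun j => |B j|) (fun j _ => abs_nonneg _) (Finset.mem_univ _))

theorem SobolevSpace.exists_rep_ae_eq_of_contDiff (hD : IsLipschitzDomain D)
    {f : EuclideanSpace ℝ (Fin d) → EuclideanSpace ℝ (Fin m)} (hf : ContDiff ℝ k f) :
    ∃ u : SobolevSpace D m k p, SobolevSpace.rep u =ᵐ[volume.restrict D] f := by
  obtain ⟨B, hB⟩ := exists_forall_norm_iteratedFDeriv_le hD.isBounded hf
  exact (sobolevBound_of_contDiff hD.isOpen.measurableSet hD.isBounded.measure_lt_top.ne hf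
    hB).exists_sobolevSpace hD.isOpen

/-- Functions of class `Cᵏ` embed continuously into the Sobolev space. -/
theorem SobolevSpace.exists_norm_le_of_contDiff (hD : IsLipschitzDomain D) (m k : ℕ) :
    ∃ C : ℝ, ∀ f : EuclideanSpace ℝ (Fin d) → EuclideanSpace ℝ (Fin m), ContDiff ℝ k f →
      ∃ u : SobolevSpace D m k p, SobolevSpace.rep u =ᵐ[volume.restrict D] f ∧
        ∀ B : ℝ, (∀ j ≤ k, ∀ x ∈ D, ‖iteratedFDeriv ℝ j f x‖ ≤ B) → ‖u‖ ≤ C * B := by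
  have hfin : volume D ≠ ⊤ := hD.isBounded.measure_lt_top.ne
  obtain ⟨C, hC⟩ := SobolevSpace.exists_norm_le_of_sobolevBound (p := p) hD.isOpen m k
  have hpow : volume D ^ p.toReal⁻¹ ≠ ⊤ :=
    ENNReal.rpow_ne_top_of_nonneg (by positivity) hfin
  refine ⟨C * (volume D ^ p.toReal⁻¹).toNNReal, fun f hf => ?_⟩
  obtain ⟨u, hu⟩ := SobolevSpace.exists_rep_ae_eq_of_contDiff (p := p) hD hf
  refine ⟨u, hu, fun B hB => ?_⟩
  have hB0 : 0 ≤ B := by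
    obtain ⟨x, hx⟩ := hD.isConnected.nonempty
    exact (norm_nonneg _).trans (hB 0 (Nat.zero_le k) x hx)
  have h1 := (sobolevBound_of_contDiff (p := p) hD.isOpen.measurableSet hfin hf hB).congr hu.symm
  have h2 := hC u ((volume D ^ p.toReal⁻¹).toNNReal * B.toNNReal) (h1.mono (by
    rw [ENNReal.coe_mul, ENNReal.coe_toNNReal hpow]
    rfl))
  rwa [NNReal.coe_mul, Real.coe_toNNReal _ hB0, ← mul_assoc] at h2

/-- Smooth functions are dense in the Sobolev space. -/
theorem SobolevSpace.exists_contDiff_norm_sub_lt (hp : p ≠ ⊤) (hD : IsLipschitzDomain D)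
    (u : SobolevSpace D m k p) {ε : ℝ} (hε : 0 < ε) :
    ∃ f : EuclideanSpace ℝ (Fin d) → EuclideanSpace ℝ (Fin m), ContDiff ℝ k f ∧
      ∃ v : SobolevSpace D m k p, SobolevSpace.rep v =ᵐ[volume.restrict D] f ∧ ‖u - v‖ < ε := by
  obtain ⟨C, hC⟩ := SobolevSpace.exists_norm_le_of_sobolevBound (p := p) hD.isOpen m k
  obtain ⟨η, hη0, hη⟩ : ∃ η : ℝ≥0, 0 < η ∧ C * (η : ℝ) < ε := by
    have hC0 : (0 : ℝ) < C + 1 := by positivity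
    refine ⟨(ε / (C + 1) / 2).toNNReal, Real.toNNReal_pos.2 (by positivity), ?_⟩
    rw [Real.coe_toNNReal _ (by positivity)]
    have h1 : (C + 1 : ℝ) * (ε / (C + 1) / 2) = ε / 2 := by field_simp
    have h2 : (0 : ℝ) < ε / (C + 1) / 2 := by positivity
    linarith
  obtain ⟨f, hf, hb⟩ := (SobolevSpace.sobolevBound u).exists_contDiff_sub hp hD hη0
  have hfk : ContDiff ℝ k f := hf.of_le (by exact_mod_cast le_top)
  obtain ⟨v, hv⟩ := SobolevSpace.exists_rep_ae_eq_of_contDiff (p := p) hD hfk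
  have hsub := (SobolevSpace.rep_sub_ae_eq u v).trans (Filter.EventuallyEq.rfl.sub hv)
  exact ⟨f, hfk, v, hv, (hC (u - v) η (hb.congr hsub.symm)).trans_lt hη⟩

/-- Sobolev spaces of bounded Lipschitz domains are function spaces of order `k`. -/
theorem SobolevSpace.isFunctionSpace (hp : p ≠ ⊤) (hD : IsLipschitzDomain D) :
    IsFunctionSpace k D (SobolevSpace.toL1 (m := m) (k := k) (p := p) hD.isBounded) := by
  have hrep := SobolevSpace.rep_ae_eq_toL1 (m := m) (k := k) (p := p) hD.isBounded
  refine ⟨?_, ?_, fun u ε hε => ?_⟩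
  · rw [injective_iff_map_eq_zero]
    intro u hu
    obtain ⟨C, hC⟩ := SobolevSpace.exists_norm_le_of_sobolevBound (p := p) hD.isOpen m k
    have h0 : SobolevSpace.rep u =ᵐ[volume.restrict D] 0 :=
      (hrep u).trans (by rw [hu]; exact Lp.coeFn_zero _ _ _)
    have h1 := hC u 0 ((sobolevBound_zero k).congr h0.symm)
    rw [NNReal.coe_zero, mul_zero] at h1
    exact norm_le_zero_iff.1 h1
  · obtain ⟨C, hC⟩ := SobolevSpace.exists_norm_le_of_contDiff (p := p) hD m k
    refine ⟨C, fun f hf => ?_⟩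
    obtain ⟨u, hu, hB⟩ := hC f hf
    exact ⟨u, (hrep u).symm.trans hu, hB⟩
  · have h := SobolevSpace.exists_contDiff_norm_sub_lt (m := m) (k := k) hp hD u hε
    obtain ⟨f, hf, v, hv⟩ := h
    have h1 := (hrep v).symm.trans hv.1
    have h2 := hv.2
    exact ⟨f, hf, v, h1, h2⟩

end

/-! ### Approximation of trajectories -/

theorem setOf_exists_mem_forall_eq {X : Type*} (𝒩 : Set (X → X)) :
    {Φ | ∃ N ∈ 𝒩, ∀ u, Φ u = N u} = 𝒩 := by
  ext Φ
  exact ⟨fun ⟨N, hN, h⟩ => (funext h : Φ = N) ▸ hN, fun h => ⟨Φ, h, fun _ => rfl⟩⟩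

/-- A bounded projection onto a subspace transports approximation from the function space. -/
theorem IsFunctionSpace.approximatesTrajectories_projected {d m k : ℕ}
    {D : Set (EuclideanSpace ℝ (Fin d))} {σ : ℝ → ℝ} {X : Type u} [NormedAddCommGroup X]
    [NormedSpace ℝ X] {ι : X →L[ℝ] Lp (EuclideanSpace ℝ (Fin m)) 1 (volume.restrict D)}
    (hX : IsFunctionSpace k D ι) (hD : IsLipschitzDomain D) (hσ : ContDiff ℝ k σ)
    (hn : IsNonpolynomial σ) (rep : X → EuclideanSpace ℝ (Fin d) → EuclideanSpace ℝ (Fin m))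
    (hrep : ∀ u, rep u =ᵐ[volume.restrict D] ι u) (U : Submodule ℝ X) (π : X →L[ℝ] U)
    (hπ : ∀ u : U, π u = u) :
    ApproximatesTrajectories.{u, v} U (projectedNeuralOperatorMaps σ D rep U π) :=
  hX.approximatesTrajectories hD.isConnected.nonempty hD.isBounded
    hD.isOpen.measurableSet hσ hn rep hrep U.subtypeL π hπ

theorem theorem1 :
    -- infinite dimensions: phase spaces of functions on a Lipschitz domain, neural operators
    (∀ (d m k : ℕ) (D : Set (EuclideanSpace ℝ (Fin d))), IsLipschitzDomain D →
      ∀ σ : ℝ → ℝ, ContDiff ℝ k σ → IsNonpolynomial σ →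
        -- general function spaces, and complemented subspaces of them
        (∀ (X : Type u) [NormedAddCommGroup X] [NormedSpace ℝ X] [CompleteSpace X]
          (ι : X →L[ℝ] Lp (EuclideanSpace ℝ (Fin m)) 1 (volume.restrict D)),
          IsFunctionSpace k D ι →
            ApproximatesTrajectories.{u, v} X (neuralOperatorMaps σ D (fun u => ⇑(ι u))) ∧
            ∀ (U : Submodule ℝ X) (π : X →L[ℝ] U), (∀ u : U, π u = u) →
              ApproximatesTrajectories.{u, v} U
                (projectedNeuralOperatorMaps σ D (fun u => ⇑(ι u)) U π)) ∧
        -- Lebesgue and Sobolev spaces, and complemented subspaces of them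
        (∀ (p : ℝ≥0∞) [Fact (1 ≤ p)], p ≠ ⊤ →
          ApproximatesTrajectories.{0, v} (SobolevSpace D m k p)
            (neuralOperatorMaps σ D SobolevSpace.rep) ∧
          ∀ (U : Submodule ℝ (SobolevSpace D m k p)) (π : SobolevSpace D m k p →L[ℝ] U),
            (∀ u : U, π u = u) →
              ApproximatesTrajectories.{0, v} U
                (projectedNeuralOperatorMaps σ D SobolevSpace.rep U π))) ∧
    -- finite dimensions: Euclidean phase spaces, feed-forward networks
    (∀ (d : ℕ) (σ : ℝ → ℝ), Continuous σ → IsNonpolynomial σ →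
      ApproximatesTrajectories.{0, v} (EuclideanSpace ℝ (Fin d)) (feedForwardMaps σ d)) := by
  refine ⟨fun d m k D hD σ hσ hn => ⟨fun X _ _ _ ι hX => ⟨?_, fun U π hπ => ?_⟩,
    fun p _ hp => ⟨?_, fun U π hπ => ?_⟩⟩, fun d σ hσ hn =>
      approximatesTrajectories_feedForwardMaps d hσ hn⟩
  · have h := hX.approximatesTrajectories hD.isConnected.nonempty hD.isBounded
      hD.isOpen.measurableSet hσ hn (fun u => ⇑(ι u)) (fun _ => Filter.EventuallyEq.rfl)
      (ContinuousLinearMap.id ℝ X) (ContinuousLinearMap.id ℝ X) (fun _ => rfl)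
    exact (setOf_exists_mem_forall_eq (neuralOperatorMaps σ D (fun u => ⇑(ι u)))) ▸ h
  · exact hX.approximatesTrajectories_projected hD hσ hn (fun u => ⇑(ι u))
      (fun _ => Filter.EventuallyEq.rfl) U π hπ
  · have hX := SobolevSpace.isFunctionSpace (m := m) (k := k) (p := p) hp hD
    have h := hX.approximatesTrajectories
      hD.isConnected.nonempty hD.isBounded hD.isOpen.measurableSet hσ hn SobolevSpace.rep
      (SobolevSpace.rep_ae_eq_toL1 hD.isBounded)
      (ContinuousLinearMap.id ℝ _) (ContinuousLinearMap.id ℝ _) (fun _ => rfl)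
    have h' := setOf_exists_mem_forall_eq (neuralOperatorMaps σ D
      (SobolevSpace.rep (D := D) (m := m) (k := k) (p := p)))
    exact h' ▸ h
  · have hX := SobolevSpace.isFunctionSpace (m := m) (k := k) (p := p) hp hD
    exact hX.approximatesTrajectories_projected hD hσ hn SobolevSpace.rep
      (SobolevSpace.rep_ae_eq_toL1 hD.isBounded) U π hπ
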